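/- **Setting.** Primes denote spatial derivatives. Let $T>0$ and $I=(-T,T)$. For $F:I\times\mathbb R\to\mathbb R$ smooth and bounded, a *solution* of the forced KdV equation $$\tfrac{d}{dt}q=-q'''+6qq'+F \qquad\text{on } I\times\mathbb R$$ is a real-valued $q\in L^\infty(I\times\mathbb R)$ with $q(t)\in L^\infty(\mathbb R)$ for every $t\in I$, such that $t\mapsto\int\psi(x)q(t,x)\,dx$ is continuous on $I$ for every $\psi\in C_c^\infty(\mathbb R)$ and $$\iint[\partial_t\phi+\phi''']\,q\,dx\,dt=3\iint\phi'q^2\,dx\,dt-\iint\phi F\,dx\,dt\qquad\text{for all }\phi\in C_c^\infty(I\times\mathbb R).$$ For $\kappa>0$ let $G_0(x,y;\kappa)=\frac1{2\kappa}e^{-\kappa|x-y|}$, the kernel of $R_0(\kappa)=(-\partial_x^2+\kappa^2)^{-1}$. For $q\in L^\infty(\mathbb R)$ with $\kappa^2\ge 4\|q\|_{L^\infty}$ let $$G(x,y;\kappa,q)=\sum_{\ell=0}^\infty(-1)^\ell\big\langle\delta_x,(R_0(\kappa)q)^\ell R_0(\kappa)\delta_y\big\rangle,\qquad g(x;\kappa,q)=G(x,x;\kappa,q),$$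 where $\langle\delta_x,R_0\delta_y\rangle=G_0(x,y;\kappa)$ and $\langle\delta_x,(R_0q)^{\ell+1}R_0\delta_y\rangle=\int G_0(x,z;\kappa)\,q(z)\,\langle\delta_z,(R_0q)^{\ell}R_0\delta_y\rangle\,dz$. **Proposition.** Let $F_1,F_2$ be smooth and bounded, let $q_1,q_2$ be solutions of forced KdV on $I$ with forcing $F_1$, $F_2$ respectively, with $q_1(0)=q_2(0)$ in $L^\infty(\mathbb R)$. Let $\kappa>0$ satisfy $\kappa^2\ge4\max\{\|q_1\|_{L^\infty_{t,x}},\|q_2\|_{L^\infty_{t,x}}\}$, and put $g_j(t,x)=g(x;\kappa,q_j(t))$ and \begin{align*} \widetilde F_j(t,x)&=\int G(x,y;\kappa,q_j(t))\,F_j(t,y)\,G(y,x;\kappa,q_j(t))\,dy,\\ A_2&=-\Big(\frac{g_1'}{g_2}+\frac{g_2'}{g_1}\Big)+2\Big(\frac{g_1'}{g_1}+\frac{g_2'}{g_2}\Big),\\ A_1&=\frac52\Big(\frac{g_1'}{g_1}+\frac{g_2'}{g_2}\Big)^2-7\frac{g_1'g_2'}{g_1g_2}-12\kappa^2+\frac32\frac{(g_1'-g_2')^2}{g_1g_2}+\Big(\frac12-2g_1'g_2'\Big)\Big(\frac1{g_1}-\frac1{g_2}\Big)^2\\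 &\quad+2q_1\frac{g_1}{g_2}+2q_2\frac{g_2}{g_1}+2\kappa^2\Big(\frac{g_1}{g_2}+\frac{g_2}{g_1}\Big)-2(q_1+q_2),\\ A_0&=-\Big(\frac{g_1'}{g_1^3}+\frac{g_2'}{g_2^3}\Big)-\Big(2\kappa^2-\frac{g_1'g_2'}{2g_1g_2}\Big)\Big(\frac{g_1'}{g_1}+\frac{g_2'}{g_2}\Big)-2\Big(\frac{q_1g_2'}{g_2}+\frac{q_2g_1'}{g_1}\Big)+\frac1{2g_1g_2}\Big(\frac{g_1'}{g_2}+\frac{g_2'}{g_1}\Big). \end{align*} Then for every $t\in I$ and $j=1,2$ all integrals in the terms of the Neumann series of $G(x,y;\kappa,q_j(t))$, the series itself, and the integral defining $\widetilde F_j$ converge absolutely, and $g_j(t,\cdot)$ is positive and differentiable. Moreover, for every $-T<t_0<T$ and every real-valued $\psi\in\mathcal S(\mathbb R)$ the following two identities hold, with all integrals absolutely convergent (those with $dx\,dt$ also over the spacetime region between times $0$ and $t_0$): \begin{align*} \Big[\int_{\mathbb R}\frac{(g_1-g_2)^2}{2g_1g_2}\,\psi\,dx\Big](t_0) &=\int_0^{t_0}\!\!\int_{\mathbb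 R}\frac{(g_1-g_2)^2}{2g_1g_2}\Big\{-\frac12\psi'''+\frac32\psi''A_2-\frac32\psi'A_1+\frac32\psi A_0\Big\}\,dx\,dt\\ &\quad+\frac32\int_0^{t_0}\!\!\int_{\mathbb R}\psi'\,\frac{g_1-g_2}{g_1g_2}\Big[2q_1g_1-2q_2g_2+\frac{(g_1')^2}{2g_1}-\frac{(g_2')^2}{2g_2}\Big]\,dx\,dt\\ &\quad-\int_0^{t_0}\!\!\int_{\mathbb R}\psi\,\frac{g_1^2-g_2^2}{2g_1g_2}\Big(\frac{\widetilde F_1}{g_1}-\frac{\widetilde F_2}{g_2}\Big)\,dx\,dt, \end{align*} and, at the fixed time $t_0$, \begin{align*} \int_{\mathbb R}(q_1-q_2)\,\psi\,dx &=\frac14\int_{\mathbb R}(g_1-g_2)\Big\{\psi''\Big(\frac1{g_1}+\frac1{g_2}\Big)+\frac12\psi'\Big[3\Big(\frac1{g_1}+\frac1{g_2}\Big)'+\frac{g_1'+g_2'}{g_1g_2}\Big]\\ &\quad+\psi\Big(-\frac12\Big(\frac1{g_1}+\frac1{g_2}\Big)\Big[2(q_1+q_2)+4\kappa^2-\frac12\Big(\frac1{g_1}+\frac1{g_2}\Big)^2+\frac3{g_1g_2}\Big]\\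 &\quad+\frac34\Big(\frac{(g_1')^2}{g_1^3}+\frac{(g_2')^2}{g_2^3}\Big)-\frac1{4g_1g_2}\Big(\frac{(g_1')^2}{g_1}+\frac{(g_2')^2}{g_2}\Big)\Big)\Big\}\,dx. \end{align*} -/

import Mathlib

open MeasureTheory Set
open scoped ContDiff SchwartzMap ENNReal

noncomputable section

/-- The free Green's function `G₀(x,y;κ) = e^{-κ|x-y|} / (2κ)` of `-∂ₓ² + κ²`. -/
def freeGreen (κ x y : ℝ) : ℝ := 1 / (2 * κ) * Real.exp (-κ * |x - y|)

/-- The integral kernel `⟨δₓ, (R₀ q)^ℓ R₀ δ_y⟩` of `(R₀(κ) q)^ℓ R₀(κ)`, as an iterated integral: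
the kernel at level `ℓ + 1` is `R₀(κ)` applied to `q` times the kernel at level `ℓ`. -/
def greenTerm (κ : ℝ) (q : ℝ → ℝ) : ℕ → ℝ → ℝ → ℝ
  | 0, x, y => freeGreen κ x y
  | l + 1, x, y => ∫ z, freeGreen κ x z * q z * greenTerm κ q l z y

/-- The Green's function `G(x,y;κ,q)` of `-∂ₓ² + q + κ²`, as its Neumann series. -/
def green (κ : ℝ) (q : ℝ → ℝ) (x y : ℝ) : ℝ := ∑' l : ℕ, (-1) ^ l * greenTerm κ q l x y

/-- The diagonal Green's function `g(x;κ,q) = G(x,x;κ,q)`. -/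
def diagGreen (κ : ℝ) (q : ℝ → ℝ) (x : ℝ) : ℝ := green κ q x x

/-- The modified forcing `∫ G(x,y;κ,q) F(y) G(y,x;κ,q) dy` at a fixed time. -/
def modifiedForcing (κ : ℝ) (q F : ℝ → ℝ) (x : ℝ) : ℝ :=
  ∫ y, green κ q x y * F y * green κ q y x

/-- `q : I × ℝ → ℝ` (time first) is a bounded, weak-* continuous, distributional solution of the
forced KdV equation `∂ₜ q = - q''' + 3 (q²)' + F` on the open time interval `I`.
Values of `q` outside `I × ℝ` are irrelevant, and only the classes `q ∈ L^∞(I × ℝ)` and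
`q(t) ∈ L^∞(ℝ)`, `t ∈ I`, matter. -/
structure IsForcedKdVSolution (I : Set ℝ) (F q : ℝ → ℝ → ℝ) : Prop where
  /-- `q ∈ L^∞(I × ℝ)`. -/
  memLp_spacetime : MemLp (fun p : ℝ × ℝ => q p.1 p.2) ∞ (volume.restrict (I ×ˢ univ))
  /-- `q(t) ∈ L^∞(ℝ)` for every time `t ∈ I`. -/
  memLp_slice : ∀ t ∈ I, MemLp (q t) ∞ volume
  /-- Weak-* continuity in time. -/
  weakStar_continuous : ∀ ψ : ℝ → ℝ, ContDiff ℝ ∞ ψ → HasCompactSupport ψ →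
    ContinuousOn (fun t => ∫ x, ψ x * q t x) I
  /-- The equation, tested against `φ ∈ C_c^∞(I × ℝ)`. -/
  distributional : ∀ φ : ℝ × ℝ → ℝ, ContDiff ℝ ∞ φ → HasCompactSupport φ →
    tsupport φ ⊆ I ×ˢ univ →
    ∫ p in I ×ˢ univ, (deriv (fun t => φ (t, p.2)) p.1
        + iteratedDeriv 3 (fun x => φ (p.1, x)) p.2) * q p.1 p.2
      = 3 * (∫ p in I ×ˢ univ, deriv (fun x => φ (p.1, x)) p.2 * q p.1 p.2 ^ 2)
        - ∫ p in I ×ˢ univ, φ p * F p.1 p.2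

/-- The norm of `q` in `L^∞(I × ℝ)`. -/
def spacetimeSupNorm (I : Set ℝ) (q : ℝ → ℝ → ℝ) : ℝ :=
  (eLpNorm (fun p : ℝ × ℝ => q p.1 p.2) ∞ (volume.restrict (I ×ˢ univ))).toReal

/-! In the definitions below everything is at a fixed time, and a prime in the comments is the
spatial derivative. -/

/-- The distance density `(g₁ - g₂)² / (2 g₁ g₂)`. -/
def greenDist (g₁ g₂ : ℝ → ℝ) (x : ℝ) : ℝ := (g₁ x - g₂ x) ^ 2 / (2 * g₁ x * g₂ x)

/-- The coefficient `A₂`. -/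
def coeffA2 (g₁ g₂ : ℝ → ℝ) (x : ℝ) : ℝ :=
  -(deriv g₁ x / g₂ x + deriv g₂ x / g₁ x) + 2 * (deriv g₁ x / g₁ x + deriv g₂ x / g₂ x)

/-- The coefficient `A₁`. -/
def coeffA1 (κ : ℝ) (q₁ q₂ g₁ g₂ : ℝ → ℝ) (x : ℝ) : ℝ :=
  5 / 2 * (deriv g₁ x / g₁ x + deriv g₂ x / g₂ x) ^ 2
    - 7 * (deriv g₁ x * deriv g₂ x / (g₁ x * g₂ x))
    - 12 * κ ^ 2
    + 3 / 2 * ((deriv g₁ x - deriv g₂ x) ^ 2 / (g₁ x * g₂ x))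
    + (1 / 2 - 2 * deriv g₁ x * deriv g₂ x) * (1 / g₁ x - 1 / g₂ x) ^ 2
    + 2 * q₁ x * (g₁ x / g₂ x) + 2 * q₂ x * (g₂ x / g₁ x)
    + 2 * κ ^ 2 * (g₁ x / g₂ x + g₂ x / g₁ x)
    - 2 * (q₁ x + q₂ x)

/-- The coefficient `A₀`. -/
def coeffA0 (κ : ℝ) (q₁ q₂ g₁ g₂ : ℝ → ℝ) (x : ℝ) : ℝ :=
  -(deriv g₁ x / g₁ x ^ 3 + deriv g₂ x / g₂ x ^ 3)
    - (2 * κ ^ 2 - deriv g₁ x * deriv g₂ x / (2 * g₁ x * g₂ x))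
        * (deriv g₁ x / g₁ x + deriv g₂ x / g₂ x)
    - 2 * (q₁ x * deriv g₂ x / g₂ x + q₂ x * deriv g₁ x / g₁ x)
    + 1 / (2 * g₁ x * g₂ x) * (deriv g₁ x / g₂ x + deriv g₂ x / g₁ x)

/-- The first integrand, with the weight `ψ` multiplied into the braces. -/
def bulkIntegrand (κ : ℝ) (q₁ q₂ g₁ g₂ ψ : ℝ → ℝ) (x : ℝ) : ℝ :=
  greenDist g₁ g₂ x *
    (-(1 / 2) * iteratedDeriv 3 ψ x
      + 3 / 2 * iteratedDeriv 2 ψ x * coeffA2 g₁ g₂ x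
      - 3 / 2 * deriv ψ x * coeffA1 κ q₁ q₂ g₁ g₂ x
      + 3 / 2 * ψ x * coeffA0 κ q₁ q₂ g₁ g₂ x)

/-- The second integrand, in which one derivative falls on the weight. -/
def fluxIntegrand (q₁ q₂ g₁ g₂ ψ : ℝ → ℝ) (x : ℝ) : ℝ :=
  deriv ψ x * ((g₁ x - g₂ x) / (g₁ x * g₂ x)) *
    (2 * q₁ x * g₁ x - 2 * q₂ x * g₂ x
      + deriv g₁ x ^ 2 / (2 * g₁ x) - deriv g₂ x ^ 2 / (2 * g₂ x))

/-- The third integrand, which carries the modified forcings `f₁`, `f₂`. -/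
def forcingIntegrand (g₁ g₂ f₁ f₂ ψ : ℝ → ℝ) (x : ℝ) : ℝ :=
  ψ x * ((g₁ x ^ 2 - g₂ x ^ 2) / (2 * g₁ x * g₂ x)) * (f₁ x / g₁ x - f₂ x / g₂ x)

/-- The integrand that expresses `q₁ - q₂` through `g₁ - g₂`, with the weight `ψ` multiplied into
the braces. -/
def qDiffIntegrand (κ : ℝ) (q₁ q₂ g₁ g₂ ψ : ℝ → ℝ) (x : ℝ) : ℝ :=
  (g₁ x - g₂ x) *
    (iteratedDeriv 2 ψ x * (1 / g₁ x + 1 / g₂ x)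
      + 1 / 2 * deriv ψ x *
          (3 * deriv (fun z => 1 / g₁ z + 1 / g₂ z) x
            + (deriv g₁ x + deriv g₂ x) / (g₁ x * g₂ x))
      + ψ x *
          (-(1 / 2) * (1 / g₁ x + 1 / g₂ x) *
              (2 * (q₁ x + q₂ x) + 4 * κ ^ 2 - 1 / 2 * (1 / g₁ x + 1 / g₂ x) ^ 2
                + 3 / (g₁ x * g₂ x))
            + 3 / 4 * (deriv g₁ x ^ 2 / g₁ x ^ 3 + deriv g₂ x ^ 2 / g₂ x ^ 3)
            - 1 / (4 * g₁ x * g₂ x) * (deriv g₁ x ^ 2 / g₁ x + deriv g₂ x ^ 2 / g₂ x)))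

/-- At a potential `q` with forcing profile `F`, the objects that enter the identities exist in the
classical sense: the Neumann series of the Green's function converges absolutely, the diagonal
Green's function is positive and differentiable, and the modified forcing is given by an
absolutely convergent integral. -/
def GreenWellDefined (κ : ℝ) (q F : ℝ → ℝ) : Prop :=
  (∀ l x y, Integrable (fun z => freeGreen κ x z * q z * greenTerm κ q l z y)) ∧
  (∀ x y, Summable (fun l : ℕ => |greenTerm κ q l x y|)) ∧
  (∀ x, 0 < diagGreen κ q x) ∧
  Differentiable ℝ (diagGreen κ q) ∧
  (∀ x, Integrable (fun y => green κ q x y * F y * green κ q y x))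

end

section
open MeasureTheory Set Filter Topology
open scoped ContDiff SchwartzMap ENNReal

noncomputable section

/-! ### The free resolvent -/

/-! Fixed time. The resolvent equation `G = G₀ - R₀ q G` shows that `G(·,y)` solves `u'' = (q + κ²)
u` off its pole when `q` is continuous, and the Neumann series at `κ² ≥ 4 ‖q‖` gives exponential
decay and `1/(3κ) ≤ g ≤ 2/(3κ)`, `|g'| ≤ 1/3`. The Wronskian of two Green's functions with different
poles vanishes beyond both poles. Hence `G(z,x) G(z,y) = g(z) G(y,x)` for nearby `x < z < y`
(`green_mul_green_eq`), and differentiating this product yields `g'' = 2 (q + κ²) g + ((g')² - 1) /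
(2 g)` (`hasDerivAt_diagGreen_and_greenSlope`). With this equation the second identity says that an
explicit expression in `g`, `g'`, `ψ`, `ψ'` has integrable derivative and vanishes at infinity
(`hasDerivAt_qDiffFlux`).

Evolution. The second resolvent identity gives `∂ₜ g = -∫ G² ∂ₜ q`. The function `G²` is annihilated
by the adjoint of `-∂³ + 4 (q + κ²) ∂ + 2 q'` up to a term on the diagonal
(`integral_green_sq_mul`), so along forced KdV `∂ₜ g = -2 g q' + 2 q g' - 4 κ² g' - F̃`
(`integral_green_sq_mul_kdv`). The time derivative of `(g₁ - g₂)²/(2 g₁ g₂)` is `(g₁² - g₂²)/(2 g₁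
g₂)` times `∂ₜ g₁/g₁ - ∂ₜ g₂/g₂`. After multiplication by `ψ` it differs from the integrands of the
first identity by an exact spatial derivative (`hasDerivAt_rhsFlux`). No derivative of `q₁`, `q₂`
remains, so the result makes sense for bounded potentials.

Rough solutions. Both formulas need smooth potentials, and bounded ones are reached by
mollification. A spacetime mollification of a solution solves forced KdV with the extra term `3
((q²)ₙ - qₙ²)'`. Integrating by parts against `G²` removes that derivative, and the commutator is
bounded and tends to zero almost everywhere, so its contribution vanishes in the limit
(`tendsto_commForcing`). The maps `q ↦ g` and `q ↦ g'` are continuous from bounded sets with weak-*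
convergence to pointwise convergence (`WeakTendsto.tendsto_greenTerm`), and all other quantities
pass to the limit by dominated convergence. This proves the first identity between almost all pairs
of times (`wdist_sub_wdist`). Weak-* continuity in time makes the left side continuous, which
extends it to all times, and equality of the data at time zero fixes the constant
(`wdist_eq_integral`). -/

theorem integrable_exp_neg_mul_abs_sub {a : ℝ} (ha : 0 < a) (x : ℝ) :
    Integrable (fun z : ℝ => Real.exp (-a * |x - z|)) := by
  have h : Integrable (fun z : ℝ => Real.exp (-a * |z|)) := by
    rw [← integrableOn_univ, ← Iic_union_Ioi (a := (0 : ℝ))]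
    refine IntegrableOn.union ?_ ?_
    · refine (integrableOn_exp_mul_Iic ha 0).congr_fun (fun z hz => ?_) measurableSet_Iic
      simp only [abs_of_nonpos (mem_Iic.1 hz)]
      ring_nf
    · refine (integrableOn_exp_mul_Ioi (neg_lt_zero.2 ha) 0).congr_fun (fun z hz => ?_)
        measurableSet_Ioi
      simp only [abs_of_pos (mem_Ioi.1 hz)]
  exact h.comp_sub_left x

theorem integral_exp_neg_mul_abs_sub {a : ℝ} (ha : 0 < a) (x : ℝ) :
    ∫ z : ℝ, Real.exp (-a * |x - z|) = 2 / a := by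
  rw [integral_sub_left_eq_self (fun z => Real.exp (-a * |z|)),
    integral_comp_abs (f := fun z => Real.exp (-a * z)), integral_exp_mul_Ioi (neg_lt_zero.2 ha)]
  simp
  field_simp

/-- The spatial derivative of the free Green's function in its first variable. -/
def freeGreenD (κ x z : ℝ) : ℝ := (if x < z then 1 / 2 else -(1 / 2)) * Real.exp (-κ * |x - z|)

/-- The free resolvent `R₀(κ)` applied to a function. -/
def res (κ : ℝ) (f : ℝ → ℝ) (x : ℝ) : ℝ := ∫ z, freeGreen κ x z * f z

/-- The derivative of the free resolvent applied to a function. -/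
def resD (κ : ℝ) (f : ℝ → ℝ) (x : ℝ) : ℝ := ∫ z, freeGreenD κ x z * f z

theorem freeGreen_symm (κ x y : ℝ) : freeGreen κ x y = freeGreen κ y x := by
  simp only [freeGreen, abs_sub_comm]

theorem continuous_freeGreen (κ : ℝ) : Continuous (fun p : ℝ × ℝ => freeGreen κ p.1 p.2) := by
  unfold freeGreen
  fun_prop

theorem freeGreen_pos {κ : ℝ} (hκ : 0 < κ) (x y : ℝ) : 0 < freeGreen κ x y := by
  unfold freeGreen
  positivity

theorem measurable_freeGreenD (κ x : ℝ) : Measurable (freeGreenD κ x) := by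
  unfold freeGreenD
  refine Measurable.mul ?_ (by fun_prop)
  exact Measurable.ite measurableSet_Ioi measurable_const measurable_const

theorem abs_freeGreenD (κ x z : ℝ) : |freeGreenD κ x z| = 1 / 2 * Real.exp (-κ * |x - z|) := by
  unfold freeGreenD
  rw [abs_mul, abs_of_pos (Real.exp_pos _)]
  split_ifs <;> norm_num

theorem abs_freeGreen {κ : ℝ} (hκ : 0 < κ) (x z : ℝ) :
    |freeGreen κ x z| = 1 / (2 * κ) * Real.exp (-κ * |x - z|) := by
  rw [abs_of_pos (freeGreen_pos hκ x z), freeGreen]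

theorem integrable_freeGreen {κ : ℝ} (hκ : 0 < κ) (x : ℝ) : Integrable (freeGreen κ x) :=
  (integrable_exp_neg_mul_abs_sub hκ x).const_mul _

theorem integrable_freeGreenD {κ : ℝ} (hκ : 0 < κ) (x : ℝ) : Integrable (freeGreenD κ x) := by
  refine ((integrable_exp_neg_mul_abs_sub hκ x).const_mul (1 / 2)).mono'
    (measurable_freeGreenD κ x).aestronglyMeasurable (Eventually.of_forall fun z => ?_)
  rw [Real.norm_eq_abs, abs_freeGreenD]

theorem hasDerivAt_freeGreen {κ : ℝ} (hκ : 0 < κ) {x z : ℝ} (h : x ≠ z) :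
    HasDerivAt (fun x => freeGreen κ x z) (freeGreenD κ x z) x := by
  rcases lt_or_gt_of_ne h with h | h
  · have h1 : HasDerivAt (fun x => 1 / (2 * κ) * Real.exp (-κ * (z - x))) (freeGreenD κ x z) x := by
      convert! ((((hasDerivAt_id x).const_sub z).const_mul (-κ)).exp).const_mul (1 / (2 * κ)) using 1
      rw [freeGreenD, if_pos h, abs_of_neg (sub_neg.2 h)]
      simp
      field_simp
    refine h1.congr_of_eventuallyEq ?_
    filter_upwards [eventually_lt_nhds h] with y hy
    rw [freeGreen, abs_of_neg (sub_neg.2 hy), neg_sub]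
  · have h1 : HasDerivAt (fun x => 1 / (2 * κ) * Real.exp (-κ * (x - z))) (freeGreenD κ x z) x := by
      convert! ((((hasDerivAt_id x).sub_const z).const_mul (-κ)).exp).const_mul (1 / (2 * κ)) using 1
      rw [freeGreenD, if_neg h.not_gt, abs_of_pos (sub_pos.2 h)]
      simp
      field_simp
    refine h1.congr_of_eventuallyEq ?_
    filter_upwards [eventually_gt_nhds h] with y hy
    rw [freeGreen, abs_of_pos (sub_pos.2 hy)]

theorem hasDerivAt_freeGreenD {κ : ℝ} (hκ : 0 < κ) {x z : ℝ} (h : x ≠ z) :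
    HasDerivAt (fun x => freeGreenD κ x z) (κ ^ 2 * freeGreen κ x z) x := by
  rcases lt_or_gt_of_ne h with h | h
  · have h1 : HasDerivAt (fun x => 1 / 2 * Real.exp (-κ * (z - x))) (κ ^ 2 * freeGreen κ x z) x := by
      convert! ((((hasDerivAt_id x).const_sub z).const_mul (-κ)).exp).const_mul (1 / 2) using 1
      rw [freeGreen, abs_of_neg (sub_neg.2 h)]
      simp
      field_simp
    refine h1.congr_of_eventuallyEq ?_
    filter_upwards [eventually_lt_nhds h] with y hy
    rw [freeGreenD, if_pos hy, abs_of_neg (sub_neg.2 hy), neg_sub]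
  · have h1 : HasDerivAt (fun x => -(1 / 2) * Real.exp (-κ * (x - z)))
        (κ ^ 2 * freeGreen κ x z) x := by
      convert! ((((hasDerivAt_id x).sub_const z).const_mul (-κ)).exp).const_mul (-(1 / 2)) using 1
      rw [freeGreen, abs_of_pos (sub_pos.2 h)]
      simp
      field_simp
    refine h1.congr_of_eventuallyEq ?_
    filter_upwards [eventually_gt_nhds h] with y hy
    rw [freeGreenD, if_neg hy.not_gt, abs_of_pos (sub_pos.2 hy)]

theorem ae_ne_volume (x : ℝ) : ∀ᵐ z : ℝ, x ≠ z := by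
  have := Measure.ae_ne volume x
  filter_upwards [this] with z hz using hz.symm

section Bounded
variable {κ C : ℝ} {f : ℝ → ℝ}

theorem integrable_freeGreen_mul (hκ : 0 < κ) (hf : AEStronglyMeasurable f volume)
    (hb : ∀ᵐ z, |f z| ≤ C) (x : ℝ) : Integrable (fun z => freeGreen κ x z * f z) :=
  (integrable_freeGreen hκ x).mul_bdd (c := C) hf (by simpa using hb)

theorem integrable_freeGreenD_mul (hκ : 0 < κ) (hf : AEStronglyMeasurable f volume)
    (hb : ∀ᵐ z, |f z| ≤ C) (x : ℝ) : Integrable (fun z => freeGreenD κ x z * f z) :=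
  (integrable_freeGreenD hκ x).mul_bdd (c := C) hf (by simpa using hb)

/-- The triangle inequality moves the weight from `z` to `x`, at the price of lowering the decay
rate of the kernel from `κ` to `κ - b`. -/
theorem exp_weight_le {b x y z : ℝ} (hb : 0 ≤ b) :
    Real.exp (-κ * |x - z|) * Real.exp (-b * |z - y|)
      ≤ Real.exp (-b * |x - y|) * Real.exp (-(κ - b) * |x - z|) := by
  rw [← Real.exp_add, ← Real.exp_add, Real.exp_le_exp]
  nlinarith [mul_le_mul_of_nonneg_left (abs_sub_le x z y) hb]

/-- A kernel dominated by `A e^{-κ|x-z|}` preserves the exponential weight `e^{-b|z-y|}`. -/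
theorem abs_integral_le_of_exp_weight {A b y x : ℝ} {K : ℝ → ℝ} (hA : 0 ≤ A) (hb : 0 ≤ b)
    (hbκ : b < κ) (hK : ∀ z, |K z| ≤ A * Real.exp (-κ * |x - z|))
    (hf : ∀ᵐ z, |f z| ≤ C * Real.exp (-b * |z - y|)) :
    |∫ z, K z * f z| ≤ A * C * (2 / (κ - b)) * Real.exp (-b * |x - y|) := by
  have hC : 0 ≤ C := by
    obtain ⟨z, hz⟩ := hf.exists
    exact nonneg_of_mul_nonneg_left ((abs_nonneg _).trans hz) (Real.exp_pos _)
  have hint := (integrable_exp_neg_mul_abs_sub (sub_pos.2 hbκ) x).const_mul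
    (A * C * Real.exp (-b * |x - y|))
  refine (abs_integral_le_integral_abs).trans ((integral_mono_of_nonneg
    (Eventually.of_forall fun z => abs_nonneg _) hint ?_).trans ?_)
  · filter_upwards [hf] with z hz
    calc |K z * f z| = |K z| * |f z| := abs_mul _ _
      _ ≤ (A * Real.exp (-κ * |x - z|)) * (C * Real.exp (-b * |z - y|)) :=
          mul_le_mul (hK z) hz (abs_nonneg _) (by positivity)
      _ = A * C * (Real.exp (-κ * |x - z|) * Real.exp (-b * |z - y|)) := by ring
      _ ≤ A * C * (Real.exp (-b * |x - y|) * Real.exp (-(κ - b) * |x - z|)) :=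
          mul_le_mul_of_nonneg_left (exp_weight_le hb) (by positivity)
      _ = _ := by ring
  · rw [integral_const_mul, integral_exp_neg_mul_abs_sub (sub_pos.2 hbκ)]
    apply le_of_eq
    ring

theorem abs_res_le_of_exp_weight {b y : ℝ} (hb : 0 ≤ b) (hbκ : b < κ)
    (hf : ∀ᵐ z, |f z| ≤ C * Real.exp (-b * |z - y|)) (x : ℝ) :
    |res κ f x| ≤ C / (κ * (κ - b)) * Real.exp (-b * |x - y|) := by
  have hκ : 0 < κ := hb.trans_lt hbκ
  refine (abs_integral_le_of_exp_weight (A := 1 / (2 * κ)) (by positivity) hb hbκ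
    (fun z => (abs_freeGreen hκ x z).le) hf).trans (le_of_eq ?_)
  have : κ - b ≠ 0 := (sub_pos.2 hbκ).ne'
  field_simp

theorem abs_resD_le_of_exp_weight {b y : ℝ} (hb : 0 ≤ b) (hbκ : b < κ)
    (hf : ∀ᵐ z, |f z| ≤ C * Real.exp (-b * |z - y|)) (x : ℝ) :
    |resD κ f x| ≤ C / (κ - b) * Real.exp (-b * |x - y|) := by
  refine (abs_integral_le_of_exp_weight (A := 1 / 2) (by positivity) hb hbκ
    (fun z => (abs_freeGreenD κ x z).le) hf).trans (le_of_eq ?_)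
  have : κ - b ≠ 0 := (sub_pos.2 hbκ).ne'
  field_simp

theorem abs_resD_le (hκ : 0 < κ) (hf : ∀ᵐ z, |f z| ≤ C) (x : ℝ) : |resD κ f x| ≤ C / κ := by
  have := abs_resD_le_of_exp_weight (f := f) (C := C) (κ := κ) le_rfl hκ (y := 0)
    (by simpa using hf) x
  simpa using this

theorem abs_exp_neg_sub_exp_neg_le {κ a b m : ℝ} (hκ : 0 < κ) (ha : m ≤ a) (hb : m ≤ b) :
    |Real.exp (-κ * a) - Real.exp (-κ * b)| ≤ κ * Real.exp (-κ * m) * |a - b| := by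
  wlog h : a ≤ b generalizing a b
  · rw [abs_sub_comm, abs_sub_comm a]
    exact this hb ha (not_le.1 h).le
  have h1 : Real.exp (-κ * b) = Real.exp (-κ * a) * Real.exp (-(κ * (b - a))) := by
    rw [← Real.exp_add]; ring_nf
  have h2 : 1 - κ * (b - a) ≤ Real.exp (-(κ * (b - a))) := by
    have := Real.add_one_le_exp (-(κ * (b - a))); linarith
  have h3 : Real.exp (-κ * a) ≤ Real.exp (-κ * m) := Real.exp_le_exp.2 (by nlinarith)
  have h4 : 0 ≤ κ * (b - a) := mul_nonneg hκ.le (sub_nonneg.2 h)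
  have h5 : Real.exp (-(κ * (b - a))) ≤ 1 := Real.exp_le_one_iff.2 (by linarith)
  have h6 := Real.exp_pos (-κ * a)
  rw [h1, abs_of_nonneg (by nlinarith), abs_sub_comm a, abs_of_nonneg (sub_nonneg.2 h)]
  nlinarith

/-- The free Green's function is Lipschitz in its first variable, locally uniformly with an
integrable constant. -/
theorem abs_freeGreen_sub_le (hκ : 0 < κ) {x₀ x y z : ℝ} (hx : |x - x₀| ≤ 1) (hy : |y - x₀| ≤ 1) :
    |freeGreen κ x z - freeGreen κ y z|
      ≤ 1 / 2 * Real.exp κ * Real.exp (-κ * |x₀ - z|) * |x - y| := by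
  have h1 : |x₀ - z| - 1 ≤ |x - z| := by
    have := abs_sub_le x₀ x z; rw [abs_sub_comm x₀ x] at this; linarith
  have h2 : |x₀ - z| - 1 ≤ |y - z| := by
    have := abs_sub_le x₀ y z; rw [abs_sub_comm x₀ y] at this; linarith
  have h3 := abs_exp_neg_sub_exp_neg_le hκ h1 h2
  have h4 : abs (|x - z| - |y - z|) ≤ |x - y| := by
    have := abs_abs_sub_abs_le_abs_sub (x - z) (y - z)
    simpa using this
  have h5 : Real.exp (-κ * (|x₀ - z| - 1)) = Real.exp κ * Real.exp (-κ * |x₀ - z|) := by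
    rw [← Real.exp_add]; ring_nf
  rw [freeGreen, freeGreen, ← mul_sub, abs_mul, abs_of_pos (by positivity : 0 < 1 / (2 * κ))]
  calc _ ≤ 1 / (2 * κ) * (κ * (Real.exp κ * Real.exp (-κ * |x₀ - z|)) * |x - y|) := by
        rw [← h5]
        gcongr
        exact h3.trans (mul_le_mul_of_nonneg_left h4 (by positivity))
    _ = _ := by field_simp

/-- No regularity of `f` is needed: the kernel is Lipschitz in `x` with a constant integrable in
`z`, and its kink `z = x` is a null set. -/
theorem hasDerivAt_res (hκ : 0 < κ) (hf : AEStronglyMeasurable f volume)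
    (hb : ∀ᵐ z, |f z| ≤ C) (x : ℝ) : HasDerivAt (res κ f) (resD κ f x) x := by
  have hC : 0 ≤ C := by
    obtain ⟨z, hz⟩ := hb.exists
    exact (abs_nonneg _).trans hz
  refine (hasDerivAt_integral_of_dominated_loc_of_lip (𝕜 := ℝ) (F := fun x z => freeGreen κ x z * f z)
    (F' := fun z => freeGreenD κ x z * f z) (s := Metric.closedBall x 1)
    (bound := fun z => 1 / 2 * Real.exp κ * C * Real.exp (-κ * |x - z|))
    (Metric.closedBall_mem_nhds _ one_pos)
    (Eventually.of_forall fun y => (integrable_freeGreen_mul hκ hf hb y).aestronglyMeasurable)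
    (integrable_freeGreen_mul hκ hf hb x)
    (integrable_freeGreenD_mul hκ hf hb x).aestronglyMeasurable ?_
    ((integrable_exp_neg_mul_abs_sub hκ x).const_mul _) ?_).2
  · filter_upwards [hb] with z hz
    refine LipschitzOnWith.of_dist_le_mul fun a ha b hb' => ?_
    rw [Metric.mem_closedBall, Real.dist_eq] at ha hb'
    rw [Real.dist_eq, Real.dist_eq, Real.coe_nnabs, abs_of_nonneg
      (by positivity : 0 ≤ 1 / 2 * Real.exp κ * C * Real.exp (-κ * |x - z|)), ← sub_mul, abs_mul]
    calc _ ≤ 1 / 2 * Real.exp κ * Real.exp (-κ * |x - z|) * |a - b| * C :=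
          mul_le_mul (abs_freeGreen_sub_le hκ ha hb') hz (abs_nonneg _) (by positivity)
      _ = _ := by ring
  · filter_upwards [ae_ne_volume x] with z hz
    exact (hasDerivAt_freeGreen hκ hz).mul_const _

theorem continuous_res (hκ : 0 < κ) (hf : AEStronglyMeasurable f volume)
    (hb : ∀ᵐ z, |f z| ≤ C) : Continuous (res κ f) :=
  continuous_iff_continuousAt.2 fun x => (hasDerivAt_res hκ hf hb x).continuousAt

theorem hasDerivAt_integral_Iic {h : ℝ → ℝ} (hc : Continuous h)
    (hi : ∀ x, IntegrableOn h (Iic x)) (x : ℝ) :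
    HasDerivAt (fun x => ∫ z in Iic x, h z) (h x) x := by
  have h1 : (fun x => ∫ z in Iic x, h z) = fun x => (∫ z in Iic 0, h z) + ∫ z in (0 : ℝ)..x, h z := by
    funext x
    rw [← intervalIntegral.integral_Iic_sub_Iic (hi 0) (hi x)]
    ring
  rw [h1]
  exact (intervalIntegral.integral_hasDerivAt_right (hc.intervalIntegrable _ _)
    (hc.stronglyMeasurableAtFilter _ _) hc.continuousAt).const_add _

theorem hasDerivAt_integral_Ioi {h : ℝ → ℝ} (hc : Continuous h)
    (hi : ∀ x, IntegrableOn h (Ioi x)) (x : ℝ) :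
    HasDerivAt (fun x => ∫ z in Ioi x, h z) (-h x) x := by
  have h1 : (fun x => ∫ z in Ioi x, h z) = fun x => (∫ z in Ioi 0, h z) - ∫ z in (0 : ℝ)..x, h z := by
    funext x
    rw [← intervalIntegral.integral_interval_add_Ioi (hi 0) (hi x)]
    ring
  rw [h1]
  exact (intervalIntegral.integral_hasDerivAt_right (hc.intervalIntegrable _ _)
    (hc.stronglyMeasurableAtFilter _ _) hc.continuousAt).const_sub _

theorem integrableOn_exp_mul_bdd_Iic (hκ : 0 < κ) (hc : Continuous f) (hb : ∀ z, |f z| ≤ C)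
    (x : ℝ) : IntegrableOn (fun z => Real.exp (κ * z) * f z) (Iic x) :=
  (integrableOn_exp_mul_Iic hκ x).mul_bdd (c := C) hc.aestronglyMeasurable
    (Eventually.of_forall fun z => hb z)

theorem integrableOn_exp_mul_bdd_Ioi (hκ : 0 < κ) (hc : Continuous f) (hb : ∀ z, |f z| ≤ C)
    (x : ℝ) : IntegrableOn (fun z => Real.exp (-κ * z) * f z) (Ioi x) :=
  (integrableOn_exp_mul_Ioi (neg_lt_zero.2 hκ) x).mul_bdd (c := C) hc.aestronglyMeasurable
    (Eventually.of_forall fun z => hb z)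

/-- Cutting the integral at `z = x` factors the exponentials and leaves two primitives of continuous
functions. The jump of the kernel at the cut contributes `-f x`, which is why continuity of `f` is
required here. -/
theorem hasDerivAt_resD (hκ : 0 < κ) (hc : Continuous f) (hb : ∀ z, |f z| ≤ C) (x : ℝ) :
    HasDerivAt (resD κ f) (κ ^ 2 * res κ f x - f x) x := by
  have hbae : ∀ᵐ z, |f z| ≤ C := Eventually.of_forall hb
  have e1 : ∀ x, resD κ f x = -(1 / 2) * (Real.exp (-κ * x) * ∫ z in Iic x, Real.exp (κ * z) * f z)
      + 1 / 2 * (Real.exp (κ * x) * ∫ z in Ioi x, Real.exp (-κ * z) * f z) := by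
    intro x
    have hi := integrable_freeGreenD_mul hκ hc.aestronglyMeasurable hbae x
    rw [resD, ← integral_add_compl measurableSet_Iic hi, compl_Iic]
    simp only [← integral_const_mul]
    congr 1
    · refine setIntegral_congr_fun measurableSet_Iic fun z hz => ?_
      have hz : z ≤ x := hz
      simp only [freeGreenD]
      rw [if_neg hz.not_gt, abs_of_nonneg (sub_nonneg.2 hz),
        show -κ * (x - z) = -κ * x + κ * z by ring, Real.exp_add]
      ring
    · refine setIntegral_congr_fun measurableSet_Ioi fun z hz => ?_
      have hz : x < z := hz
      simp only [freeGreenD]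
      rw [if_pos hz, abs_of_neg (sub_neg.2 hz),
        show -κ * -(x - z) = κ * x + -κ * z by ring, Real.exp_add]
      ring
  have e2 : ∀ x, res κ f x = 1 / (2 * κ) * (Real.exp (-κ * x) * ∫ z in Iic x, Real.exp (κ * z) * f z)
      + 1 / (2 * κ) * (Real.exp (κ * x) * ∫ z in Ioi x, Real.exp (-κ * z) * f z) := by
    intro x
    have hi := integrable_freeGreen_mul hκ hc.aestronglyMeasurable hbae x
    rw [res, ← integral_add_compl measurableSet_Iic hi, compl_Iic]
    simp only [← integral_const_mul]
    congr 1
    · refine setIntegral_congr_fun measurableSet_Iic fun z hz => ?_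
      have hz : z ≤ x := hz
      simp only [freeGreen]
      rw [abs_of_nonneg (sub_nonneg.2 hz),
        show -κ * (x - z) = -κ * x + κ * z by ring, Real.exp_add]
      ring
    · refine setIntegral_congr_fun measurableSet_Ioi fun z hz => ?_
      have hz : x < z := hz
      simp only [freeGreen]
      rw [abs_of_neg (sub_neg.2 hz),
        show -κ * -(x - z) = κ * x + -κ * z by ring, Real.exp_add]
      ring
  have d1 := hasDerivAt_integral_Iic (h := fun z => Real.exp (κ * z) * f z) (by fun_prop)
    (integrableOn_exp_mul_bdd_Iic hκ hc hb) x
  have d2 := hasDerivAt_integral_Ioi (h := fun z => Real.exp (-κ * z) * f z) (by fun_prop)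
    (integrableOn_exp_mul_bdd_Ioi hκ hc hb) x
  have x1 : HasDerivAt (fun x => Real.exp (-κ * x)) (Real.exp (-κ * x) * (-κ)) x := by
    simpa using ((hasDerivAt_id x).const_mul (-κ)).exp
  have x2 : HasDerivAt (fun x => Real.exp (κ * x)) (Real.exp (κ * x) * κ) x := by
    simpa using ((hasDerivAt_id x).const_mul κ).exp
  have key := ((x1.mul d1).const_mul (-(1 / 2))).add ((x2.mul d2).const_mul (1 / 2))
  rw [show resD κ f = _ from funext e1, e2]
  convert! key using 1
  have h1 : Real.exp (-(κ * x)) * Real.exp (κ * x) = 1 := by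
    rw [← Real.exp_add]; simp
  simp only [neg_mul]
  field_simp
  linear_combination (2 * f x) * h1

end Bounded

/-- The free resolvent is symmetric. -/
theorem integral_mul_res_comm {κ : ℝ} (hκ : 0 < κ) {f h : ℝ → ℝ} (hf : Integrable f)
    (hhi : Integrable h) :
    ∫ z, f z * res κ h z = ∫ z, h z * res κ f z := by
  have hint : Integrable (fun p : ℝ × ℝ => f p.1 * h p.2 * freeGreen κ p.1 p.2)
      (volume.prod volume) := by
    refine (hf.mul_prod hhi).mul_bdd (c := 1 / (2 * κ))
      (continuous_freeGreen κ).aestronglyMeasurable (Eventually.of_forall fun p => ?_)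
    rw [Real.norm_eq_abs, abs_freeGreen hκ]
    refine mul_le_of_le_one_right (by positivity) (Real.exp_le_one_iff.2 ?_)
    nlinarith [abs_nonneg (p.1 - p.2)]
  have h1 : ∀ z, f z * res κ h z = ∫ y, f z * h y * freeGreen κ z y := fun z => by
    rw [res, ← integral_const_mul]
    exact integral_congr_ae (Eventually.of_forall fun y => by ring)
  have h2 : ∀ z, h z * res κ f z = ∫ y, f y * h z * freeGreen κ y z := fun z => by
    rw [res, ← integral_const_mul]
    refine integral_congr_ae (Eventually.of_forall fun y => ?_)
    simp only [freeGreen_symm κ z y]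
    ring
  simp only [h1, h2]
  exact integral_integral_swap (f := fun x y => f x * h y * freeGreen κ x y) hint

end
end

section
open MeasureTheory Set Filter Topology
open scoped ContDiff SchwartzMap ENNReal

noncomputable section

/-! ### The Green's function of a small bounded potential -/

/-- Potentials for which the Neumann series at `κ` converges: `κ² ≥ 4 ‖q‖`. -/
structure Adm (κ : ℝ) (q : ℝ → ℝ) : Prop where
  meas : AEStronglyMeasurable q volume
  bound : ∀ᵐ x, |q x| ≤ κ ^ 2 / 4

theorem greenTerm_succ (κ : ℝ) (q : ℝ → ℝ) (l : ℕ) (x y : ℝ) :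
    greenTerm κ q (l + 1) x y = res κ (fun z => q z * greenTerm κ q l z y) x := by
  simp only [greenTerm, res, mul_assoc]

section Single
variable {κ : ℝ} {q : ℝ → ℝ}

/-- Each factor `R₀ q` preserves the weight `e^{-b|·-y|}` with constant `(κ²/4) / (κ (κ - b))`.
Taking `b = 0` gives the ratio `1/4` needed for sharp bounds on the diagonal, and `b = κ/2` gives
the ratio `1/2` together with decay. Continuity joins the induction because it makes the next
integrand measurable. -/
theorem abs_greenTerm_le_aux (hq : Adm κ q) {b : ℝ} (hb : 0 ≤ b) (hbκ : b < κ) (l : ℕ) (y : ℝ) :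
    Continuous (fun z => greenTerm κ q l z y) ∧ ∀ x, |greenTerm κ q l x y|
      ≤ (κ / (4 * (κ - b))) ^ l * (1 / (2 * κ)) * Real.exp (-b * |x - y|) := by
  have hκ : 0 < κ := hb.trans_lt hbκ
  have hκb : 0 < κ - b := sub_pos.2 hbκ
  induction l with
  | zero =>
    refine ⟨(continuous_freeGreen κ).comp (by fun_prop : Continuous fun z : ℝ => (z, y)),
      fun x => ?_⟩
    rw [greenTerm, abs_freeGreen hκ, pow_zero, one_mul]
    refine mul_le_mul_of_nonneg_left (Real.exp_le_exp.2 ?_) (by positivity)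
    nlinarith [abs_nonneg (x - y)]
  | succ l ih =>
    obtain ⟨hc, hbd⟩ := ih
    have hm : AEStronglyMeasurable (fun z => q z * greenTerm κ q l z y) volume :=
      hq.meas.mul hc.aestronglyMeasurable
    have h1 : ∀ᵐ z, |q z * greenTerm κ q l z y|
        ≤ κ ^ 2 / 4 * ((κ / (4 * (κ - b))) ^ l * (1 / (2 * κ))) * Real.exp (-b * |z - y|) := by
      filter_upwards [hq.bound] with z hz
      rw [abs_mul, mul_assoc]
      exact mul_le_mul hz (hbd z) (abs_nonneg _) (by positivity)
    have h2 : ∀ᵐ z, |q z * greenTerm κ q l z y|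
        ≤ κ ^ 2 / 4 * ((κ / (4 * (κ - b))) ^ l * (1 / (2 * κ))) := by
      filter_upwards [h1] with z hz
      refine hz.trans (mul_le_of_le_one_right (by positivity) (Real.exp_le_one_iff.2 ?_))
      nlinarith [abs_nonneg (z - y)]
    simp only [greenTerm_succ]
    refine ⟨continuous_res hκ hm h2, fun x => (abs_res_le_of_exp_weight hb hbκ h1 x).trans
      (le_of_eq ?_)⟩
    rw [pow_succ _ l]
    generalize (κ / (4 * (κ - b))) ^ l = r
    field_simp

theorem continuous_greenTerm (hκ : 0 < κ) (hq : Adm κ q) (l : ℕ) (y : ℝ) :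
    Continuous (fun z => greenTerm κ q l z y) := (abs_greenTerm_le_aux hq le_rfl hκ l y).1

theorem abs_greenTerm_le (hκ : 0 < κ) (hq : Adm κ q) (l : ℕ) (x y : ℝ) :
    |greenTerm κ q l x y| ≤ (1 / 4) ^ l * (1 / (2 * κ)) := by
  have := (abs_greenTerm_le_aux hq le_rfl hκ l y).2 x
  rw [show κ / (4 * (κ - 0)) = 1 / 4 by rw [sub_zero]; field_simp] at this
  simpa using this

theorem abs_greenTerm_le_exp (hκ : 0 < κ) (hq : Adm κ q) (l : ℕ) (x y : ℝ) :
    |greenTerm κ q l x y| ≤ (1 / 2) ^ l * (1 / (2 * κ) * Real.exp (-(κ / 2) * |x - y|)) := by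
  have := (abs_greenTerm_le_aux hq (half_pos hκ).le (half_lt_self hκ) l y).2 x
  rw [show κ / (4 * (κ - κ / 2)) = 1 / 2 by field_simp; ring, mul_assoc] at this
  exact this

theorem summable_abs_greenTerm (hκ : 0 < κ) (hq : Adm κ q) (x y : ℝ) :
    Summable (fun l : ℕ => |greenTerm κ q l x y|) :=
  Summable.of_nonneg_of_le (fun _ => abs_nonneg _) (fun l => abs_greenTerm_le hκ hq l x y)
    ((summable_geometric_of_lt_one (by norm_num) (by norm_num)).mul_right _)

theorem norm_neg_one_pow_mul (l : ℕ) (a : ℝ) : ‖(-1) ^ l * a‖ = |a| := by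
  simp

theorem hasSum_green (hκ : 0 < κ) (hq : Adm κ q) (x y : ℝ) :
    HasSum (fun l : ℕ => (-1) ^ l * greenTerm κ q l x y) (green κ q x y) := by
  refine Summable.hasSum (Summable.of_norm ?_)
  simpa only [norm_neg_one_pow_mul] using summable_abs_greenTerm hκ hq x y

theorem abs_green_le (hκ : 0 < κ) (hq : Adm κ q) (x y : ℝ) :
    |green κ q x y| ≤ 2 / (3 * κ) := by
  have h := tsum_of_norm_bounded (f := fun l : ℕ => (-1) ^ l * greenTerm κ q l x y)
    ((hasSum_geometric_of_lt_one (r := (1 / 4 : ℝ)) (by norm_num) (by norm_num)).mul_right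
      (1 / (2 * κ))) (fun l => by
        rw [norm_neg_one_pow_mul]; exact abs_greenTerm_le hκ hq l x y)
  refine h.trans (le_of_eq ?_)
  field_simp
  norm_num

theorem abs_green_le_exp (hκ : 0 < κ) (hq : Adm κ q) (x y : ℝ) :
    |green κ q x y| ≤ 1 / κ * Real.exp (-(κ / 2) * |x - y|) := by
  have h := tsum_of_norm_bounded (f := fun l : ℕ => (-1) ^ l * greenTerm κ q l x y)
    ((hasSum_geometric_of_lt_one (r := (1 / 2 : ℝ)) (by norm_num) (by norm_num)).mul_right
      (1 / (2 * κ) * Real.exp (-(κ / 2) * |x - y|))) (fun l => by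
        rw [norm_neg_one_pow_mul]; exact abs_greenTerm_le_exp hκ hq l x y)
  refine h.trans (le_of_eq ?_)
  field_simp
  norm_num

theorem continuous_green_left (hκ : 0 < κ) (hq : Adm κ q) (y : ℝ) :
    Continuous (fun x => green κ q x y) :=
  continuous_tsum (fun l => continuous_const.mul (continuous_greenTerm hκ hq l y))
    ((summable_geometric_of_lt_one (r := (1 / 4 : ℝ)) (by norm_num) (by norm_num)).mul_right
      (1 / (2 * κ))) (fun l x => by
        rw [norm_neg_one_pow_mul]; exact abs_greenTerm_le hκ hq l x y)

theorem aestronglyMeasurable_mul_green (hκ : 0 < κ) (hq : Adm κ q) (y : ℝ) :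
    AEStronglyMeasurable (fun z => q z * green κ q z y) volume :=
  hq.meas.mul (continuous_green_left hκ hq y).aestronglyMeasurable

theorem abs_mul_green_le (hκ : 0 < κ) (hq : Adm κ q) (y : ℝ) :
    ∀ᵐ z, |q z * green κ q z y| ≤ κ / 6 := by
  filter_upwards [hq.bound] with z hz
  rw [abs_mul]
  calc _ ≤ κ ^ 2 / 4 * (2 / (3 * κ)) :=
        mul_le_mul hz (abs_green_le hκ hq z y) (abs_nonneg _) (by positivity)
    _ = κ / 6 := by field_simp; norm_num

theorem abs_mul_green_le_exp (hκ : 0 < κ) (hq : Adm κ q) (y : ℝ) :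
    ∀ᵐ z, |q z * green κ q z y| ≤ κ / 4 * Real.exp (-(κ / 2) * |z - y|) := by
  filter_upwards [hq.bound] with z hz
  rw [abs_mul]
  calc _ ≤ κ ^ 2 / 4 * (1 / κ * Real.exp (-(κ / 2) * |z - y|)) :=
        mul_le_mul hz (abs_green_le_exp hκ hq z y) (abs_nonneg _) (by positivity)
    _ = _ := by field_simp

theorem integrable_mul_green (hκ : 0 < κ) (hq : Adm κ q) (y : ℝ) :
    Integrable (fun z => q z * green κ q z y) := by
  refine ((integrable_exp_neg_mul_abs_sub (half_pos hκ) y).const_mul (κ / 4)).mono'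
    (aestronglyMeasurable_mul_green hκ hq y) ?_
  filter_upwards [abs_mul_green_le_exp hκ hq y] with z hz
  rwa [abs_sub_comm] at hz

/-- The resolvent equation `G = G₀ - R₀ q G`. -/
theorem green_eq (hκ : 0 < κ) (hq : Adm κ q) (x y : ℝ) :
    green κ q x y = freeGreen κ x y - res κ (fun z => q z * green κ q z y) x := by
  have hgeo := (hasSum_geometric_of_lt_one (r := (1 / 4 : ℝ)) (by norm_num) (by norm_num))
  -- Applying `R₀ q` termwise shifts the alternating series by one index and reverses its sign.
  have h1 : HasSum (fun l : ℕ => ∫ z, freeGreen κ x z * (q z * ((-1) ^ l * greenTerm κ q l z y)))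
      (res κ (fun z => q z * green κ q z y) x) := by
    refine hasSum_integral_of_dominated_convergence
      (fun l z => freeGreen κ x z * (κ ^ 2 / 4) * ((1 / 4) ^ l * (1 / (2 * κ)))) (fun l => ?_)
      (fun l => ?_) (Eventually.of_forall fun z => ?_) ?_ (Eventually.of_forall fun z => ?_)
    · exact (integrable_freeGreen hκ x).aestronglyMeasurable.mul (hq.meas.mul
        (continuous_const.mul (continuous_greenTerm hκ hq l y)).aestronglyMeasurable)
    · filter_upwards [hq.bound] with z hz
      rw [norm_mul, norm_mul, norm_neg_one_pow_mul, Real.norm_eq_abs, Real.norm_eq_abs,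
        abs_of_pos (freeGreen_pos hκ x z), mul_assoc]
      exact mul_le_mul_of_nonneg_left (mul_le_mul hz (abs_greenTerm_le hκ hq l z y)
        (abs_nonneg _) (by positivity)) (freeGreen_pos hκ x z).le
    · exact (hgeo.summable.mul_right _).mul_left _
    · simp only [tsum_mul_left]
      exact ((integrable_freeGreen hκ x).mul_const _).mul_const _
    · exact ((hasSum_green hκ hq z y).mul_left _).mul_left _
  have h2 : ∀ l : ℕ, ∫ z, freeGreen κ x z * (q z * ((-1) ^ l * greenTerm κ q l z y))
      = -((-1) ^ (l + 1) * greenTerm κ q (l + 1) x y) := by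
    intro l
    rw [greenTerm_succ, res, pow_succ, ← integral_const_mul, ← integral_neg]
    exact integral_congr_ae (Eventually.of_forall fun z => by ring)
  simp only [h2] at h1
  have h3 := (hasSum_nat_add_iff' 1).2 (hasSum_green hκ hq x y)
  have h4 := h3.unique (by simpa using h1.neg)
  simp only [Finset.range_one, Finset.sum_singleton, pow_zero, one_mul, greenTerm] at h4
  linarith

/-- On bounded functions `R₀` has norm at most `1/κ²`, and `|q G| ≤ κ/6`. Since `G₀ = 1/(2κ)` on the
diagonal, this keeps `g` above `1/(3κ)`. -/
theorem abs_green_sub_freeGreen_le (hκ : 0 < κ) (hq : Adm κ q) (x y : ℝ) :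
    |green κ q x y - freeGreen κ x y| ≤ 1 / (6 * κ) := by
  have := abs_res_le_of_exp_weight (f := fun z => q z * green κ q z y) (C := κ / 6) (y := y)
    le_rfl hκ (by simpa using abs_mul_green_le hκ hq y) x
  rw [green_eq hκ hq, sub_sub_cancel_left, abs_neg]
  refine this.trans (le_of_eq ?_)
  simp
  field_simp

theorem diagGreen_ge (hκ : 0 < κ) (hq : Adm κ q) (x : ℝ) : 1 / (3 * κ) ≤ diagGreen κ q x := by
  have h := (abs_le.1 (abs_green_sub_freeGreen_le hκ hq x x)).1
  have h1 : freeGreen κ x x = 1 / (2 * κ) := by simp [freeGreen]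
  rw [h1] at h
  have h2 : 1 / (2 * κ) - 1 / (6 * κ) = 1 / (3 * κ) := by field_simp; norm_num
  rw [diagGreen]
  linarith

theorem diagGreen_pos (hκ : 0 < κ) (hq : Adm κ q) (x : ℝ) : 0 < diagGreen κ q x :=
  (by positivity : 0 < 1 / (3 * κ)).trans_le (diagGreen_ge hκ hq x)

theorem diagGreen_le (hκ : 0 < κ) (hq : Adm κ q) (x : ℝ) : diagGreen κ q x ≤ 2 / (3 * κ) :=
  (le_abs_self _).trans (abs_green_le hκ hq x x)

/-- The Green's function is positive close to the diagonal. -/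
theorem green_pos_of_abs_le (hκ : 0 < κ) (hq : Adm κ q) {x y : ℝ} (h : κ * |x - y| ≤ 1) :
    0 < green κ q x y := by
  have h1 := (abs_le.1 (abs_green_sub_freeGreen_le hκ hq x y)).1
  -- Because `e < 3`, the free kernel at distance at most `1/κ` still exceeds `1/(6κ)`, the bound
  -- for the correction.
  have h2 : 1 / 3 < Real.exp (-κ * |x - y|) := by
    have e1 : Real.exp (-1) ≤ Real.exp (-κ * |x - y|) := Real.exp_le_exp.2 (by linarith)
    have e2 : 1 / 3 < Real.exp (-1) := by
      rw [Real.exp_neg, one_div]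
      exact inv_strictAnti₀ (Real.exp_pos 1) (Real.exp_one_lt_d9.trans (by norm_num))
    linarith
  have h3 : 1 / (6 * κ) < freeGreen κ x y := by
    rw [freeGreen, show 1 / (6 * κ) = 1 / (2 * κ) * (1 / 3) by field_simp; norm_num]
    exact mul_lt_mul_of_pos_left h2 (by positivity)
  linarith

theorem integrable_green (hκ : 0 < κ) (hq : Adm κ q) (y : ℝ) :
    Integrable (fun z => green κ q z y) := by
  refine ((integrable_exp_neg_mul_abs_sub (half_pos hκ) y).const_mul (1 / κ)).mono'
    (continuous_green_left hκ hq y).aestronglyMeasurable (Eventually.of_forall fun z => ?_)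
  rw [Real.norm_eq_abs, abs_sub_comm]
  exact abs_green_le_exp hκ hq z y

end Single

/-- The second resolvent identity for Green's functions. -/
theorem green_sub_green {κ : ℝ} {p q : ℝ → ℝ} (hκ : 0 < κ) (hp : Adm κ p) (hq : Adm κ q)
    (x y : ℝ) : green κ p x y - green κ q y x
      = ∫ z, (q z - p z) * green κ q z x * green κ p z y := by
  have hu := integrable_mul_green hκ hq x
  have hv := integrable_mul_green hκ hp y
  have hcomm := integral_mul_res_comm hκ hu hv
  have i1 := integrable_freeGreen_mul hκ (aestronglyMeasurable_mul_green hκ hq x)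
    (abs_mul_green_le hκ hq x) y
  have i2 := integrable_freeGreen_mul hκ (aestronglyMeasurable_mul_green hκ hp y)
    (abs_mul_green_le hκ hp y) x
  have j1 : Integrable (fun z => q z * green κ q z x * res κ (fun z => p z * green κ p z y) z) :=
    hu.mul_bdd (c := κ / 6 / (κ * κ)) (continuous_res hκ (aestronglyMeasurable_mul_green hκ hp y)
      (abs_mul_green_le hκ hp y)).aestronglyMeasurable (Eventually.of_forall fun z => by
        simpa using abs_res_le_of_exp_weight (f := fun z => p z * green κ p z y) (C := κ / 6)
          (y := y) le_rfl hκ (by simpa using abs_mul_green_le hκ hp y) z)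
  have j2 : Integrable (fun z => p z * green κ p z y * res κ (fun z => q z * green κ q z x) z) :=
    hv.mul_bdd (c := κ / 6 / (κ * κ)) (continuous_res hκ (aestronglyMeasurable_mul_green hκ hq x)
      (abs_mul_green_le hκ hq x)).aestronglyMeasurable (Eventually.of_forall fun z => by
        simpa using abs_res_le_of_exp_weight (f := fun z => q z * green κ q z x) (C := κ / 6)
          (y := y) le_rfl hκ (by simpa using abs_mul_green_le hκ hq x) z)
  -- In the term with `q`, the resolvent equation is used for `green κ p`, and conversely. The two
  -- remaining double pairings cancel by symmetry of `R₀`.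
  have h1 : ∫ z, (q z - p z) * green κ q z x * green κ p z y
      = (res κ (fun z => q z * green κ q z x) y
          - ∫ z, q z * green κ q z x * res κ (fun z => p z * green κ p z y) z)
        - (res κ (fun z => p z * green κ p z y) x
          - ∫ z, p z * green κ p z y * res κ (fun z => q z * green κ q z x) z) := by
    have k1 : Integrable (fun z => freeGreen κ y z * (q z * green κ q z x)
        - q z * green κ q z x * res κ (fun z => p z * green κ p z y) z) := i1.sub j1
    have k2 : Integrable (fun z => freeGreen κ x z * (p z * green κ p z y)
        - p z * green κ p z y * res κ (fun z => q z * green κ q z x) z) := i2.sub j2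
    rw [res, res, ← integral_sub i1 j1, ← integral_sub i2 j2, ← integral_sub k1 k2]
    refine integral_congr_ae (Eventually.of_forall fun z => ?_)
    have e1 := green_eq hκ hq z x
    have e2 := green_eq hκ hp z y
    simp only [freeGreen_symm κ y z, freeGreen_symm κ x z]
    rw [show freeGreen κ z y = green κ p z y + res κ (fun z => p z * green κ p z y) z by linarith,
      show freeGreen κ z x = green κ q z x + res κ (fun z => q z * green κ q z x) z by linarith]
    ring
  rw [h1, hcomm, green_eq hκ hp x y, green_eq hκ hq y x, freeGreen_symm κ y x]
  ring

/-- This is the case `p = q` of the second resolvent identity, whose two Green's functions carry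
exchanged arguments. -/
theorem green_symm {κ : ℝ} {q : ℝ → ℝ} (hκ : 0 < κ) (hq : Adm κ q) (x y : ℝ) :
    green κ q x y = green κ q y x := by
  have := green_sub_green hκ hq hq x y
  simp only [sub_self, zero_mul, integral_zero] at this
  linarith

theorem diagGreen_sub {κ : ℝ} {p q : ℝ → ℝ} (hκ : 0 < κ) (hp : Adm κ p) (hq : Adm κ q) (x : ℝ) :
    diagGreen κ p x - diagGreen κ q x = ∫ z, (q z - p z) * (green κ q z x * green κ p z x) := by
  rw [diagGreen, diagGreen, green_sub_green hκ hp hq]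
  simp only [mul_assoc]

/-- The Green's function only depends on the almost everywhere class of the potential. -/
theorem diagGreen_congr {κ : ℝ} {p q : ℝ → ℝ} (hκ : 0 < κ) (hp : Adm κ p) (hq : Adm κ q)
    (h : p =ᵐ[volume] q) : diagGreen κ p = diagGreen κ q := by
  funext x
  rw [← sub_eq_zero, diagGreen_sub hκ hp hq]
  refine integral_eq_zero_of_ae ?_
  filter_upwards [h] with z hz
  simp [hz]

end
end

section
open MeasureTheory Set Filter Topology
open scoped ContDiff SchwartzMap ENNReal

noncomputable section

/-! ### Dependence of the Green's function on the potential -/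

/-- The derivative of the Green's function in its first variable, off the diagonal. -/
def greenD (κ : ℝ) (q : ℝ → ℝ) (x y : ℝ) : ℝ :=
  freeGreenD κ x y - resD κ (fun z => q z * green κ q z y) x

/-- The derivative of the diagonal Green's function. -/
def greenSlope (κ : ℝ) (q : ℝ → ℝ) (x : ℝ) : ℝ := -2 * resD κ (fun z => q z * green κ q z x) x

section Single
variable {κ : ℝ} {q : ℝ → ℝ}

theorem abs_greenSlope_le (hκ : 0 < κ) (hq : Adm κ q) (x : ℝ) : |greenSlope κ q x| ≤ 1 / 3 := by
  have := abs_resD_le hκ (abs_mul_green_le hκ hq x) x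
  rw [greenSlope, abs_mul, show |(-2 : ℝ)| = 2 by norm_num]
  have h : κ / 6 / κ = 1 / 6 := by field_simp
  linarith

theorem abs_greenD_le (hκ : 0 < κ) (hq : Adm κ q) (x y : ℝ) :
    |greenD κ q x y| ≤ Real.exp (-(κ / 2) * |x - y|) := by
  have h1 := abs_resD_le_of_exp_weight (half_pos hκ).le (half_lt_self hκ)
    (abs_mul_green_le_exp hκ hq y) x
  have h2 : |freeGreenD κ x y| ≤ 1 / 2 * Real.exp (-(κ / 2) * |x - y|) := by
    rw [abs_freeGreenD]
    refine mul_le_mul_of_nonneg_left (Real.exp_le_exp.2 ?_) (by norm_num)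
    nlinarith [abs_nonneg (x - y)]
  rw [show κ / 4 / (κ - κ / 2) = 1 / 2 by field_simp; norm_num] at h1
  rw [greenD]
  exact (abs_sub _ _).trans (by linarith)

theorem exp_neg_mul_abs_sub_le (hκ : 0 ≤ κ) {x x₀ z : ℝ} (h : |x - x₀| ≤ 1) :
    Real.exp (-κ * |x - z|) ≤ Real.exp κ * Real.exp (-κ * |x₀ - z|) := by
  rw [← Real.exp_add, Real.exp_le_exp]
  have := abs_sub_le x₀ x z
  rw [abs_sub_comm x₀ x] at this
  nlinarith

theorem continuous_green_right (hκ : 0 < κ) (hq : Adm κ q) (x : ℝ) :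
    Continuous (fun y => green κ q x y) := by
  simp only [green_symm hκ hq x]
  exact continuous_green_left hκ hq x

/-- Both the evaluation point and the pole move with `x`; symmetry of the Green's function supplies
continuity in the pole, and dominated convergence does the rest. -/
theorem continuous_greenSlope (hκ : 0 < κ) (hq : Adm κ q) : Continuous (greenSlope κ q) := by
  refine continuous_const.mul (continuous_iff_continuousAt.2 fun x => ?_)
  refine continuousAt_of_dominated
    (bound := fun z => 1 / 2 * (Real.exp κ * Real.exp (-κ * |x - z|)) * (κ / 6))
    (Eventually.of_forall fun y => ((measurable_freeGreenD κ y).aestronglyMeasurable.mul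
      (aestronglyMeasurable_mul_green hκ hq y))) ?_
    ((((integrable_exp_neg_mul_abs_sub hκ x).const_mul _).const_mul _).mul_const _) ?_
  · filter_upwards [Metric.closedBall_mem_nhds x one_pos] with y hy
    rw [Metric.mem_closedBall, Real.dist_eq] at hy
    filter_upwards [abs_mul_green_le hκ hq y] with z hz
    rw [norm_mul, Real.norm_eq_abs, abs_freeGreenD]
    have := exp_neg_mul_abs_sub_le hκ.le (z := z) hy
    exact mul_le_mul (by linarith) hz (norm_nonneg _) (by positivity)
  · filter_upwards [ae_ne_volume x] with z hz
    exact (hasDerivAt_freeGreenD hκ hz).continuousAt.mul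
      (continuousAt_const.mul (continuous_green_right hκ hq z).continuousAt)

theorem abs_green_mul_green_le (hκ : 0 < κ) (hq : Adm κ q) (x y : ℝ) :
    |green κ q y x * green κ q y x| ≤ 1 / κ ^ 2 * Real.exp (-κ * |x - y|) := by
  have := abs_green_le_exp hκ hq y x
  rw [abs_mul]
  calc _ ≤ (1 / κ * Real.exp (-(κ / 2) * |y - x|)) * (1 / κ * Real.exp (-(κ / 2) * |y - x|)) :=
        mul_le_mul this this (abs_nonneg _) (by positivity)
    _ = 1 / κ ^ 2 * (Real.exp (-(κ / 2) * |y - x|) * Real.exp (-(κ / 2) * |y - x|)) := by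
        field_simp
    _ = _ := by rw [← Real.exp_add, abs_sub_comm]; ring_nf

theorem integrable_green_mul_mul_green (hκ : 0 < κ) (hq : Adm κ q) {F : ℝ → ℝ} {C : ℝ}
    (hF : AEStronglyMeasurable F volume) (hC : ∀ᵐ z, |F z| ≤ C) (x : ℝ) :
    Integrable (fun y => green κ q y x * green κ q y x * F y) := by
  refine Integrable.mul_bdd (c := C) ?_ hF (by simpa using hC)
  refine ((integrable_exp_neg_mul_abs_sub hκ x).const_mul (1 / κ ^ 2)).mono'
    ((continuous_green_left hκ hq x).mul (continuous_green_left hκ hq x)).aestronglyMeasurable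
    (Eventually.of_forall fun y => abs_green_mul_green_le hκ hq x y)

theorem modifiedForcing_eq (hκ : 0 < κ) (hq : Adm κ q) (F : ℝ → ℝ) (x : ℝ) :
    modifiedForcing κ q F x = ∫ y, green κ q y x * green κ q y x * F y := by
  refine integral_congr_ae (Eventually.of_forall fun y => ?_)
  simp only [green_symm hκ hq x y]
  ring

theorem abs_modifiedForcing_le (hκ : 0 < κ) (hq : Adm κ q) {F : ℝ → ℝ} {C : ℝ}
    (hC : ∀ᵐ z, |F z| ≤ C) (x : ℝ) : |modifiedForcing κ q F x| ≤ 2 * C / κ ^ 3 := by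
  have hC0 : 0 ≤ C := by
    obtain ⟨z, hz⟩ := hC.exists
    exact (abs_nonneg _).trans hz
  rw [modifiedForcing_eq hκ hq]
  refine abs_integral_le_integral_abs.trans ((integral_mono_of_nonneg
    (Eventually.of_forall fun z => abs_nonneg _)
    (((integrable_exp_neg_mul_abs_sub hκ x).const_mul (1 / κ ^ 2)).mul_const C) ?_).trans
      (le_of_eq ?_))
  · filter_upwards [hC] with y hy
    rw [abs_mul]
    exact mul_le_mul (abs_green_mul_green_le hκ hq x y) hy (abs_nonneg _) (by positivity)
  · rw [integral_mul_const, integral_const_mul, integral_exp_neg_mul_abs_sub hκ]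
    field_simp

theorem continuous_modifiedForcing (hκ : 0 < κ) (hq : Adm κ q) {F : ℝ → ℝ} {C : ℝ}
    (hF : AEStronglyMeasurable F volume) (hC : ∀ᵐ z, |F z| ≤ C) :
    Continuous (modifiedForcing κ q F) := by
  rw [funext (modifiedForcing_eq hκ hq F)]
  refine continuous_iff_continuousAt.2 fun x => continuousAt_of_dominated
    (bound := fun z => 1 / κ ^ 2 * (Real.exp κ * Real.exp (-κ * |x - z|)) * C)
    (Eventually.of_forall fun y => (integrable_green_mul_mul_green hκ hq hF hC y).aestronglyMeasurable)
    ?_ ((((integrable_exp_neg_mul_abs_sub hκ x).const_mul _).const_mul _).mul_const _)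
    (Eventually.of_forall fun z => ?_)
  · filter_upwards [Metric.closedBall_mem_nhds x one_pos] with y hy
    rw [Metric.mem_closedBall, Real.dist_eq] at hy
    filter_upwards [hC] with z hz
    rw [norm_mul]
    refine mul_le_mul ((abs_green_mul_green_le hκ hq y z).trans ?_) hz (norm_nonneg _)
      (by positivity)
    exact mul_le_mul_of_nonneg_left (exp_neg_mul_abs_sub_le hκ.le hy) (by positivity)
  · have := (continuous_green_right hκ hq z).continuousAt (x := x)
    exact (this.mul this).mul continuousAt_const

end Single

/-- Weak-* convergence in `L^∞(ℝ)`. -/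
def WeakTendsto {ι : Type*} (l : Filter ι) (p : ι → ℝ → ℝ) (q : ℝ → ℝ) : Prop :=
  ∀ f : ℝ → ℝ, Integrable f → Tendsto (fun i => ∫ z, f z * p i z) l (𝓝 (∫ z, f z * q z))

section Limits
variable {ι : Type*} {l : Filter ι} [l.IsCountablyGenerated] {κ : ℝ} {p : ι → ℝ → ℝ} {q : ℝ → ℝ}

theorem weakTendsto_of_ae_tendsto (hp : ∀ i, Adm κ (p i))
    (h : ∀ᵐ z, Tendsto (fun i => p i z) l (𝓝 (q z))) : WeakTendsto l p q := by
  intro f hf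
  refine tendsto_integral_filter_of_dominated_convergence (fun z => |f z| * (κ ^ 2 / 4))
    (Eventually.of_forall fun i => hf.aestronglyMeasurable.mul (hp i).meas)
    (Eventually.of_forall fun i => ?_) (hf.abs.mul_const _) ?_
  · filter_upwards [(hp i).bound] with z hz
    rw [norm_mul]
    exact mul_le_mul_of_nonneg_left hz (abs_nonneg _)
  · filter_upwards [h] with z hz using tendsto_const_nhds.mul hz

/-- Weak-* convergence passes to products with dominated, pointwise convergent sequences. -/
theorem WeakTendsto.integral_mul (hw : WeakTendsto l p q) (hp : ∀ i, Adm κ (p i))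
    {f : ι → ℝ → ℝ} {f₀ h : ℝ → ℝ} (hh : Integrable h)
    (hfm : ∀ i, AEStronglyMeasurable (f i) volume) (hf₀m : AEStronglyMeasurable f₀ volume)
    (hf : ∀ i, ∀ᵐ z, |f i z| ≤ h z) (hf₀ : ∀ᵐ z, |f₀ z| ≤ h z)
    (hlim : ∀ᵐ z, Tendsto (fun i => f i z) l (𝓝 (f₀ z))) :
    Tendsto (fun i => ∫ z, f i z * p i z) l (𝓝 (∫ z, f₀ z * q z)) := by
  have if₀ : Integrable f₀ := hh.mono' hf₀m hf₀
  have ifi : ∀ i, Integrable (f i) := fun i => hh.mono' (hfm i) (hf i)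
  have h1 : Tendsto (fun i => ∫ z, |f i z - f₀ z|) l (𝓝 0) := by
    have := tendsto_integral_filter_of_dominated_convergence (μ := volume) (l := l)
      (F := fun i z => |f i z - f₀ z|) (f := fun _ => (0 : ℝ)) (fun z => h z + h z)
      (Eventually.of_forall fun i => ((ifi i).sub if₀).abs.aestronglyMeasurable)
      (Eventually.of_forall fun i => by
        filter_upwards [hf i, hf₀] with z h1 h2
        rw [Real.norm_eq_abs, abs_abs]
        exact (abs_sub _ _).trans (add_le_add h1 h2)) (hh.add hh) (by
        filter_upwards [hlim] with z hz
        simpa using (hz.sub_const (f₀ z)).abs)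
    simpa using this
  -- The test functions converge in `L¹` and the potentials are uniformly bounded, so `f i` may be
  -- replaced by the fixed `f₀`, for which weak-* convergence applies.
  have h2 : Tendsto (fun i => ∫ z, (f i z - f₀ z) * p i z) l (𝓝 0) := by
    refine squeeze_zero_norm (a := fun i => (∫ z, |f i z - f₀ z|) * (κ ^ 2 / 4)) (fun i => ?_)
      (by simpa using h1.mul_const (κ ^ 2 / 4))
    rw [← integral_mul_const]
    refine norm_integral_le_of_norm_le (((ifi i).sub if₀).abs.mul_const _) ?_
    filter_upwards [(hp i).bound] with z hz
    rw [norm_mul]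
    exact mul_le_mul_of_nonneg_left hz (abs_nonneg _)
  have h3 := h2.add (hw f₀ if₀)
  rw [zero_add] at h3
  refine h3.congr fun i => ?_
  have b1 : ∀ᵐ z, ‖p i z‖ ≤ κ ^ 2 / 4 := (hp i).bound
  have j1 : Integrable (fun z => (f i z - f₀ z) * p i z) :=
    ((ifi i).sub if₀).mul_bdd (hp i).meas b1
  rw [← integral_add j1 (if₀.mul_bdd (hp i).meas b1)]
  exact integral_congr_ae (Eventually.of_forall fun z => by ring)

/-- Level `n + 1` tests the potential against `G₀` times level `n`. By induction these test
functions converge pointwise under a common integrable bound, so weak-* convergence becomes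
pointwise convergence. -/
theorem WeakTendsto.tendsto_greenTerm (hκ : 0 < κ) (hw : WeakTendsto l p q) (hp : ∀ i, Adm κ (p i))
    (hq : Adm κ q) (n : ℕ) (x y : ℝ) :
    Tendsto (fun i => greenTerm κ (p i) n x y) l (𝓝 (greenTerm κ q n x y)) := by
  induction n generalizing x with
  | zero => exact tendsto_const_nhds
  | succ n ih =>
    have h := hw.integral_mul hp (f := fun i z => freeGreen κ x z * greenTerm κ (p i) n z y)
      (f₀ := fun z => freeGreen κ x z * greenTerm κ q n z y)
      (h := fun z => freeGreen κ x z * ((1 / 4) ^ n * (1 / (2 * κ))))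
      ((integrable_freeGreen hκ x).mul_const _)
      (fun i => (integrable_freeGreen hκ x).aestronglyMeasurable.mul
        (continuous_greenTerm hκ (hp i) n y).aestronglyMeasurable)
      ((integrable_freeGreen hκ x).aestronglyMeasurable.mul
        (continuous_greenTerm hκ hq n y).aestronglyMeasurable)
      (fun i => Eventually.of_forall fun z => by
        rw [abs_mul, abs_of_pos (freeGreen_pos hκ x z)]
        exact mul_le_mul_of_nonneg_left (abs_greenTerm_le hκ (hp i) n z y)
          (freeGreen_pos hκ x z).le)
      (Eventually.of_forall fun z => by
        rw [abs_mul, abs_of_pos (freeGreen_pos hκ x z)]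
        exact mul_le_mul_of_nonneg_left (abs_greenTerm_le hκ hq n z y)
          (freeGreen_pos hκ x z).le)
      (Eventually.of_forall fun z => (ih z).const_mul _)
    simpa only [greenTerm, mul_right_comm] using h

theorem WeakTendsto.tendsto_green (hκ : 0 < κ) (hw : WeakTendsto l p q) (hp : ∀ i, Adm κ (p i))
    (hq : Adm κ q) (x y : ℝ) :
    Tendsto (fun i => green κ (p i) x y) l (𝓝 (green κ q x y)) := by
  refine tendsto_tsum_of_dominated_convergence
    (bound := fun n : ℕ => (1 / 4) ^ n * (1 / (2 * κ)))
    ((summable_geometric_of_lt_one (by norm_num) (by norm_num)).mul_right _)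
    (fun n => (hw.tendsto_greenTerm hκ hp hq n x y).const_mul _)
    (Eventually.of_forall fun i n => ?_)
  rw [norm_neg_one_pow_mul]
  exact abs_greenTerm_le hκ (hp i) n x y

theorem WeakTendsto.tendsto_diagGreen (hκ : 0 < κ) (hw : WeakTendsto l p q) (hp : ∀ i, Adm κ (p i))
    (hq : Adm κ q) (x : ℝ) :
    Tendsto (fun i => diagGreen κ (p i) x) l (𝓝 (diagGreen κ q x)) :=
  hw.tendsto_green hκ hp hq x x

theorem WeakTendsto.tendsto_resD_mul_green (hκ : 0 < κ) (hw : WeakTendsto l p q)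
    (hp : ∀ i, Adm κ (p i)) (hq : Adm κ q) (x y : ℝ) :
    Tendsto (fun i => resD κ (fun z => p i z * green κ (p i) z y) x) l
      (𝓝 (resD κ (fun z => q z * green κ q z y) x)) := by
  have h := hw.integral_mul hp (f := fun i z => freeGreenD κ x z * green κ (p i) z y)
    (f₀ := fun z => freeGreenD κ x z * green κ q z y)
    (h := fun z => |freeGreenD κ x z| * (2 / (3 * κ)))
    ((integrable_freeGreenD hκ x).abs.mul_const _)
    (fun i => (integrable_freeGreenD hκ x).aestronglyMeasurable.mul
      (continuous_green_left hκ (hp i) y).aestronglyMeasurable)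
    ((integrable_freeGreenD hκ x).aestronglyMeasurable.mul
      (continuous_green_left hκ hq y).aestronglyMeasurable)
    (fun i => Eventually.of_forall fun z => by
      rw [abs_mul]
      exact mul_le_mul_of_nonneg_left (abs_green_le hκ (hp i) z y) (abs_nonneg _))
    (Eventually.of_forall fun z => by
      rw [abs_mul]
      exact mul_le_mul_of_nonneg_left (abs_green_le hκ hq z y) (abs_nonneg _))
    (Eventually.of_forall fun z => (hw.tendsto_green hκ hp hq z y).const_mul _)
  have e : ∀ r : ℝ → ℝ, resD κ (fun z => r z * green κ r z y) x
      = ∫ z, freeGreenD κ x z * green κ r z y * r z := fun r =>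
    integral_congr_ae (Eventually.of_forall fun z => by ring)
  simpa only [e] using h

theorem WeakTendsto.tendsto_greenSlope (hκ : 0 < κ) (hw : WeakTendsto l p q) (hp : ∀ i, Adm κ (p i))
    (hq : Adm κ q) (x : ℝ) :
    Tendsto (fun i => greenSlope κ (p i) x) l (𝓝 (greenSlope κ q x)) :=
  (hw.tendsto_resD_mul_green hκ hp hq x x).const_mul _

theorem WeakTendsto.tendsto_modifiedForcing (hκ : 0 < κ) (hw : WeakTendsto l p q)
    (hp : ∀ i, Adm κ (p i)) (hq : Adm κ q) {F : ι → ℝ → ℝ} {F₀ : ℝ → ℝ} {C : ℝ}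
    (hF : ∀ i, AEStronglyMeasurable (F i) volume) (hC : ∀ i, ∀ᵐ z, |F i z| ≤ C)
    (hlim : ∀ᵐ z, Tendsto (fun i => F i z) l (𝓝 (F₀ z))) (x : ℝ) :
    Tendsto (fun i => modifiedForcing κ (p i) (F i) x) l (𝓝 (modifiedForcing κ q F₀ x)) := by
  rw [modifiedForcing_eq hκ hq]
  simp only [fun i => modifiedForcing_eq hκ (hp i) (F i) x]
  refine tendsto_integral_filter_of_dominated_convergence
    (fun y => 1 / κ ^ 2 * Real.exp (-κ * |x - y|) * C)
    (Eventually.of_forall fun i =>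
      (integrable_green_mul_mul_green hκ (hp i) (hF i) (hC i) x).aestronglyMeasurable)
    (Eventually.of_forall fun i => ?_)
    (((integrable_exp_neg_mul_abs_sub hκ x).const_mul _).mul_const _) ?_
  · filter_upwards [hC i] with y hy
    rw [norm_mul]
    exact mul_le_mul (abs_green_mul_green_le hκ (hp i) x y) hy (norm_nonneg _) (by positivity)
  · filter_upwards [hlim] with y hy
    exact ((hw.tendsto_green hκ hp hq y x).mul (hw.tendsto_green hκ hp hq y x)).mul hy

end Limits

end
end

section
open MeasureTheory Set Filter Topology
open scoped ContDiff SchwartzMap ENNReal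

noncomputable section

/-! ### The differential equation for the diagonal Green's function -/

theorem tendsto_exp_neg_mul_abs_sub_cocompact {a : ℝ} (ha : 0 < a) (y : ℝ) :
    Tendsto (fun z : ℝ => Real.exp (-a * |z - y|)) (cocompact ℝ) (𝓝 0) := by
  refine Real.tendsto_exp_atBot.comp ((tendsto_const_mul_atBot_of_neg (neg_lt_zero.2 ha)).2 ?_)
  have h1 : Tendsto (fun z : ℝ => |z| - |y|) (cocompact ℝ) atTop :=
    tendsto_atTop_add_const_right _ _ (tendsto_norm_cocompact_atTop (E := ℝ))
  exact tendsto_atTop_mono (fun z => abs_sub_abs_le_abs_sub z y) h1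

section Single
variable {κ : ℝ} {q : ℝ → ℝ}

theorem Adm.abs_le (hq : Adm κ q) (hc : Continuous q) (x : ℝ) : |q x| ≤ κ ^ 2 / 4 := by
  have h1 := Measure.dense_of_ae hq.bound
  have h2 : IsClosed {x | |q x| ≤ κ ^ 2 / 4} := isClosed_le hc.abs continuous_const
  have : x ∈ closure {x | |q x| ≤ κ ^ 2 / 4} := h1 x
  rwa [h2.closure_eq] at this

theorem tendsto_green_cocompact (hκ : 0 < κ) (hq : Adm κ q) (y : ℝ) :
    Tendsto (fun z => green κ q z y) (cocompact ℝ) (𝓝 0) :=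
  squeeze_zero_norm (fun z => abs_green_le_exp hκ hq z y)
    (by simpa using (tendsto_exp_neg_mul_abs_sub_cocompact (half_pos hκ) y).const_mul (1 / κ))

theorem tendsto_greenD_cocompact (hκ : 0 < κ) (hq : Adm κ q) (y : ℝ) :
    Tendsto (fun z => greenD κ q z y) (cocompact ℝ) (𝓝 0) :=
  squeeze_zero_norm (fun z => abs_greenD_le hκ hq z y)
    (tendsto_exp_neg_mul_abs_sub_cocompact (half_pos hκ) y)

theorem hasDerivAt_green (hκ : 0 < κ) (hq : Adm κ q) {z y : ℝ} (h : z ≠ y) :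
    HasDerivAt (fun z => green κ q z y) (greenD κ q z y) z := by
  have e : (fun z => green κ q z y)
      = fun z => freeGreen κ z y - res κ (fun z => q z * green κ q z y) z :=
    funext fun z => green_eq hκ hq z y
  rw [e]
  exact (hasDerivAt_freeGreen hκ h).sub
    (hasDerivAt_res hκ (aestronglyMeasurable_mul_green hκ hq y) (abs_mul_green_le hκ hq y) z)

theorem hasDerivAt_resD_mul_green (hκ : 0 < κ) (hq : Adm κ q) (hc : Continuous q) (z y : ℝ) :
    HasDerivAt (resD κ (fun z => q z * green κ q z y))
      (κ ^ 2 * res κ (fun z => q z * green κ q z y) z - q z * green κ q z y) z := by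
  refine hasDerivAt_resD (C := κ ^ 2 / 4 * (2 / (3 * κ))) hκ
    (hc.mul (continuous_green_left hκ hq y)) (fun z => ?_) z
  rw [Pi.mul_apply, abs_mul]
  exact mul_le_mul (hq.abs_le hc z) (abs_green_le hκ hq z y) (abs_nonneg _) (by positivity)

theorem hasDerivAt_greenD (hκ : 0 < κ) (hq : Adm κ q) (hc : Continuous q) {z y : ℝ} (h : z ≠ y) :
    HasDerivAt (fun z => greenD κ q z y) ((q z + κ ^ 2) * green κ q z y) z := by
  convert! (hasDerivAt_freeGreenD hκ h).sub (hasDerivAt_resD_mul_green hκ hq hc z y) using 1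
  rw [green_eq hκ hq z y]
  ring

/-- The correction `R₀ q G` is continuously differentiable across the pole and contributes half of
`greenSlope`. The free kernel contributes the one-sided value `-1/2`, and `1/2` from the left. -/
theorem tendsto_greenD_right (hκ : 0 < κ) (hq : Adm κ q) (hc : Continuous q) (y : ℝ) :
    Tendsto (fun z => greenD κ q z y) (𝓝[>] y) (𝓝 ((greenSlope κ q y - 1) / 2)) := by
  have h1 : Tendsto (fun z : ℝ => -(1 / 2) * Real.exp (-κ * |z - y|)) (𝓝[>] y) (𝓝 (-(1 / 2))) := by
    have : Continuous (fun z : ℝ => -(1 / 2) * Real.exp (-κ * |z - y|)) := by fun_prop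
    simpa using (this.tendsto y).mono_left (nhdsWithin_le_nhds (s := Ioi y))
  have h2 : Tendsto (fun z => freeGreenD κ z y) (𝓝[>] y) (𝓝 (-(1 / 2))) := by
    refine h1.congr' ?_
    filter_upwards [self_mem_nhdsWithin] with z hz
    rw [freeGreenD, if_neg (lt_asymm (mem_Ioi.1 hz))]
  have h3 := (hasDerivAt_resD_mul_green hκ hq hc y y).continuousAt.tendsto.mono_left
    (nhdsWithin_le_nhds (s := Ioi y))
  have e : (greenSlope κ q y - 1) / 2 = -(1 / 2) - resD κ (fun z => q z * green κ q z y) y := by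
    rw [greenSlope]; ring
  rw [e]
  exact h2.sub h3

theorem tendsto_greenD_left (hκ : 0 < κ) (hq : Adm κ q) (hc : Continuous q) (y : ℝ) :
    Tendsto (fun z => greenD κ q z y) (𝓝[<] y) (𝓝 ((greenSlope κ q y + 1) / 2)) := by
  have h1 : Tendsto (fun z : ℝ => 1 / 2 * Real.exp (-κ * |z - y|)) (𝓝[<] y) (𝓝 (1 / 2)) := by
    have : Continuous (fun z : ℝ => 1 / 2 * Real.exp (-κ * |z - y|)) := by fun_prop
    simpa using (this.tendsto y).mono_left (nhdsWithin_le_nhds (s := Iio y))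
  have h2 : Tendsto (fun z => freeGreenD κ z y) (𝓝[<] y) (𝓝 (1 / 2)) := by
    refine h1.congr' ?_
    filter_upwards [self_mem_nhdsWithin] with z hz
    rw [freeGreenD, if_pos (mem_Iio.1 hz)]
  have h3 := (hasDerivAt_resD_mul_green hκ hq hc y y).continuousAt.tendsto.mono_left
    (nhdsWithin_le_nhds (s := Iio y))
  have e : (greenSlope κ q y + 1) / 2 = 1 / 2 - resD κ (fun z => q z * green κ q z y) y := by
    rw [greenSlope]; ring
  rw [e]
  exact h2.sub h3

/-- The Wronskian of two Green's functions. -/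
def greenWronskian (κ : ℝ) (q : ℝ → ℝ) (x y z : ℝ) : ℝ :=
  green κ q z x * greenD κ q z y - greenD κ q z x * green κ q z y

theorem hasDerivAt_greenWronskian (hκ : 0 < κ) (hq : Adm κ q) (hc : Continuous q) {x y z : ℝ}
    (hx : z ≠ x) (hy : z ≠ y) : HasDerivAt (greenWronskian κ q x y) 0 z := by
  convert! ((hasDerivAt_green hκ hq hx).mul (hasDerivAt_greenD hκ hq hc hy)).sub
    ((hasDerivAt_greenD hκ hq hc hx).mul (hasDerivAt_green hκ hq hy)) using 1
  ring

theorem tendsto_greenWronskian_cocompact (hκ : 0 < κ) (hq : Adm κ q) (x y : ℝ) :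
    Tendsto (greenWronskian κ q x y) (cocompact ℝ) (𝓝 0) := by
  have := ((tendsto_green_cocompact hκ hq x).mul (tendsto_greenD_cocompact hκ hq y)).sub
    ((tendsto_greenD_cocompact hκ hq x).mul (tendsto_green_cocompact hκ hq y))
  simp only [mul_zero, sub_zero] at this
  exact this

/-- Beyond both poles the Wronskian is constant, and it decays at infinity. -/
theorem greenWronskian_eq_zero_right (hκ : 0 < κ) (hq : Adm κ q) (hc : Continuous q) {x y z : ℝ}
    (hx : x < z) (hy : y < z) : greenWronskian κ q x y z = 0 := by
  have := integral_Ioi_of_hasDerivAt_of_tendsto' (a := z) (f' := fun _ => (0 : ℝ))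
    (fun w hw => hasDerivAt_greenWronskian hκ hq hc (hx.trans_le hw).ne' (hy.trans_le hw).ne')
    (integrable_zero _ _ _).integrableOn
    ((tendsto_greenWronskian_cocompact hκ hq x y).mono_left atTop_le_cocompact)
  simpa using this

theorem greenWronskian_eq_zero_left (hκ : 0 < κ) (hq : Adm κ q) (hc : Continuous q) {x y z : ℝ}
    (hx : z < x) (hy : z < y) : greenWronskian κ q x y z = 0 := by
  have := integral_Iic_of_hasDerivAt_of_tendsto' (a := z) (f' := fun _ => (0 : ℝ))
    (fun w hw => hasDerivAt_greenWronskian hκ hq hc (hx.trans_le' hw).ne (hy.trans_le' hw).ne)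
    (integrable_zero _ _ _).integrableOn
    ((tendsto_greenWronskian_cocompact hκ hq x y).mono_left atBot_le_cocompact)
  simpa using this.symm

/-- Put the second pole at `z` and let the evaluation point approach `z` from the right. The
vanishing Wronskian then expresses the logarithmic derivative of `G(·,x)` at `z` through the
diagonal data `g`, `greenSlope`. -/
theorem greenD_mul_diagGreen_right (hκ : 0 < κ) (hq : Adm κ q) (hc : Continuous q) {x z : ℝ}
    (h : x < z) :
    greenD κ q z x * diagGreen κ q z = green κ q z x * ((greenSlope κ q z - 1) / 2) := by
  have h1 : Tendsto (greenWronskian κ q x z) (𝓝[>] z)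
      (𝓝 (green κ q z x * ((greenSlope κ q z - 1) / 2) - greenD κ q z x * green κ q z z)) :=
    (((hasDerivAt_green hκ hq h.ne').continuousAt.tendsto.mono_left nhdsWithin_le_nhds).mul
      (tendsto_greenD_right hκ hq hc z)).sub
    (((hasDerivAt_greenD hκ hq hc h.ne').continuousAt.tendsto.mono_left nhdsWithin_le_nhds).mul
      ((continuous_green_left hκ hq z).continuousAt.tendsto.mono_left nhdsWithin_le_nhds))
  have h2 : Tendsto (greenWronskian κ q x z) (𝓝[>] z) (𝓝 0) := by
    refine tendsto_const_nhds.congr' ?_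
    filter_upwards [self_mem_nhdsWithin] with w hw
    exact (greenWronskian_eq_zero_right hκ hq hc (h.trans hw) hw).symm
  have := tendsto_nhds_unique h1 h2
  rw [diagGreen]
  linarith

theorem greenD_mul_diagGreen_left (hκ : 0 < κ) (hq : Adm κ q) (hc : Continuous q) {x z : ℝ}
    (h : z < x) :
    greenD κ q z x * diagGreen κ q z = green κ q z x * ((greenSlope κ q z + 1) / 2) := by
  have h1 : Tendsto (greenWronskian κ q x z) (𝓝[<] z)
      (𝓝 (green κ q z x * ((greenSlope κ q z + 1) / 2) - greenD κ q z x * green κ q z z)) :=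
    (((hasDerivAt_green hκ hq h.ne).continuousAt.tendsto.mono_left nhdsWithin_le_nhds).mul
      (tendsto_greenD_left hκ hq hc z)).sub
    (((hasDerivAt_greenD hκ hq hc h.ne).continuousAt.tendsto.mono_left nhdsWithin_le_nhds).mul
      ((continuous_green_left hκ hq z).continuousAt.tendsto.mono_left nhdsWithin_le_nhds))
  have h2 : Tendsto (greenWronskian κ q x z) (𝓝[<] z) (𝓝 0) := by
    refine tendsto_const_nhds.congr' ?_
    filter_upwards [self_mem_nhdsWithin] with w hw
    exact (greenWronskian_eq_zero_left hκ hq hc (hw.trans h) hw).symm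
  have := tendsto_nhds_unique h1 h2
  rw [diagGreen]
  linarith

/-- Close to the diagonal the Green's function factors through its diagonal. -/
theorem green_mul_green_eq (hκ : 0 < κ) (hq : Adm κ q) (hc : Continuous q) {x z y : ℝ}
    (hxz : x < z) (hzy : z < y) (hxy : κ * (y - x) ≤ 1) :
    green κ q z x * green κ q z y = diagGreen κ q z * green κ q y x := by
  have hpos : ∀ w ∈ Icc z y, 0 < green κ q w z := fun w hw =>
    green_pos_of_abs_le hκ hq (by
      rw [abs_of_nonneg (sub_nonneg.2 hw.1)]
      nlinarith [hw.2])
  -- The derivative of this quotient is a multiple of the Wronskian, hence zero, so its values at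
  -- `z` and `y` agree. Positivity near the diagonal keeps the denominator away from zero.
  obtain ⟨w, -, hw⟩ := exists_hasDerivAt_eq_slope (fun w => green κ q w x / green κ q w z)
    (fun _ => 0) hzy
    ((continuous_green_left hκ hq x).continuousOn.div (continuous_green_left hκ hq z).continuousOn
      fun w hw => (hpos w hw).ne')
    (fun w hw => by
      convert! (hasDerivAt_green hκ hq (hxz.trans hw.1).ne').div (hasDerivAt_green hκ hq hw.1.ne')
        (hpos w ⟨hw.1.le, hw.2.le⟩).ne' using 1
      have := greenWronskian_eq_zero_right hκ hq hc (hxz.trans hw.1) hw.1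
      rw [greenWronskian] at this
      rw [eq_comm, div_eq_zero_iff]
      left
      linarith)
  have h1 : green κ q y x / green κ q y z - green κ q z x / green κ q z z = 0 := by
    rcases div_eq_zero_iff.1 hw.symm with h | h
    · exact h
    · linarith
  have p1 := (hpos y ⟨hzy.le, le_rfl⟩).ne'
  have p2 := (hpos z ⟨le_rfl, hzy.le⟩).ne'
  rw [sub_eq_zero, div_eq_div_iff p1 p2] at h1
  rw [diagGreen, green_symm hκ hq z y]
  linarith

/-- The second derivative of the diagonal Green's function. -/
def greenSlope₂ (κ : ℝ) (q : ℝ → ℝ) (x : ℝ) : ℝ :=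
  2 * (q x + κ ^ 2) * diagGreen κ q x + (greenSlope κ q x ^ 2 - 1) / (2 * diagGreen κ q x)

theorem hasDerivAt_diagGreen_and_greenSlope (hκ : 0 < κ) (hq : Adm κ q) (hc : Continuous q)
    (x : ℝ) : HasDerivAt (diagGreen κ q) (greenSlope κ q x) x ∧
      HasDerivAt (greenSlope κ q) (greenSlope₂ κ q x) x := by
  -- The window has length `1/(2κ)`, short enough for positivity and factorization. Its end points
  -- serve as fixed poles on either side of `x`.
  set a := x - 1 / (4 * κ) with ha
  set b := x + 1 / (4 * κ) with hb
  have h4 : 0 < 1 / (4 * κ) := by positivity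
  have hab : κ * (b - a) ≤ 1 := by
    rw [ha, hb, show x + 1 / (4 * κ) - (x - 1 / (4 * κ)) = 1 / (2 * κ) by field_simp; norm_num]
    field_simp
    norm_num
  have hx : x ∈ Ioo a b := ⟨by linarith, by linarith⟩
  have hc0 : 0 < green κ q b a := green_pos_of_abs_le hκ hq (by
    rwa [abs_of_pos (by linarith : 0 < b - a)])
  have hA : ∀ z ∈ Ioo a b, 0 < green κ q z a := fun z hz => green_pos_of_abs_le hκ hq (by
    rw [abs_of_pos (by linarith [hz.1] : 0 < z - a)]
    nlinarith [hz.2])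
  -- With both poles fixed, `g` is locally a constant times a product of two solutions of `u'' = (q
  -- + κ²) u`, so it can be differentiated by the product rule.
  have e1 : ∀ z ∈ Ioo a b, diagGreen κ q z = green κ q z a * green κ q z b / green κ q b a :=
    fun z hz => by
      rw [green_mul_green_eq hκ hq hc hz.1 hz.2 hab]
      field_simp
  -- This form of the slope involves a derivative of only one factor, so it can be differentiated
  -- once more using the equation for `G`.
  have e2 : ∀ z ∈ Ioo a b,
      greenSlope κ q z = 2 * (greenD κ q z a * green κ q z b) / green κ q b a + 1 := by
    intro z hz
    have h1 := greenD_mul_diagGreen_right hκ hq hc hz.1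
    have h2 := hA z hz
    have h3 : greenD κ q z a * green κ q z b = green κ q b a * ((greenSlope κ q z - 1) / 2) := by
      have h5 := green_mul_green_eq hκ hq hc hz.1 hz.2 hab
      refine mul_left_cancel₀ h2.ne' ?_
      linear_combination (greenD κ q z a) * h5 + green κ q b a * h1
    rw [h3]
    field_simp
    ring
  have e3 : greenD κ q x b * green κ q x a = green κ q b a * ((greenSlope κ q x + 1) / 2) := by
    have h1 := greenD_mul_diagGreen_left hκ hq hc hx.2
    have h2 := green_mul_green_eq hκ hq hc hx.1 hx.2 hab
    have h3 := diagGreen_pos hκ hq x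
    refine mul_left_cancel₀ h3.ne' ?_
    linear_combination green κ q x a * h1 + ((greenSlope κ q x + 1) / 2) * h2
  have hmem : Ioo a b ∈ 𝓝 x := Ioo_mem_nhds hx.1 hx.2
  have dA := hasDerivAt_green hκ hq hx.1.ne'
  have dB := hasDerivAt_green hκ hq hx.2.ne
  have dA' := hasDerivAt_greenD hκ hq hc hx.1.ne'
  have f2 := e2 x hx
  constructor
  · have := (dA.mul dB).div_const (green κ q b a)
    refine (this.congr_of_eventuallyEq ?_).congr_deriv ?_
    · filter_upwards [hmem] with z hz using e1 z hz
    · rw [div_eq_iff hc0.ne']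
      have f3 : greenD κ q x a * green κ q x b
          = green κ q b a * ((greenSlope κ q x - 1) / 2) := by
        rw [f2]; field_simp; ring
      linear_combination f3 + e3
  · have := (((dA'.mul dB).const_mul 2).div_const (green κ q b a)).add_const 1
    refine (this.congr_of_eventuallyEq ?_).congr_deriv ?_
    · filter_upwards [hmem] with z hz using e2 z hz
    · have f1 := e1 x hx
      have h1 := greenD_mul_diagGreen_right hκ hq hc hx.1
      have h2 := greenD_mul_diagGreen_left hκ hq hc hx.2
      have h3 := diagGreen_pos hκ hq x
      have h5 : green κ q x a * green κ q x b = diagGreen κ q x * green κ q b a :=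
        green_mul_green_eq hκ hq hc hx.1 hx.2 hab
      have f4 : greenD κ q x a * greenD κ q x b = (greenSlope κ q x ^ 2 - 1) / 4
          * green κ q b a / diagGreen κ q x := by
        rw [eq_div_iff h3.ne']
        refine mul_right_cancel₀ h3.ne' ?_
        linear_combination (greenD κ q x b * diagGreen κ q x) * h1
          + (green κ q x a * ((greenSlope κ q x - 1) / 2)) * h2
          + ((greenSlope κ q x ^ 2 - 1) / 4) * h5
      rw [mul_assoc, h5, f4, greenSlope₂]
      field_simp
      ring

/-- The derivative of the diagonal Green's function of a potential that is an almost everywhere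
limit of continuous ones. -/
theorem hasDerivAt_diagGreen_of_ae_tendsto (hκ : 0 < κ) (hq : Adm κ q) {p : ℕ → ℝ → ℝ}
    (hp : ∀ n, Adm κ (p n)) (hpc : ∀ n, Continuous (p n))
    (h : ∀ᵐ z, Tendsto (fun n => p n z) atTop (𝓝 (q z))) (x : ℝ) :
    HasDerivAt (diagGreen κ q) (greenSlope κ q x) x := by
  have hw := weakTendsto_of_ae_tendsto hp h
  -- The integrated form survives the limit, since the slopes converge pointwise and are bounded by
  -- `1/3`. Continuity of the limit slope then returns the derivative.
  have e : ∀ y, diagGreen κ q y = diagGreen κ q 0 + ∫ s in (0 : ℝ)..y, greenSlope κ q s := by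
    intro y
    have h1 : ∀ n, ∫ s in (0 : ℝ)..y, greenSlope κ (p n) s
        = diagGreen κ (p n) y - diagGreen κ (p n) 0 := fun n =>
      intervalIntegral.integral_eq_sub_of_hasDerivAt
        (fun s _ => (hasDerivAt_diagGreen_and_greenSlope hκ (hp n) (hpc n) s).1)
        ((continuous_greenSlope hκ (hp n)).intervalIntegrable _ _)
    have h2 : Tendsto (fun n => ∫ s in (0 : ℝ)..y, greenSlope κ (p n) s) atTop
        (𝓝 (∫ s in (0 : ℝ)..y, greenSlope κ q s)) := by
      refine intervalIntegral.tendsto_integral_filter_of_dominated_convergence (fun _ => 1 / 3)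
        (Eventually.of_forall fun n => (continuous_greenSlope hκ (hp n)).aestronglyMeasurable)
        (Eventually.of_forall fun n => Eventually.of_forall fun s _ =>
          abs_greenSlope_le hκ (hp n) s) intervalIntegrable_const
        (Eventually.of_forall fun s _ => hw.tendsto_greenSlope hκ hp hq s)
    have h3 := (hw.tendsto_diagGreen hκ hp hq y).sub (hw.tendsto_diagGreen hκ hp hq 0)
    simp only [← h1] at h3
    rw [tendsto_nhds_unique h2 h3]
    ring
  rw [show diagGreen κ q = _ from funext e]
  exact ((continuous_greenSlope hκ hq).integral_hasStrictDerivAt 0 x).hasDerivAt.const_add _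

end Single

end
end

section
open MeasureTheory Set Filter Topology
open scoped ContDiff SchwartzMap ENNReal

noncomputable section

/-! ### Evolution of the diagonal Green's function -/

/-- The integral of a derivative over the line, for a function with one jump. -/
theorem integral_of_hasDerivAt_of_jump {f f' : ℝ → ℝ} {a l r : ℝ}
    (hd : ∀ x, x ≠ a → HasDerivAt f (f' x) x) (hi : Integrable f')
    (hl : Tendsto f (𝓝[<] a) (𝓝 l)) (hr : Tendsto f (𝓝[>] a) (𝓝 r))
    (h0 : Tendsto f (cocompact ℝ) (𝓝 0)) : ∫ x, f' x = l - r := by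
  have eu : ∀ c x, x ≠ a → Function.update f a c =ᶠ[𝓝 x] f := fun c x hx => by
    filter_upwards [isOpen_ne.mem_nhds hx] with y hy using Function.update_of_ne hy _ _
  have e1 : ∫ x in Iic a, f' x = l := by
    have := integral_Iic_of_hasDerivAt_of_tendsto (f := Function.update f a l) (f' := f') (a := a)
      (m := 0) (continuousWithinAt_update_same.2 (by rwa [Iic_sdiff_right]))
      (fun x hx => (hd x (ne_of_lt hx)).congr_of_eventuallyEq (eu _ _ (ne_of_lt hx)))
      hi.integrableOn ((h0.mono_left atBot_le_cocompact).congr' ?_)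
    · simpa using this
    · filter_upwards [eventually_lt_atBot a] with x hx
      exact (Function.update_of_ne hx.ne _ _).symm
  have e2 : ∫ x in Ioi a, f' x = -r := by
    have := integral_Ioi_of_hasDerivAt_of_tendsto (f := Function.update f a r) (f' := f') (a := a)
      (m := 0) (continuousWithinAt_update_same.2 (by rwa [Ici_sdiff_left]))
      (fun x hx => (hd x (ne_of_gt hx)).congr_of_eventuallyEq (eu _ _ (ne_of_gt hx)))
      hi.integrableOn ((h0.mono_left atTop_le_cocompact).congr' ?_)
    · simpa using this
    · filter_upwards [eventually_gt_atTop a] with x hx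
      exact (Function.update_of_ne hx.ne' _ _).symm
  rw [← integral_add_compl measurableSet_Iic hi, compl_Iic, e1, e2]
  ring

theorem tendsto_mul_zero_of_bdd {α : Type*} {l : Filter α} {a b : α → ℝ} {C : ℝ}
    (ha : Tendsto a l (𝓝 0)) (hb : ∀ x, |b x| ≤ C) : Tendsto (fun x => a x * b x) l (𝓝 0) := by
  refine squeeze_zero_norm (a := fun x => |a x| * C) (fun x => ?_) (by simpa using ha.abs.mul_const C)
  rw [norm_mul]
  exact mul_le_mul_of_nonneg_left (hb x) (abs_nonneg _)

/-- `f` is three times continuously differentiable with bounded derivatives `f₁, f₂, f₃`. -/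
structure BddC3 (f f₁ f₂ f₃ : ℝ → ℝ) : Prop where
  d₀ : ∀ x, HasDerivAt f (f₁ x) x
  d₁ : ∀ x, HasDerivAt f₁ (f₂ x) x
  d₂ : ∀ x, HasDerivAt f₂ (f₃ x) x
  c₃ : Continuous f₃
  bdd : ∃ C, ∀ x, |f x| ≤ C ∧ |f₁ x| ≤ C ∧ |f₂ x| ≤ C ∧ |f₃ x| ≤ C

namespace BddC3
variable {f f₁ f₂ f₃ : ℝ → ℝ}

theorem c₀ (h : BddC3 f f₁ f₂ f₃) : Continuous f :=
  continuous_iff_continuousAt.2 fun x => (h.d₀ x).continuousAt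

theorem c₁ (h : BddC3 f f₁ f₂ f₃) : Continuous f₁ :=
  continuous_iff_continuousAt.2 fun x => (h.d₁ x).continuousAt

theorem c₂ (h : BddC3 f f₁ f₂ f₃) : Continuous f₂ :=
  continuous_iff_continuousAt.2 fun x => (h.d₂ x).continuousAt

theorem one : BddC3 (fun _ => 1) (fun _ => 0) (fun _ => 0) (fun _ => 0) :=
  ⟨fun x => hasDerivAt_const x 1, fun x => hasDerivAt_const x 0, fun x => hasDerivAt_const x 0,
    continuous_const, 1, fun _ => by simp⟩

end BddC3

section Single
variable {κ : ℝ} {q q₁ q₂ q₃ : ℝ → ℝ}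

theorem integrable_green_sq_mul (hκ : 0 < κ) (hq : Adm κ q) {h : ℝ → ℝ} {C : ℝ}
    (hc : Continuous h) (hC : ∀ z, |h z| ≤ C) (x : ℝ) :
    Integrable (fun y => green κ q y x * green κ q y x * h y) :=
  integrable_green_mul_mul_green hκ hq hc.aestronglyMeasurable (Eventually.of_forall hC) x

theorem abs_add_const_le {f : ℝ → ℝ} {C c : ℝ} (h : ∀ x, |f x| ≤ C) (x : ℝ) :
    |f x + c| ≤ C + |c| := (abs_add_le _ _).trans (by linarith [h x])

/-- The square of the Green's function is annihilated, up to a boundary term on the diagonal, by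
the adjoint of the third order operator of the potential. -/
theorem integral_green_sq_mul (hκ : 0 < κ) (hq : Adm κ q) (hqs : BddC3 q q₁ q₂ q₃)
    {f f₁ f₂ f₃ : ℝ → ℝ} (hf : BddC3 f f₁ f₂ f₃) (x : ℝ) :
    ∫ y, green κ q y x * green κ q y x
        * (-f₃ y + 4 * (q y + κ ^ 2) * f₁ y + 2 * q₁ y * f y)
      = 2 * diagGreen κ q x * f₁ x - 2 * greenSlope κ q x * f x := by
  have hc := hqs.c₀
  obtain ⟨C, hC⟩ := hf.bdd
  obtain ⟨Cq, hCq⟩ := hqs.bdd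
  have hC0 : 0 ≤ C := (abs_nonneg _).trans (hC 0).1
  have hCq0 : 0 ≤ Cq := (abs_nonneg _).trans (hCq 0).1
  have hV : ∀ y, |q y + κ ^ 2| ≤ Cq + |κ ^ 2| := abs_add_const_le fun y => (hCq y).1
  set u := fun z => green κ q z x with hu
  set w := fun z => greenD κ q z x with hw
  have hlim : ∀ {l : Filter ℝ} {m : ℝ}, l ≤ 𝓝 x → Tendsto w l (𝓝 m) →
      Tendsto (fun z => u z * u z * (-f₂ z + 2 * (q z + κ ^ 2) * f z) + u z * w z * (2 * f₁ z)
          + w z * w z * (-2 * f z)) l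
        (𝓝 (u x * u x * (-f₂ x + 2 * (q x + κ ^ 2) * f x) + u x * m * (2 * f₁ x)
          + m * m * (-2 * f x))) := by
    intro l m hl hm
    have t0 := (hf.c₀.tendsto x).mono_left hl
    have t1 := (hf.c₁.tendsto x).mono_left hl
    have t2 := (hf.c₂.tendsto x).mono_left hl
    have tq := (hc.tendsto x).mono_left hl
    have tu := ((continuous_green_left hκ hq x).tendsto x).mono_left hl
    exact (((tu.mul tu).mul (t2.neg.add (((tq.add_const _).const_mul 2).mul t0))).add
      ((tu.mul hm).mul (t1.const_mul 2))).add ((hm.mul hm).mul (t0.const_mul (-2)))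
  -- Off the pole, the derivative of `u² (-f'' + 2 (q + κ²) f) + 2 u u' f' - 2 (u')² f` is the
  -- integrand, by `u'' = (q + κ²) u`. At the pole only `u'` jumps, from `(greenSlope + 1)/2` to
  -- `(greenSlope - 1)/2`, which gives the right-hand side.
  have key := integral_of_hasDerivAt_of_jump (a := x)
    (f := fun z => u z * u z * (-f₂ z + 2 * (q z + κ ^ 2) * f z) + u z * w z * (2 * f₁ z)
      + w z * w z * (-2 * f z))
    (f' := fun y => green κ q y x * green κ q y x
        * (-f₃ y + 4 * (q y + κ ^ 2) * f₁ y + 2 * q₁ y * f y)) (fun z hz => ?_) ?_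
    (hlim nhdsWithin_le_nhds (tendsto_greenD_left hκ hq hc x))
    (hlim nhdsWithin_le_nhds (tendsto_greenD_right hκ hq hc x)) ?_
  · rw [key]
    simp only [hu, diagGreen]
    ring
  · have du : HasDerivAt u (w z) z := hasDerivAt_green hκ hq hz
    have dw : HasDerivAt w ((q z + κ ^ 2) * u z) z := hasDerivAt_greenD hκ hq hc hz
    convert! (((du.mul du).mul ((hf.d₂ z).neg.add
      ((((hqs.d₀ z).add_const (κ ^ 2)).const_mul 2).mul (hf.d₀ z)))).add
      ((du.mul dw).mul ((hf.d₁ z).const_mul 2))).add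
      ((dw.mul dw).mul ((hf.d₀ z).const_mul (-2))) using 1
    simp
    ring
  · refine integrable_green_sq_mul hκ hq (C := C + 4 * (Cq + |κ ^ 2|) * C + 2 * Cq * C) ?_
      (fun y => ?_) x
    · have h1 := hf.c₁
      have h2 := hf.c₃
      have h3 := hf.c₀
      have h4 := hqs.c₁
      fun_prop
    · obtain ⟨b0, b1, b2, b3⟩ := hC y
      obtain ⟨p0, p1, p2, p3⟩ := hCq y
      refine (abs_add_three _ _ _).trans ?_
      rw [abs_neg, abs_mul, abs_mul, abs_mul, abs_mul, abs_of_pos (by norm_num : (0 : ℝ) < 4),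
        abs_of_pos (by norm_num : (0 : ℝ) < 2)]
      have := hV y
      gcongr
  · have tu := tendsto_green_cocompact hκ hq x
    have tw := tendsto_greenD_cocompact hκ hq x
    have r1 := tendsto_mul_zero_of_bdd (C := C + 2 * (Cq + |κ ^ 2|) * C)
      (b := fun z => -f₂ z + 2 * (q z + κ ^ 2) * f z) (by simpa only [mul_zero] using tu.mul tu) (fun z => by
        refine (abs_add_le _ _).trans ?_
        rw [abs_neg, abs_mul, abs_mul, abs_of_pos (by norm_num : (0 : ℝ) < 2)]
        have := hV z
        obtain ⟨b0, b1, b2, b3⟩ := hC z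
        gcongr)
    have r2 := tendsto_mul_zero_of_bdd (C := 2 * C) (b := fun z => 2 * f₁ z)
      (by simpa only [mul_zero] using tu.mul tw) (fun z => by
        rw [abs_mul, abs_of_pos (by norm_num : (0 : ℝ) < 2)]
        have := (hC z).2.1
        gcongr)
    have r3 := tendsto_mul_zero_of_bdd (C := 2 * C) (b := fun z => -2 * f z)
      (by simpa only [mul_zero] using tw.mul tw) (fun z => by
        rw [abs_mul, abs_neg, abs_of_pos (by norm_num : (0 : ℝ) < 2)]
        have := (hC z).1
        gcongr)
    simpa only [add_zero] using (r1.add r2).add r3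

/-- The contribution of a commutator `r` to the evolution of the diagonal Green's function. -/
def commForcing (κ : ℝ) (q r : ℝ → ℝ) (x : ℝ) : ℝ :=
  ∫ y, green κ q y x * greenD κ q y x * r y

theorem abs_green_mul_greenD_le (hκ : 0 < κ) (hq : Adm κ q) (x y : ℝ) :
    |green κ q y x * greenD κ q y x| ≤ 1 / κ * Real.exp (-κ * |x - y|) := by
  rw [abs_mul]
  calc _ ≤ (1 / κ * Real.exp (-(κ / 2) * |y - x|)) * (Real.exp (-(κ / 2) * |y - x|)) :=
        mul_le_mul (abs_green_le_exp hκ hq y x) (abs_greenD_le hκ hq y x) (abs_nonneg _)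
          (by positivity)
    _ = 1 / κ * (Real.exp (-(κ / 2) * |y - x|) * Real.exp (-(κ / 2) * |y - x|)) := by ring
    _ = _ := by rw [← Real.exp_add, abs_sub_comm]; ring_nf

theorem measurable_greenD_left (hκ : 0 < κ) (hq : Adm κ q) (hc : Continuous q) (x : ℝ) :
    Measurable (fun y => greenD κ q y x) := by
  refine Measurable.sub ?_ (Continuous.measurable (continuous_iff_continuousAt.2 fun z =>
    (hasDerivAt_resD_mul_green hκ hq hc z x).continuousAt))
  unfold freeGreenD
  refine Measurable.mul ?_ (by fun_prop)
  exact Measurable.ite measurableSet_Iio measurable_const measurable_const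

theorem integrable_green_mul_greenD_mul (hκ : 0 < κ) (hq : Adm κ q) (hc : Continuous q)
    {r : ℝ → ℝ} {C : ℝ} (hr : AEStronglyMeasurable r volume) (hC : ∀ᵐ z, |r z| ≤ C) (x : ℝ) :
    Integrable (fun y => green κ q y x * greenD κ q y x * r y) := by
  refine Integrable.mul_bdd (c := C) ?_ hr (by simpa using hC)
  exact ((integrable_exp_neg_mul_abs_sub hκ x).const_mul (1 / κ)).mono'
    ((continuous_green_left hκ hq x).aestronglyMeasurable.mul
      (measurable_greenD_left hκ hq hc x).aestronglyMeasurable)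
    (Eventually.of_forall fun y => abs_green_mul_greenD_le hκ hq x y)

theorem abs_commForcing_le (hκ : 0 < κ) (hq : Adm κ q) {r : ℝ → ℝ} {C : ℝ}
    (hC : ∀ᵐ z, |r z| ≤ C) (x : ℝ) : |commForcing κ q r x| ≤ 2 * C / κ ^ 2 := by
  have hC0 : 0 ≤ C := by
    obtain ⟨z, hz⟩ := hC.exists
    exact (abs_nonneg _).trans hz
  refine abs_integral_le_integral_abs.trans ((integral_mono_of_nonneg
    (Eventually.of_forall fun z => abs_nonneg _)
    (((integrable_exp_neg_mul_abs_sub hκ x).const_mul (1 / κ)).mul_const C) ?_).trans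
      (le_of_eq ?_))
  · filter_upwards [hC] with y hy
    rw [abs_mul]
    exact mul_le_mul (abs_green_mul_greenD_le hκ hq x y) hy (abs_nonneg _) (by positivity)
  · rw [integral_mul_const, integral_const_mul, integral_exp_neg_mul_abs_sub hκ]
    field_simp

/-- Since `G²` is continuous across the pole, integration by parts leaves no diagonal term. Moving
the derivative onto `G²` lets a commutator be controlled by its size alone, without bounds on its
derivative. -/
theorem integral_green_sq_mul_deriv (hκ : 0 < κ) (hq : Adm κ q) (hc : Continuous q)
    {r r' : ℝ → ℝ} {C : ℝ} (hr : ∀ z, HasDerivAt r (r' z) z) (hr' : Continuous r')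
    (hC : ∀ z, |r z| ≤ C) (hC' : ∀ z, |r' z| ≤ C) (x : ℝ) :
    ∫ y, green κ q y x * green κ q y x * r' y = -2 * commForcing κ q r x := by
  have hrc : Continuous r := continuous_iff_continuousAt.2 fun z => (hr z).continuousAt
  have i1 := integrable_green_sq_mul hκ hq hr' hC' x
  have i2 := integrable_green_mul_greenD_mul hκ hq hc hrc.aestronglyMeasurable
    (Eventually.of_forall hC) x
  have hcont : Continuous (fun z => green κ q z x * green κ q z x * r z) :=
    ((continuous_green_left hκ hq x).mul (continuous_green_left hκ hq x)).mul hrc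
  have tu := tendsto_green_cocompact hκ hq x
  have key := integral_of_hasDerivAt_of_jump (a := x)
    (f := fun z => green κ q z x * green κ q z x * r z)
    (f' := fun z => green κ q z x * green κ q z x * r' z
      + 2 * (green κ q z x * greenD κ q z x * r z)) (fun z hz => ?_) (i1.add (i2.const_mul 2))
    ((hcont.tendsto x).mono_left nhdsWithin_le_nhds)
    ((hcont.tendsto x).mono_left nhdsWithin_le_nhds)
    (tendsto_mul_zero_of_bdd (by simpa only [mul_zero] using tu.mul tu) hC)
  · rw [integral_add i1 (i2.const_mul 2), integral_const_mul, sub_self] at key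
    rw [commForcing]
    linarith
  · have du := hasDerivAt_green hκ hq hz
    convert! (du.mul du).mul (hr z) using 1
    simp
    ring

/-- The pairing of `G²` with a forced KdV right-hand side. -/
theorem integral_green_sq_mul_kdv (hκ : 0 < κ) (hq : Adm κ q) (hqs : BddC3 q q₁ q₂ q₃)
    {s s' F : ℝ → ℝ} {C : ℝ} (hs : ∀ z, HasDerivAt s (s' z) z) (hs' : Continuous s')
    (hC : ∀ z, |s z| ≤ C) (hC' : ∀ z, |s' z| ≤ C) (hF : Continuous F) (hFC : ∀ z, |F z| ≤ C)
    (x : ℝ) :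
    -∫ y, green κ q y x * green κ q y x * (-q₃ y + 3 * s' y + F y)
      = -2 * diagGreen κ q x * q₁ x + 2 * q x * greenSlope κ q x - 4 * κ ^ 2 * greenSlope κ q x
        - (modifiedForcing κ q F x - 6 * commForcing κ q (fun z => s z - q z ^ 2) x) := by
  obtain ⟨Cq, hCq⟩ := hqs.bdd
  have hCq0 : 0 ≤ Cq := (abs_nonneg _).trans (hCq 0).1
  have hc := hqs.c₀
  have hc1 := hqs.c₁
  have hc3 := hqs.c₃
  have e1 := integral_green_sq_mul hκ hq hqs hqs x
  have e2 := integral_green_sq_mul hκ hq hqs BddC3.one x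
  have hC0 : 0 ≤ C := (abs_nonneg _).trans (hC 0)
  have e3 := integral_green_sq_mul_deriv hκ hq hc (r := fun z => s z - q z ^ 2)
    (r' := fun z => s' z - 2 * q z * q₁ z) (C := C + 2 * Cq * Cq) (fun z => by
      convert! (hs z).sub ((hqs.d₀ z).pow 2) using 1
      simp) (by fun_prop) (fun z => by
        refine (abs_sub _ _).trans ?_
        rw [abs_pow]
        have h1 := hC z
        have h2 : |q z| ^ 2 ≤ Cq ^ 2 := pow_le_pow_left₀ (abs_nonneg _) (hCq z).1 2
        nlinarith) (fun z => by
        refine (abs_sub _ _).trans ?_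
        rw [abs_mul, abs_mul, abs_of_pos (by norm_num : (0 : ℝ) < 2)]
        have h1 := hC' z
        obtain ⟨b0, b1, b2, b3⟩ := hCq z
        gcongr) x
  rw [modifiedForcing_eq hκ hq]
  have i1 : Integrable (fun y => green κ q y x * green κ q y x
      * (-q₃ y + 4 * (q y + κ ^ 2) * q₁ y + 2 * q₁ y * q y)) := by
    refine integrable_green_sq_mul hκ hq
      (C := Cq + 4 * (Cq + |κ ^ 2|) * Cq + 2 * Cq * Cq) (by fun_prop) (fun y => ?_) x
    obtain ⟨p0, p1, p2, p3⟩ := hCq y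
    refine (abs_add_three _ _ _).trans ?_
    rw [abs_neg, abs_mul, abs_mul, abs_mul, abs_mul, abs_of_pos (by norm_num : (0 : ℝ) < 4),
      abs_of_pos (by norm_num : (0 : ℝ) < 2)]
    have := abs_add_const_le (f := q) (c := κ ^ 2) (fun y => (hCq y).1) y
    gcongr
  have i2 : Integrable (fun y => green κ q y x * green κ q y x
      * (-0 + 4 * (q y + κ ^ 2) * 0 + 2 * q₁ y * 1)) := by
    refine integrable_green_sq_mul hκ hq (C := 2 * Cq) (by fun_prop) (fun y => ?_) x
    rw [mul_zero, neg_zero, zero_add, zero_add, mul_one, abs_mul, abs_of_pos (by norm_num : (0 : ℝ) < 2)]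
    have := (hCq y).2.1
    gcongr
  have i3 : Integrable (fun y => green κ q y x * green κ q y x * (s' y - 2 * q y * q₁ y)) := by
    refine integrable_green_sq_mul hκ hq (C := C + 2 * Cq * Cq) (by fun_prop) (fun y => ?_) x
    refine (abs_sub _ _).trans ?_
    rw [abs_mul, abs_mul, abs_of_pos (by norm_num : (0 : ℝ) < 2)]
    have h1 := hC' y
    obtain ⟨b0, b1, b2, b3⟩ := hCq y
    gcongr
  have i4 := integrable_green_sq_mul hκ hq hF hFC x
  -- The third order operator applied to `q` gives `-q''' + 6 q q' + 4 κ² q'`. Applied to `1` it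
  -- gives `2 q'`, which removes the excess `4 κ² q'`. What is left is the commutator `3 (s - q²)'`
  -- and the forcing.
  have e4 : ∫ y, green κ q y x * green κ q y x * (-q₃ y + 3 * s' y + F y)
      = (∫ y, green κ q y x * green κ q y x
          * (-q₃ y + 4 * (q y + κ ^ 2) * q₁ y + 2 * q₁ y * q y))
        - 2 * κ ^ 2 * (∫ y, green κ q y x * green κ q y x
          * (-0 + 4 * (q y + κ ^ 2) * 0 + 2 * q₁ y * 1))
        + 3 * (∫ y, green κ q y x * green κ q y x * (s' y - 2 * q y * q₁ y))
        + ∫ y, green κ q y x * green κ q y x * F y := by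
    have j1 : Integrable (fun y => green κ q y x * green κ q y x
        * (-q₃ y + 4 * (q y + κ ^ 2) * q₁ y + 2 * q₁ y * q y)
        - 2 * κ ^ 2 * (green κ q y x * green κ q y x
          * (-0 + 4 * (q y + κ ^ 2) * 0 + 2 * q₁ y * 1))) := i1.sub (i2.const_mul _)
    have j2 : Integrable (fun y => green κ q y x * green κ q y x
        * (-q₃ y + 4 * (q y + κ ^ 2) * q₁ y + 2 * q₁ y * q y)
        - 2 * κ ^ 2 * (green κ q y x * green κ q y x
          * (-0 + 4 * (q y + κ ^ 2) * 0 + 2 * q₁ y * 1))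
        + 3 * (green κ q y x * green κ q y x * (s' y - 2 * q y * q₁ y))) :=
      j1.add (i3.const_mul _)
    rw [← integral_const_mul, ← integral_const_mul, ← integral_sub i1 (i2.const_mul _),
      ← integral_add j1 (i3.const_mul _), ← integral_add j2 i4]
    exact integral_congr_ae (Eventually.of_forall fun y => by ring)
  rw [e4, e1, e2, e3]
  ring

end Single

/-- The time derivative of the diagonal Green's function. -/
theorem hasDerivAt_diagGreen_time {κ C t : ℝ} (hκ : 0 < κ) {q : ℝ → ℝ → ℝ} {q' : ℝ → ℝ}
    (hq : ∀ s, Adm κ (q s)) (hd : ∀ z, HasDerivAt (fun s => q s z) (q' z) t)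
    (hlip : ∀ s z, |q s z - q t z| ≤ C * |s - t|) (x : ℝ) :
    HasDerivAt (fun s => diagGreen κ (q s) x)
      (-∫ y, green κ (q t) y x * green κ (q t) y x * q' y) t := by
  rw [hasDerivAt_iff_tendsto_slope, ← integral_neg]
  have hw : WeakTendsto (𝓝[≠] t) q (q t) := weakTendsto_of_ae_tendsto hq
    (Eventually.of_forall fun z => (hd z).continuousAt.tendsto.mono_left nhdsWithin_le_nhds)
  -- The second resolvent identity makes the difference quotient exact, with one Green's function at
  -- each of the two times; only the one at time `s` moves in the limit.
  have e : ∀ s, slope (fun s => diagGreen κ (q s) x) t s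
      = ∫ z, -(green κ (q t) z x * green κ (q s) z x * slope (fun s => q s z) t s) := by
    intro s
    rw [slope_def_field, diagGreen_sub hκ (hq s) (hq t), div_eq_mul_inv, ← integral_mul_const]
    refine integral_congr_ae (Eventually.of_forall fun z => ?_)
    simp only [slope_def_field]
    ring
  rw [show slope (fun s => diagGreen κ (q s) x) t = _ from funext e]
  refine tendsto_integral_filter_of_dominated_convergence
    (fun z => |green κ (q t) z x| * (2 / (3 * κ)) * |C|)
    (Eventually.of_forall fun s => ?_) (Eventually.of_forall fun s => Eventually.of_forall fun z => ?_)
    (((integrable_green hκ (hq t) x).abs.mul_const _).mul_const _)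
    (Eventually.of_forall fun z => ?_)
  · simp only [slope_def_field, div_eq_mul_inv]
    exact (((continuous_green_left hκ (hq t) x).aestronglyMeasurable.mul
      (continuous_green_left hκ (hq s) x).aestronglyMeasurable).mul
      (((hq s).meas.sub (hq t).meas).mul aestronglyMeasurable_const)).neg
  · rw [norm_neg, norm_mul, norm_mul]
    refine mul_le_mul (mul_le_mul_of_nonneg_left (abs_green_le hκ (hq s) z x) (abs_nonneg _)) ?_
      (norm_nonneg _) (by positivity)
    rw [slope_def_field, Real.norm_eq_abs, abs_div]
    refine div_le_of_le_mul₀ (abs_nonneg _) (abs_nonneg _) ((hlip s z).trans ?_)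
    exact mul_le_mul_of_nonneg_right (le_abs_self C) (abs_nonneg _)
  · exact ((tendsto_const_nhds.mul (hw.tendsto_green hκ hq (hq t) z x)).mul
      (hasDerivAt_iff_tendsto_slope.1 (hd z))).neg

end
end

section
open MeasureTheory Set Filter Topology
open scoped ContDiff SchwartzMap ENNReal

noncomputable section

/-! ### Integrands as polynomials in jets -/

/-- The values from which all integrands are formed polynomially. -/
def jet (g₁ g₂ d₁ d₂ q₁ q₂ f₁ f₂ : ℝ) : Fin 10 → ℝ :=
  ![g₁, g₂, g₁⁻¹, g₂⁻¹, d₁, d₂, q₁, q₂, f₁, f₂]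

/-- A differential expression in the weight `ψ`, with coefficients depending on a jet. -/
def jetForm (c : Fin 4 → (Fin 10 → ℝ) → ℝ) (ψ : ℝ → ℝ) (v : Fin 10 → ℝ) (x : ℝ) : ℝ :=
  ∑ k : Fin 4, c k v * iteratedDeriv k ψ x

def distPoly (v : Fin 10 → ℝ) : ℝ := (v 0 - v 1) ^ 2 * (v 2 * v 3) / 2

/-- In this and the following families, entry `k` multiplies the `k`-th derivative of the weight.
The reciprocals of the Green's functions are the independent entries `v 2`, `v 3`, so that no
division occurs and every coefficient is continuous on the whole jet space. -/
def distCoeff : Fin 4 → (Fin 10 → ℝ) → ℝ := ![distPoly, fun _ => 0, fun _ => 0, fun _ => 0]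

def bulkCoeff (κ : ℝ) : Fin 4 → (Fin 10 → ℝ) → ℝ :=
  ![fun v => 3 / 2 * distPoly v * (-(v 4 * v 2 ^ 3 + v 5 * v 3 ^ 3)
      - (2 * κ ^ 2 - v 4 * v 5 / 2 * (v 2 * v 3)) * (v 4 * v 2 + v 5 * v 3)
      - 2 * (v 6 * v 5 * v 3 + v 7 * v 4 * v 2)
      + 1 / 2 * (v 2 * v 3) * (v 4 * v 3 + v 5 * v 2)),
    fun v => -(3 / 2) * distPoly v * (5 / 2 * (v 4 * v 2 + v 5 * v 3) ^ 2
      - 7 * (v 4 * v 5 * (v 2 * v 3)) - 12 * κ ^ 2 + 3 / 2 * ((v 4 - v 5) ^ 2 * (v 2 * v 3))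
      + (1 / 2 - 2 * v 4 * v 5) * (v 2 - v 3) ^ 2 + 2 * v 6 * (v 0 * v 3)
      + 2 * v 7 * (v 1 * v 2) + 2 * κ ^ 2 * (v 0 * v 3 + v 1 * v 2) - 2 * (v 6 + v 7)),
    fun v => 3 / 2 * distPoly v * (-(v 4 * v 3 + v 5 * v 2) + 2 * (v 4 * v 2 + v 5 * v 3)),
    fun v => -(1 / 2) * distPoly v]

def fluxCoeff : Fin 4 → (Fin 10 → ℝ) → ℝ :=
  ![fun _ => 0,
    fun v => (v 0 - v 1) * (v 2 * v 3)
      * (2 * v 6 * v 0 - 2 * v 7 * v 1 + v 4 ^ 2 / 2 * v 2 - v 5 ^ 2 / 2 * v 3),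
    fun _ => 0, fun _ => 0]

def forcingCoeff : Fin 4 → (Fin 10 → ℝ) → ℝ :=
  ![fun v => (v 0 ^ 2 - v 1 ^ 2) * (v 2 * v 3) / 2 * (v 8 * v 2 - v 9 * v 3),
    fun _ => 0, fun _ => 0, fun _ => 0]

/-- The coefficients of the time derivative of the weighted distance. -/
def rhsCoeff (κ : ℝ) (k : Fin 4) (v : Fin 10 → ℝ) : ℝ :=
  bulkCoeff κ k v + 3 / 2 * fluxCoeff k v - forcingCoeff k v

def qDiffCoeff (κ : ℝ) : Fin 4 → (Fin 10 → ℝ) → ℝ :=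
  ![fun v => (v 0 - v 1) * (-(1 / 2) * (v 2 + v 3) * (2 * (v 6 + v 7) + 4 * κ ^ 2
      - 1 / 2 * (v 2 + v 3) ^ 2 + 3 * (v 2 * v 3))
      + 3 / 4 * (v 4 ^ 2 * v 2 ^ 3 + v 5 ^ 2 * v 3 ^ 3)
      - 1 / 4 * (v 2 * v 3) * (v 4 ^ 2 * v 2 + v 5 ^ 2 * v 3)),
    fun v => (v 0 - v 1) * (1 / 2 * (3 * (-(v 4 * v 2 ^ 2 + v 5 * v 3 ^ 2))
      + (v 4 + v 5) * (v 2 * v 3))),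
    fun v => (v 0 - v 1) * (v 2 + v 3), fun _ => 0]

def diffCoeff : Fin 4 → (Fin 10 → ℝ) → ℝ :=
  ![fun v => v 6 - v 7, fun _ => 0, fun _ => 0, fun _ => 0]

/-- The density whose spatial derivative is the defect between the time derivative of the
weighted distance density and the integrands of the first identity. -/
def rhsFluxCoeff (κ : ℝ) : Fin 4 → (Fin 10 → ℝ) → ℝ :=
  ![fun v => 3 / 4 * v 2 ^ 2 + 3 / 4 * v 3 ^ 2 - 1 / 4 * v 2 ^ 3 * v 1 - 1 / 4 * v 3 ^ 3 * v 0
      - v 2 * v 3 + 1 / 2 * (v 2 * v 3) * (v 4 ^ 2 + v 5 ^ 2) - 3 / 2 * (v 2 * v 3) * (v 4 * v 5)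
      + 1 / 4 * (v 2 ^ 2 + v 3 ^ 2) * (v 4 * v 5) + (v 6 - v 7) * (v 1 * v 2 - v 0 * v 3)
      - 3 * κ ^ 2 * (v 0 * v 3 + v 1 * v 2) + 6 * κ ^ 2,
    fun v => v 4 * (15 / 4 * v 2 - 13 / 4 * v 3 + 3 / 4 * v 0 * v 3 ^ 2 - 5 / 4 * v 2 ^ 2 * v 1)
      + v 5 * (15 / 4 * v 3 - 13 / 4 * v 2 + 3 / 4 * v 1 * v 2 ^ 2 - 5 / 4 * v 3 ^ 2 * v 0),
    fun v => 1 / 4 * (v 0 * v 3 + v 1 * v 2) - 1 / 2, fun _ => 0]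

/-- The density whose spatial derivative is the defect in the second identity. -/
def qDiffFluxCoeff : Fin 4 → (Fin 10 → ℝ) → ℝ :=
  ![fun v => v 4 * (2 * v 2 + 1 / 2 * v 3 - 1 / 2 * v 2 ^ 2 * v 1)
      - v 5 * (2 * v 3 + 1 / 2 * v 2 - 1 / 2 * v 3 ^ 2 * v 0),
    fun v => v 1 * v 2 - v 0 * v 3, fun _ => 0, fun _ => 0]

theorem continuous_distPoly : Continuous distPoly := by
  unfold distPoly
  fun_prop

theorem continuous_distCoeff (k : Fin 4) : Continuous (distCoeff k) := by
  have := continuous_distPoly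
  fin_cases k <;> simp [distCoeff] <;> fun_prop

theorem continuous_bulkCoeff (κ : ℝ) (k : Fin 4) : Continuous (bulkCoeff κ k) := by
  fin_cases k <;> simp [bulkCoeff, distPoly] <;> fun_prop

theorem continuous_fluxCoeff (k : Fin 4) : Continuous (fluxCoeff k) := by
  fin_cases k <;> simp [fluxCoeff] <;> fun_prop

theorem continuous_forcingCoeff (k : Fin 4) : Continuous (forcingCoeff k) := by
  fin_cases k <;> simp [forcingCoeff] <;> fun_prop

theorem continuous_rhsCoeff (κ : ℝ) (k : Fin 4) : Continuous (rhsCoeff κ k) :=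
  ((continuous_bulkCoeff κ k).add (continuous_const.mul (continuous_fluxCoeff k))).sub
    (continuous_forcingCoeff k)

theorem continuous_qDiffCoeff (κ : ℝ) (k : Fin 4) : Continuous (qDiffCoeff κ k) := by
  fin_cases k <;> simp [qDiffCoeff] <;> fun_prop

theorem continuous_diffCoeff (k : Fin 4) : Continuous (diffCoeff k) := by
  fin_cases k <;> simp [diffCoeff] <;> fun_prop

theorem continuous_rhsFluxCoeff (κ : ℝ) (k : Fin 4) : Continuous (rhsFluxCoeff κ k) := by
  fin_cases k <;> simp [rhsFluxCoeff] <;> fun_prop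

theorem continuous_qDiffFluxCoeff (k : Fin 4) : Continuous (qDiffFluxCoeff k) := by
  fin_cases k <;> simp [qDiffFluxCoeff] <;> fun_prop

section Form
variable {c : Fin 4 → (Fin 10 → ℝ) → ℝ} (ψ : 𝓢(ℝ, ℝ))

theorem exists_schwartz_iteratedDeriv (k : ℕ) : ∃ φ : 𝓢(ℝ, ℝ), ⇑φ = iteratedDeriv k ψ := by
  induction k with
  | zero => exact ⟨ψ, iteratedDeriv_zero.symm⟩
  | succ k ih =>
    obtain ⟨φ, hφ⟩ := ih
    refine ⟨SchwartzMap.derivCLM ℝ ℝ φ, ?_⟩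
    rw [iteratedDeriv_succ, ← hφ]
    rfl

theorem continuous_iteratedDeriv_schwartz (k : ℕ) : Continuous (iteratedDeriv k ψ) := by
  obtain ⟨φ, hφ⟩ := exists_schwartz_iteratedDeriv ψ k
  rw [← hφ]
  exact φ.continuous

theorem hasDerivAt_iteratedDeriv_schwartz (k : ℕ) (x : ℝ) :
    HasDerivAt (iteratedDeriv k ψ) (iteratedDeriv (k + 1) ψ x) x := by
  obtain ⟨φ, hφ⟩ := exists_schwartz_iteratedDeriv ψ k
  rw [iteratedDeriv_succ, ← hφ]
  exact φ.hasDerivAt x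

/-- The sum of the absolute values of the derivatives of the weight up to order three. -/
def envelope (ψ : ℝ → ℝ) (x : ℝ) : ℝ := ∑ k : Fin 4, |iteratedDeriv k ψ x|

theorem integrable_envelope : Integrable (envelope ψ) := by
  refine integrable_finsetSum _ fun k _ => ?_
  obtain ⟨φ, hφ⟩ := exists_schwartz_iteratedDeriv ψ k
  rw [← hφ]
  exact φ.integrable.abs

theorem tendsto_envelope : Tendsto (envelope ψ) (cocompact ℝ) (𝓝 0) := by
  have : Tendsto (envelope ψ) (cocompact ℝ) (𝓝 (∑ _k : Fin 4, 0)) := by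
    refine tendsto_finsetSum _ fun k _ => ?_
    obtain ⟨φ, hφ⟩ := exists_schwartz_iteratedDeriv ψ k
    rw [← hφ]
    simpa using φ.tendsto_cocompact.abs
  simpa using this

theorem abs_jetForm_le {ψ : ℝ → ℝ} {v : Fin 10 → ℝ} {C : ℝ} (h : ∀ k, |c k v| ≤ C) (x : ℝ) :
    |jetForm c ψ v x| ≤ C * envelope ψ x := by
  rw [envelope, Finset.mul_sum]
  refine (Finset.abs_sum_le_sum_abs _ _).trans (Finset.sum_le_sum fun k _ => ?_)
  rw [abs_mul]
  exact mul_le_mul_of_nonneg_right (h k) (abs_nonneg _)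

/-- Closed balls of the jet space are compact. All jets in use lie in one ball, so every domination
reduces to a constant times the integrable `envelope ψ`. -/
theorem exists_bound_coeff (hc : ∀ k, Continuous (c k)) (R : ℝ) :
    ∃ C, ∀ v, ‖v‖ ≤ R → ∀ k, |c k v| ≤ C := by
  have h : ∀ k, ∃ C, ∀ v ∈ Metric.closedBall (0 : Fin 10 → ℝ) R, ‖c k v‖ ≤ C := fun k =>
    (isCompact_closedBall _ _).exists_bound_of_continuousOn (hc k).continuousOn
  choose C hC using h
  refine ⟨∑ k, |C k|, fun v hv k => (hC k v (by simpa using hv)).trans ((le_abs_self _).trans ?_)⟩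
  exact Finset.single_le_sum (f := fun k => |C k|) (fun _ _ => abs_nonneg _) (Finset.mem_univ k)

theorem continuous_jetForm (hc : ∀ k, Continuous (c k)) :
    Continuous (fun p : (Fin 10 → ℝ) × ℝ => jetForm c ψ p.1 p.2) := by
  refine continuous_finsetSum _ fun k _ => ?_
  exact ((hc k).comp continuous_fst).mul ((continuous_iteratedDeriv_schwartz ψ k).comp continuous_snd)

theorem tendsto_jetForm (hc : ∀ k, Continuous (c k)) {ι : Type*} {l : Filter ι}
    {v : ι → Fin 10 → ℝ} {v₀ : Fin 10 → ℝ} (h : Tendsto v l (𝓝 v₀)) (x : ℝ) :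
    Tendsto (fun i => jetForm c ψ (v i) x) l (𝓝 (jetForm c ψ v₀ x)) :=
  ((continuous_jetForm ψ hc).tendsto (v₀, x)).comp (h.prodMk_nhds tendsto_const_nhds)

theorem aestronglyMeasurable_jetForm (hc : ∀ k, Continuous (c k)) {α : Type*}
    [MeasurableSpace α] {μ : Measure α} {v : α → Fin 10 → ℝ} {ξ : α → ℝ}
    (hv : AEStronglyMeasurable v μ) (hξ : AEStronglyMeasurable ξ μ) :
    AEStronglyMeasurable (fun a => jetForm c ψ (v a) (ξ a)) μ :=
  (continuous_jetForm ψ hc).comp_aestronglyMeasurable (hv.prodMk hξ)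

theorem integrable_jetForm (hc : ∀ k, Continuous (c k)) {v : ℝ → Fin 10 → ℝ} {R : ℝ}
    (hv : AEStronglyMeasurable v volume) (hR : ∀ᵐ x, ‖v x‖ ≤ R) :
    Integrable (fun x => jetForm c ψ (v x) x) := by
  obtain ⟨C, hC⟩ := exists_bound_coeff hc R
  refine ((integrable_envelope ψ).const_mul C).mono'
    (aestronglyMeasurable_jetForm ψ hc hv aestronglyMeasurable_id) ?_
  filter_upwards [hR] with x hx using abs_jetForm_le (hC _ hx) x

theorem tendsto_jetForm_cocompact (hc : ∀ k, Continuous (c k)) {v : ℝ → Fin 10 → ℝ} {R : ℝ}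
    (hR : ∀ x, ‖v x‖ ≤ R) :
    Tendsto (fun x => jetForm c ψ (v x) x) (cocompact ℝ) (𝓝 0) := by
  obtain ⟨C, hC⟩ := exists_bound_coeff hc R
  exact squeeze_zero_norm (fun x => abs_jetForm_le (hC _ (hR x)) x)
    (by simpa using (tendsto_envelope ψ).const_mul C)

/-- Dominated convergence for weighted integrals of jet forms. -/
theorem tendsto_integral_jetForm (hc : ∀ k, Continuous (c k)) {v : ℕ → ℝ → Fin 10 → ℝ}
    {v₀ : ℝ → Fin 10 → ℝ} {R : ℝ} (hv : ∀ n, AEStronglyMeasurable (v n) volume)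
    (hR : ∀ n, ∀ᵐ x, ‖v n x‖ ≤ R) (hlim : ∀ᵐ x, Tendsto (fun n => v n x) atTop (𝓝 (v₀ x))) :
    Tendsto (fun n => ∫ x, jetForm c ψ (v n x) x) atTop (𝓝 (∫ x, jetForm c ψ (v₀ x) x)) := by
  obtain ⟨C, hC⟩ := exists_bound_coeff hc R
  refine tendsto_integral_of_dominated_convergence (fun x => C * envelope ψ x)
    (fun n => aestronglyMeasurable_jetForm ψ hc (hv n) aestronglyMeasurable_id)
    ((integrable_envelope ψ).const_mul C) (fun n => ?_) ?_
  · filter_upwards [hR n] with x hx using abs_jetForm_le (hC _ hx) x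
  · filter_upwards [hlim] with x hx using tendsto_jetForm ψ hc hx x

end Form

section Eval
variable {κ x : ℝ} {q₁ q₂ g₁ g₂ f₁ f₂ ψ : ℝ → ℝ} (b₁ b₂ : ℝ)

theorem greenDist_mul_eq_jetForm (d₁ d₂ : ℝ) : greenDist g₁ g₂ x * ψ x
    = jetForm distCoeff ψ (jet (g₁ x) (g₂ x) d₁ d₂ (q₁ x) (q₂ x) b₁ b₂) x := by
  simp [jetForm, Fin.sum_univ_four, distCoeff, distPoly, jet, greenDist, div_eq_mul_inv]
  left
  ring

theorem bulkIntegrand_eq_jetForm : bulkIntegrand κ q₁ q₂ g₁ g₂ ψ x = jetForm (bulkCoeff κ) ψ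
    (jet (g₁ x) (g₂ x) (deriv g₁ x) (deriv g₂ x) (q₁ x) (q₂ x) b₁ b₂) x := by
  simp [jetForm, Fin.sum_univ_four, bulkCoeff, distPoly, jet, bulkIntegrand, greenDist, coeffA2,
    coeffA1, coeffA0, div_eq_mul_inv]
  ring

theorem fluxIntegrand_eq_jetForm : fluxIntegrand q₁ q₂ g₁ g₂ ψ x = jetForm fluxCoeff ψ
    (jet (g₁ x) (g₂ x) (deriv g₁ x) (deriv g₂ x) (q₁ x) (q₂ x) b₁ b₂) x := by
  simp [jetForm, Fin.sum_univ_four, fluxCoeff, jet, fluxIntegrand, div_eq_mul_inv]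
  ring

theorem forcingIntegrand_eq_jetForm (d₁ d₂ : ℝ) : forcingIntegrand g₁ g₂ f₁ f₂ ψ x
    = jetForm forcingCoeff ψ (jet (g₁ x) (g₂ x) d₁ d₂ (q₁ x) (q₂ x) (f₁ x) (f₂ x)) x := by
  simp [jetForm, Fin.sum_univ_four, forcingCoeff, jet, forcingIntegrand, div_eq_mul_inv]
  ring

theorem qDiffIntegrand_eq_jetForm (h₁ : DifferentiableAt ℝ g₁ x) (h₂ : DifferentiableAt ℝ g₂ x)
    (n₁ : g₁ x ≠ 0) (n₂ : g₂ x ≠ 0) : qDiffIntegrand κ q₁ q₂ g₁ g₂ ψ x = jetForm (qDiffCoeff κ) ψ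
    (jet (g₁ x) (g₂ x) (deriv g₁ x) (deriv g₂ x) (q₁ x) (q₂ x) b₁ b₂) x := by
  have e : deriv (fun z => 1 / g₁ z + 1 / g₂ z) x
      = -(deriv g₁ x * (g₁ x)⁻¹ ^ 2 + deriv g₂ x * (g₂ x)⁻¹ ^ 2) := by
    have := (h₁.hasDerivAt.fun_inv n₁).fun_add (h₂.hasDerivAt.fun_inv n₂)
    simp only [one_div]
    rw [this.deriv]
    simp only [div_eq_mul_inv, inv_pow]
    ring
  rw [qDiffIntegrand, e]
  simp [jetForm, Fin.sum_univ_four, qDiffCoeff, jet, div_eq_mul_inv]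
  ring

theorem jetForm_rhsCoeff {v : Fin 10 → ℝ} : jetForm (rhsCoeff κ) ψ v x
    = jetForm (bulkCoeff κ) ψ v x + 3 / 2 * jetForm fluxCoeff ψ v x
      - jetForm forcingCoeff ψ v x := by
  simp only [jetForm, rhsCoeff, Fin.sum_univ_four]
  ring

end Eval

theorem norm_jet_le {g₁ g₂ d₁ d₂ q₁ q₂ f₁ f₂ R : ℝ} (h₁ : |g₁| ≤ R) (h₂ : |g₂| ≤ R)
    (h₃ : |g₁⁻¹| ≤ R) (h₄ : |g₂⁻¹| ≤ R) (h₅ : |d₁| ≤ R) (h₆ : |d₂| ≤ R) (h₇ : |q₁| ≤ R)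
    (h₈ : |q₂| ≤ R) (h₉ : |f₁| ≤ R) (h₁₀ : |f₂| ≤ R) : ‖jet g₁ g₂ d₁ d₂ q₁ q₂ f₁ f₂‖ ≤ R := by
  rw [pi_norm_le_iff_of_nonneg ((abs_nonneg _).trans h₁)]
  rw [abs_inv] at h₃ h₄
  intro i
  fin_cases i <;> simpa [jet]

theorem tendsto_jet {ι : Type*} {l : Filter ι} {g₁ g₂ d₁ d₂ q₁ q₂ f₁ f₂ : ι → ℝ}
    {g₁' g₂' d₁' d₂' q₁' q₂' f₁' f₂' : ℝ} (h₁ : Tendsto g₁ l (𝓝 g₁')) (h₂ : Tendsto g₂ l (𝓝 g₂'))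
    (n₁ : g₁' ≠ 0) (n₂ : g₂' ≠ 0)
    (h₅ : Tendsto d₁ l (𝓝 d₁')) (h₆ : Tendsto d₂ l (𝓝 d₂')) (h₇ : Tendsto q₁ l (𝓝 q₁'))
    (h₈ : Tendsto q₂ l (𝓝 q₂')) (h₉ : Tendsto f₁ l (𝓝 f₁')) (h₁₀ : Tendsto f₂ l (𝓝 f₂')) :
    Tendsto (fun i => jet (g₁ i) (g₂ i) (d₁ i) (d₂ i) (q₁ i) (q₂ i) (f₁ i) (f₂ i)) l
      (𝓝 (jet g₁' g₂' d₁' d₂' q₁' q₂' f₁' f₂')) := by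
  have h₃ := h₁.inv₀ n₁
  have h₄ := h₂.inv₀ n₂
  rw [tendsto_pi_nhds]
  intro i
  fin_cases i <;> simpa [jet]

theorem aestronglyMeasurable_jet {α : Type*} [MeasurableSpace α] {μ : Measure α}
    {g₁ g₂ d₁ d₂ q₁ q₂ f₁ f₂ : α → ℝ} (h₁ : AEStronglyMeasurable g₁ μ)
    (h₂ : AEStronglyMeasurable g₂ μ) (h₅ : AEStronglyMeasurable d₁ μ)
    (h₆ : AEStronglyMeasurable d₂ μ) (h₇ : AEStronglyMeasurable q₁ μ)
    (h₈ : AEStronglyMeasurable q₂ μ) (h₉ : AEStronglyMeasurable f₁ μ)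
    (h₁₀ : AEStronglyMeasurable f₂ μ) : AEStronglyMeasurable
      (fun a => jet (g₁ a) (g₂ a) (d₁ a) (d₂ a) (q₁ a) (q₂ a) (f₁ a) (f₂ a)) μ := by
  have h₃ : AEStronglyMeasurable (fun a => (g₁ a)⁻¹) μ := h₁.aemeasurable.inv.aestronglyMeasurable
  have h₄ : AEStronglyMeasurable (fun a => (g₂ a)⁻¹) μ := h₂.aemeasurable.inv.aestronglyMeasurable
  refine (aemeasurable_pi_iff.2 fun i => ?_).aestronglyMeasurable
  fin_cases i <;> simp [jet] <;> exact AEStronglyMeasurable.aemeasurable (by assumption)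

end
end

section
open MeasureTheory Set Filter Topology
open scoped ContDiff SchwartzMap ENNReal

noncomputable section

/-! ### The identities at a fixed time for smooth potentials -/

section Jets
variable {κ x q₁' q₂' : ℝ} {g₁ g₂ d₁ d₂ q₁ q₂ : ℝ → ℝ}

/-- The equation for `g''` eliminates second derivatives. The derivatives of the potentials enter
the flux only through `(q₁ - q₂)(g₂/g₁ - g₁/g₂)`, where they match the terms `-2 g q'` of the
evolution. The coefficient of `ψ''` in the flux is half the distance density, which accounts for the
`ψ'''` term. -/
theorem hasDerivAt_rhsFlux (ψ : 𝓢(ℝ, ℝ)) (f₁ f₂ : ℝ → ℝ) (hg₁ : HasDerivAt g₁ (d₁ x) x)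
    (hd₁ : HasDerivAt d₁ (2 * (q₁ x + κ ^ 2) * g₁ x + (d₁ x ^ 2 - 1) / (2 * g₁ x)) x)
    (hq₁ : HasDerivAt q₁ q₁' x) (hg₂ : HasDerivAt g₂ (d₂ x) x)
    (hd₂ : HasDerivAt d₂ (2 * (q₂ x + κ ^ 2) * g₂ x + (d₂ x ^ 2 - 1) / (2 * g₂ x)) x)
    (hq₂ : HasDerivAt q₂ q₂' x) (n₁ : g₁ x ≠ 0) (n₂ : g₂ x ≠ 0) :
    HasDerivAt (fun x => jetForm (rhsFluxCoeff κ) ψ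
        (jet (g₁ x) (g₂ x) (d₁ x) (d₂ x) (q₁ x) (q₂ x) (f₁ x) (f₂ x)) x)
      (ψ x * ((g₁ x ^ 2 - g₂ x ^ 2) / (2 * g₁ x * g₂ x)
          * ((-2 * g₁ x * q₁' + 2 * q₁ x * d₁ x - 4 * κ ^ 2 * d₁ x - f₁ x) / g₁ x
            - (-2 * g₂ x * q₂' + 2 * q₂ x * d₂ x - 4 * κ ^ 2 * d₂ x - f₂ x) / g₂ x))
        - jetForm (rhsCoeff κ) ψ
          (jet (g₁ x) (g₂ x) (d₁ x) (d₂ x) (q₁ x) (q₂ x) (f₁ x) (f₂ x)) x) x := by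
  have hi₁ := hg₁.fun_inv n₁
  have hi₂ := hg₂.fun_inv n₂
  have hψ₀ := hasDerivAt_iteratedDeriv_schwartz ψ 0 x
  have hψ₁ := hasDerivAt_iteratedDeriv_schwartz ψ 1 x
  have hψ₂ := hasDerivAt_iteratedDeriv_schwartz ψ 2 x
  have e : (fun x => jetForm (rhsFluxCoeff κ) ψ
        (jet (g₁ x) (g₂ x) (d₁ x) (d₂ x) (q₁ x) (q₂ x) (f₁ x) (f₂ x)) x) = fun x =>
      (3 / 4 * (g₁ x)⁻¹ ^ 2 + 3 / 4 * (g₂ x)⁻¹ ^ 2 - 1 / 4 * (g₁ x)⁻¹ ^ 3 * g₂ x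
        - 1 / 4 * (g₂ x)⁻¹ ^ 3 * g₁ x - (g₁ x)⁻¹ * (g₂ x)⁻¹
        + 1 / 2 * ((g₁ x)⁻¹ * (g₂ x)⁻¹) * (d₁ x ^ 2 + d₂ x ^ 2)
        - 3 / 2 * ((g₁ x)⁻¹ * (g₂ x)⁻¹) * (d₁ x * d₂ x)
        + 1 / 4 * ((g₁ x)⁻¹ ^ 2 + (g₂ x)⁻¹ ^ 2) * (d₁ x * d₂ x)
        + (q₁ x - q₂ x) * (g₂ x * (g₁ x)⁻¹ - g₁ x * (g₂ x)⁻¹)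
        - 3 * κ ^ 2 * (g₁ x * (g₂ x)⁻¹ + g₂ x * (g₁ x)⁻¹) + 6 * κ ^ 2) * iteratedDeriv 0 ψ x
      + (d₁ x * (15 / 4 * (g₁ x)⁻¹ - 13 / 4 * (g₂ x)⁻¹ + 3 / 4 * g₁ x * (g₂ x)⁻¹ ^ 2
          - 5 / 4 * (g₁ x)⁻¹ ^ 2 * g₂ x)
        + d₂ x * (15 / 4 * (g₂ x)⁻¹ - 13 / 4 * (g₁ x)⁻¹ + 3 / 4 * g₂ x * (g₁ x)⁻¹ ^ 2
          - 5 / 4 * (g₂ x)⁻¹ ^ 2 * g₁ x)) * iteratedDeriv 1 ψ x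
      + (1 / 4 * (g₁ x * (g₂ x)⁻¹ + g₂ x * (g₁ x)⁻¹) - 1 / 2) * iteratedDeriv 2 ψ x := by
    funext x
    simp [jetForm, Fin.sum_univ_four, rhsFluxCoeff, jet]
  have e₀ : ψ x = iteratedDeriv 0 ψ x := by rw [iteratedDeriv_zero]
  rw [e, e₀]
  apply HasDerivAt.congr_deriv
  · repeat' first
      | exact hg₁ | exact hg₂ | exact hd₁ | exact hd₂ | exact hq₁ | exact hq₂
      | exact hi₁ | exact hi₂ | exact hψ₀ | exact hψ₁ | exact hψ₂ | exact hasDerivAt_const _ _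
      | with_reducible apply HasDerivAt.fun_add | with_reducible apply HasDerivAt.fun_sub
      | with_reducible apply HasDerivAt.fun_mul | with_reducible apply HasDerivAt.fun_pow
  simp only [jetForm, Fin.sum_univ_four, rhsCoeff, bulkCoeff, fluxCoeff, forcingCoeff, distPoly, jet]
  simp only [Fin.isValue, Fin.coe_ofNat_eq_mod, Matrix.cons_val, Nat.reduceMod]
  simp only [zero_add, Nat.reduceAdd]
  -- With the values at `x` as free variables, a rational identity with denominators in `g₁`, `g₂`
  -- remains.
  generalize iteratedDeriv 0 ψ x = p0
  generalize iteratedDeriv 1 ψ x = p1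
  generalize iteratedDeriv 2 ψ x = p2
  generalize iteratedDeriv 3 ψ x = p3
  generalize g₁ x = a at *
  generalize g₂ x = b at *
  generalize d₁ x = c at *
  generalize d₂ x = d at *
  simp only [Nat.cast_ofNat, Nat.reduceSub, pow_one]
  field_simp
  ring

/-- Inserting the equation for `g''` into the derivative of the flux produces the potential terms `4
(q₁ - q₂) + (q₁ + q₂)(g₁/g₂ - g₂/g₁)`; the second summand belongs to the right side of the identity,
and the first is the quantity to be expressed. -/
theorem hasDerivAt_qDiffFlux (ψ : 𝓢(ℝ, ℝ)) (f₁ f₂ : ℝ → ℝ) (hg₁ : HasDerivAt g₁ (d₁ x) x)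
    (hd₁ : HasDerivAt d₁ (2 * (q₁ x + κ ^ 2) * g₁ x + (d₁ x ^ 2 - 1) / (2 * g₁ x)) x)
    (hg₂ : HasDerivAt g₂ (d₂ x) x)
    (hd₂ : HasDerivAt d₂ (2 * (q₂ x + κ ^ 2) * g₂ x + (d₂ x ^ 2 - 1) / (2 * g₂ x)) x)
    (n₁ : g₁ x ≠ 0) (n₂ : g₂ x ≠ 0) :
    HasDerivAt (fun x => jetForm qDiffFluxCoeff ψ
        (jet (g₁ x) (g₂ x) (d₁ x) (d₂ x) (q₁ x) (q₂ x) (f₁ x) (f₂ x)) x)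
      (4 * jetForm diffCoeff ψ (jet (g₁ x) (g₂ x) (d₁ x) (d₂ x) (q₁ x) (q₂ x) (f₁ x) (f₂ x)) x
        - jetForm (qDiffCoeff κ) ψ
          (jet (g₁ x) (g₂ x) (d₁ x) (d₂ x) (q₁ x) (q₂ x) (f₁ x) (f₂ x)) x) x := by
  have hi₁ := hg₁.fun_inv n₁
  have hi₂ := hg₂.fun_inv n₂
  have hψ₀ := hasDerivAt_iteratedDeriv_schwartz ψ 0 x
  have hψ₁ := hasDerivAt_iteratedDeriv_schwartz ψ 1 x
  have e : (fun x => jetForm qDiffFluxCoeff ψ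
        (jet (g₁ x) (g₂ x) (d₁ x) (d₂ x) (q₁ x) (q₂ x) (f₁ x) (f₂ x)) x) = fun x =>
      (d₁ x * (2 * (g₁ x)⁻¹ + 1 / 2 * (g₂ x)⁻¹ - 1 / 2 * (g₁ x)⁻¹ ^ 2 * g₂ x)
        - d₂ x * (2 * (g₂ x)⁻¹ + 1 / 2 * (g₁ x)⁻¹ - 1 / 2 * (g₂ x)⁻¹ ^ 2 * g₁ x))
          * iteratedDeriv 0 ψ x
      + (g₂ x * (g₁ x)⁻¹ - g₁ x * (g₂ x)⁻¹) * iteratedDeriv 1 ψ x := by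
    funext x
    simp [jetForm, Fin.sum_univ_four, qDiffFluxCoeff, jet]
  rw [e]
  apply HasDerivAt.congr_deriv
  · repeat' first
      | exact hg₁ | exact hg₂ | exact hd₁ | exact hd₂
      | exact hi₁ | exact hi₂ | exact hψ₀ | exact hψ₁ | exact hasDerivAt_const _ _
      | with_reducible apply HasDerivAt.fun_add | with_reducible apply HasDerivAt.fun_sub
      | with_reducible apply HasDerivAt.fun_mul | with_reducible apply HasDerivAt.fun_pow
  simp only [jetForm, Fin.sum_univ_four, qDiffCoeff, diffCoeff, jet]
  simp only [Fin.isValue, Fin.coe_ofNat_eq_mod, Matrix.cons_val, Nat.reduceMod]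
  simp only [zero_add, Nat.reduceAdd]
  generalize iteratedDeriv 0 ψ x = p0
  generalize iteratedDeriv 1 ψ x = p1
  generalize iteratedDeriv 2 ψ x = p2
  generalize iteratedDeriv 3 ψ x = p3
  generalize g₁ x = a at *
  generalize g₂ x = b at *
  generalize d₁ x = c at *
  generalize d₂ x = d at *
  simp only [Nat.cast_ofNat, Nat.reduceSub, pow_one]
  field_simp
  ring

end Jets

/-- The jet of the diagonal Green's functions of a pair of potentials. -/
def potJet (κ : ℝ) (p q f₁ f₂ : ℝ → ℝ) (x : ℝ) : Fin 10 → ℝ :=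
  jet (diagGreen κ p x) (diagGreen κ q x) (greenSlope κ p x) (greenSlope κ q x) (p x) (q x)
    (f₁ x) (f₂ x)

/-- A bound for the jets of admissible potentials. -/
def jetBound (κ C : ℝ) : ℝ := 2 / (3 * κ) + 3 * κ + 1 / 3 + κ ^ 2 / 4 + |C|

section PotJet
variable {κ C : ℝ} {p q f₁ f₂ : ℝ → ℝ}

theorem norm_potJet_le (hκ : 0 < κ) (hp : Adm κ p) (hq : Adm κ q) {x : ℝ}
    (hpx : |p x| ≤ κ ^ 2 / 4) (hqx : |q x| ≤ κ ^ 2 / 4) (h₁ : |f₁ x| ≤ C) (h₂ : |f₂ x| ≤ C) :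
    ‖potJet κ p q f₁ f₂ x‖ ≤ jetBound κ C := by
  have e₁ : 0 < 2 / (3 * κ) := by positivity
  have e₂ : 0 < κ ^ 2 := by positivity
  have e₃ := abs_nonneg C
  have e₄ := le_abs_self C
  have hinv : ∀ {r}, Adm κ r → |(diagGreen κ r x)⁻¹| ≤ jetBound κ C := by
    intro r hr
    have h := diagGreen_ge hκ hr x
    rw [abs_of_pos (inv_pos.2 (diagGreen_pos hκ hr x))]
    have : (diagGreen κ r x)⁻¹ ≤ 3 * κ := by
      rw [inv_le_comm₀ (diagGreen_pos hκ hr x) (by positivity)]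
      simpa using h
    unfold jetBound
    linarith
  have hg : ∀ {r}, Adm κ r → |diagGreen κ r x| ≤ jetBound κ C := by
    intro r hr
    rw [abs_of_pos (diagGreen_pos hκ hr x)]
    have := diagGreen_le hκ hr x
    unfold jetBound
    linarith
  have hs : ∀ {r}, Adm κ r → |greenSlope κ r x| ≤ jetBound κ C := by
    intro r hr
    have := abs_greenSlope_le hκ hr x
    unfold jetBound
    linarith
  apply norm_jet_le (hg hp) (hg hq) (hinv hp) (hinv hq) (hs hp) (hs hq) <;> unfold jetBound <;>
    linarith

theorem Adm.ae_norm_potJet_le (hp : Adm κ p) (hκ : 0 < κ) (hq : Adm κ q) (h₁ : ∀ x, |f₁ x| ≤ C)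
    (h₂ : ∀ x, |f₂ x| ≤ C) : ∀ᵐ x, ‖potJet κ p q f₁ f₂ x‖ ≤ jetBound κ C := by
  filter_upwards [hp.bound, hq.bound] with x hx hy
    using norm_potJet_le hκ hp hq hx hy (h₁ x) (h₂ x)

theorem continuous_diagGreen (hκ : 0 < κ) (hq : Adm κ q) : Continuous (diagGreen κ q) := by
  have e : diagGreen κ q = fun x => 1 / (2 * κ) - res κ (fun z => q z * green κ q z x) x := by
    funext x
    rw [diagGreen, green_eq hκ hq]
    simp [freeGreen]
  rw [e]
  refine continuous_const.sub (continuous_iff_continuousAt.2 fun x => ?_)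
  refine continuousAt_of_dominated
    (bound := fun z => 1 / (2 * κ) * (Real.exp κ * Real.exp (-κ * |x - z|)) * (κ / 6))
    (Eventually.of_forall fun y => ((integrable_freeGreen hκ y).aestronglyMeasurable.mul
      (aestronglyMeasurable_mul_green hκ hq y))) ?_
    ((((integrable_exp_neg_mul_abs_sub hκ x).const_mul _).const_mul _).mul_const _) ?_
  · filter_upwards [Metric.closedBall_mem_nhds x one_pos] with y hy
    rw [Metric.mem_closedBall, Real.dist_eq] at hy
    filter_upwards [abs_mul_green_le hκ hq y] with z hz
    rw [norm_mul, Real.norm_eq_abs, abs_of_pos (freeGreen_pos hκ y z), freeGreen]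
    have := exp_neg_mul_abs_sub_le hκ.le (z := z) hy
    exact mul_le_mul (mul_le_mul_of_nonneg_left this (by positivity)) hz (norm_nonneg _)
      (by positivity)
  · refine Eventually.of_forall fun z => ?_
    have : Continuous fun y => freeGreen κ y z := by
      unfold freeGreen
      fun_prop
    exact this.continuousAt.mul
      (continuousAt_const.mul (continuous_green_right hκ hq z).continuousAt)

theorem aestronglyMeasurable_potJet (hκ : 0 < κ) (hp : Adm κ p) (hq : Adm κ q)
    (h₁ : AEStronglyMeasurable f₁ volume) (h₂ : AEStronglyMeasurable f₂ volume) :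
    AEStronglyMeasurable (potJet κ p q f₁ f₂) volume :=
  aestronglyMeasurable_jet (continuous_diagGreen hκ hp).aestronglyMeasurable
    (continuous_diagGreen hκ hq).aestronglyMeasurable
    (continuous_greenSlope hκ hp).aestronglyMeasurable
    (continuous_greenSlope hκ hq).aestronglyMeasurable hp.meas hq.meas h₁ h₂

theorem integrable_jetForm_potJet {c : Fin 4 → (Fin 10 → ℝ) → ℝ} (hκ : 0 < κ) (ψ : 𝓢(ℝ, ℝ))
    (hc : ∀ k, Continuous (c k)) (hp : Adm κ p) (hq : Adm κ q)
    (h₁ : AEStronglyMeasurable f₁ volume) (h₂ : AEStronglyMeasurable f₂ volume)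
    (b₁ : ∀ x, |f₁ x| ≤ C) (b₂ : ∀ x, |f₂ x| ≤ C) :
    Integrable (fun x => jetForm c ψ (potJet κ p q f₁ f₂ x) x) :=
  integrable_jetForm ψ hc (aestronglyMeasurable_potJet hκ hp hq h₁ h₂)
    (hp.ae_norm_potJet_le hκ hq b₁ b₂)

theorem tendsto_potJet (hκ : 0 < κ) {ι : Type*} {l : Filter ι} [l.IsCountablyGenerated]
    {p' q' f₁' f₂' : ι → ℝ → ℝ} (hp' : ∀ i, Adm κ (p' i)) (hq' : ∀ i, Adm κ (q' i))
    (hp : Adm κ p) (hq : Adm κ q) (wp : WeakTendsto l p' p) (wq : WeakTendsto l q' q) {x : ℝ}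
    (hpx : Tendsto (fun i => p' i x) l (𝓝 (p x))) (hqx : Tendsto (fun i => q' i x) l (𝓝 (q x)))
    (h₁ : Tendsto (fun i => f₁' i x) l (𝓝 (f₁ x))) (h₂ : Tendsto (fun i => f₂' i x) l (𝓝 (f₂ x))) :
    Tendsto (fun i => potJet κ (p' i) (q' i) (f₁' i) (f₂' i) x) l
      (𝓝 (potJet κ p q f₁ f₂ x)) :=
  tendsto_jet (wp.tendsto_diagGreen hκ hp' hp x) (wq.tendsto_diagGreen hκ hq' hq x)
    (diagGreen_pos hκ hp x).ne' (diagGreen_pos hκ hq x).ne' (wp.tendsto_greenSlope hκ hp' hp x)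
    (wq.tendsto_greenSlope hκ hq' hq x) hpx hqx h₁ h₂

/-- The second identity for continuous potentials. -/
theorem integral_qDiff_of_continuous (hκ : 0 < κ) (ψ : 𝓢(ℝ, ℝ)) (hp : Adm κ p) (hq : Adm κ q)
    (hpc : Continuous p) (hqc : Continuous q) :
    4 * ∫ x, jetForm diffCoeff ψ (potJet κ p q 0 0 x) x
      = ∫ x, jetForm (qDiffCoeff κ) ψ (potJet κ p q 0 0 x) x := by
  have hR : ∀ x, ‖potJet κ p q 0 0 x‖ ≤ jetBound κ 0 := fun x =>
    norm_potJet_le hκ hp hq (hp.abs_le hpc x) (hq.abs_le hqc x) (by simp) (by simp)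
  have h0 : AEStronglyMeasurable (0 : ℝ → ℝ) volume := aestronglyMeasurable_zero
  have i₁ := integrable_jetForm_potJet (C := 0) hκ ψ continuous_diffCoeff hp hq h0 h0 (by simp)
    (by simp)
  have i₂ := integrable_jetForm_potJet (C := 0) hκ ψ (continuous_qDiffCoeff κ) hp hq h0 h0
    (by simp) (by simp)
  have lim := tendsto_jetForm_cocompact ψ continuous_qDiffFluxCoeff hR
  have := integral_of_hasDerivAt_of_tendsto (fun x => ?_) ((i₁.const_mul 4).sub i₂)
    (lim.mono_left atBot_le_cocompact) (lim.mono_left atTop_le_cocompact)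
  · simp only [Pi.sub_apply] at this
    rw [integral_sub (i₁.const_mul 4) i₂, integral_const_mul] at this
    linarith
  · obtain ⟨a₁, a₂⟩ := hasDerivAt_diagGreen_and_greenSlope hκ hp hpc x
    obtain ⟨b₁, b₂⟩ := hasDerivAt_diagGreen_and_greenSlope hκ hq hqc x
    exact hasDerivAt_qDiffFlux ψ 0 0 a₁ a₂ b₁ b₂ (diagGreen_pos hκ hp x).ne'
      (diagGreen_pos hκ hq x).ne'

/-- The weighted distance of the diagonal Green's functions, differentiated along the flow. -/
def distRate (κ : ℝ) (p q p' q' f₁ f₂ : ℝ → ℝ) (x : ℝ) : ℝ :=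
  (diagGreen κ p x ^ 2 - diagGreen κ q x ^ 2) / (2 * diagGreen κ p x * diagGreen κ q x)
    * ((-2 * diagGreen κ p x * p' x + 2 * p x * greenSlope κ p x - 4 * κ ^ 2 * greenSlope κ p x
        - f₁ x) / diagGreen κ p x
      - (-2 * diagGreen κ q x * q' x + 2 * q x * greenSlope κ q x - 4 * κ ^ 2 * greenSlope κ q x
        - f₂ x) / diagGreen κ q x)

/-- The first identity in differential form for differentiable potentials. -/
theorem integral_distRate (hκ : 0 < κ) (ψ : 𝓢(ℝ, ℝ)) (hp : Adm κ p) (hq : Adm κ q)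
    {p' q' : ℝ → ℝ} (hpd : ∀ x, HasDerivAt p (p' x) x) (hqd : ∀ x, HasDerivAt q (q' x) x)
    (h₁ : AEStronglyMeasurable f₁ volume) (h₂ : AEStronglyMeasurable f₂ volume)
    (b₁ : ∀ x, |f₁ x| ≤ C) (b₂ : ∀ x, |f₂ x| ≤ C)
    (hi : Integrable (fun x => ψ x * distRate κ p q p' q' f₁ f₂ x)) :
    ∫ x, ψ x * distRate κ p q p' q' f₁ f₂ x
      = ∫ x, jetForm (rhsCoeff κ) ψ (potJet κ p q f₁ f₂ x) x := by
  have hpc : Continuous p := continuous_iff_continuousAt.2 fun x => (hpd x).continuousAt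
  have hqc : Continuous q := continuous_iff_continuousAt.2 fun x => (hqd x).continuousAt
  have hR : ∀ x, ‖potJet κ p q f₁ f₂ x‖ ≤ jetBound κ C := fun x =>
    norm_potJet_le hκ hp hq (hp.abs_le hpc x) (hq.abs_le hqc x) (b₁ x) (b₂ x)
  have i₂ := integrable_jetForm_potJet hκ ψ (continuous_rhsCoeff κ) hp hq h₁ h₂ b₁ b₂
  have lim := tendsto_jetForm_cocompact ψ (continuous_rhsFluxCoeff κ) hR
  have := integral_of_hasDerivAt_of_tendsto (fun x => ?_) (hi.sub i₂)
    (lim.mono_left atBot_le_cocompact) (lim.mono_left atTop_le_cocompact)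
  · simp only [Pi.sub_apply] at this
    rw [integral_sub hi i₂] at this
    linarith
  · obtain ⟨a₁, a₂⟩ := hasDerivAt_diagGreen_and_greenSlope hκ hp hpc x
    obtain ⟨b₁, b₂⟩ := hasDerivAt_diagGreen_and_greenSlope hκ hq hqc x
    exact hasDerivAt_rhsFlux ψ f₁ f₂ a₁ a₂ (hpd x) b₁ b₂ (hqd x) (diagGreen_pos hκ hp x).ne'
      (diagGreen_pos hκ hq x).ne'

end PotJet
end
end

section
open MeasureTheory Set Filter Topology
open scoped ContDiff SchwartzMap ENNReal

noncomputable section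

/-! ### Mollification -/

section Mollify
set_option linter.unusedSectionVars false
variable {E : Type*} [NormedAddCommGroup E] [MeasureSpace E]

/-- The mollification of `Q` by `φ`. -/
def mollify (φ Q : E → ℝ) (x : E) : ℝ := ∫ w, Q w * φ (x - w)

variable [NormedSpace ℝ E]

/-- The derivative of `φ` in the direction `v`. -/
def dirDeriv (v : E) (φ : E → ℝ) (x : E) : ℝ := fderiv ℝ φ x v

/-- Smooth compactly supported functions. -/
structure TestFun (φ : E → ℝ) : Prop where
  smooth : ContDiff ℝ ∞ φ
  supp : HasCompactSupport φ

theorem TestFun.dirDeriv {φ : E → ℝ} (h : TestFun φ) (v : E) : TestFun (dirDeriv v φ) :=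
  ⟨(h.smooth.fderiv_right (m := ∞) (by simp)).clm_apply contDiff_const, h.supp.fderiv_apply ℝ v⟩

variable [FiniteDimensional ℝ E] [BorelSpace E] [(volume : Measure E).IsAddHaarMeasure]
  {φ Q : E → ℝ} {M : ℝ}

theorem TestFun.integrable (h : TestFun φ) : Integrable φ :=
  h.smooth.continuous.integrable_of_hasCompactSupport h.supp

theorem TestFun.integrable_mul (h : TestFun φ) (hQ : AEStronglyMeasurable Q volume)
    (hM : ∀ᵐ w, |Q w| ≤ M) (x : E) : Integrable (fun w => Q w * φ (x - w)) :=
  (h.integrable.comp_sub_left x).bdd_mul hQ hM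

theorem locallyIntegrable_of_ae_bdd (hQ : AEStronglyMeasurable Q volume)
    (hM : ∀ᵐ w, |Q w| ≤ M) : LocallyIntegrable Q := by
  have h : LocallyIntegrable (fun _ : E => M) := locallyIntegrable_const M
  refine h.mono hQ ?_
  filter_upwards [hM] with w hw using hw.trans (le_abs_self M)

theorem hasFDerivAt_mollify (h : TestFun φ) (hQ : AEStronglyMeasurable Q volume)
    (hM : ∀ᵐ w, |Q w| ≤ M) (x : E) :
    ∃ D : E →L[ℝ] ℝ, HasFDerivAt (mollify φ Q) D x ∧ ∀ v, D v = mollify (dirDeriv v φ) Q x := by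
  have hl := locallyIntegrable_of_ae_bdd hQ hM
  refine ⟨_, h.supp.hasFDerivAt_convolution_right (ContinuousLinearMap.mul ℝ ℝ) hl
    (h.smooth.of_le (by simp)) x, fun v => ?_⟩
  rw [convolution_precompR_apply _ hl (h.supp.fderiv ℝ)
    (h.smooth.continuous_fderiv (by simp))]
  rfl

theorem continuous_mollify (h : TestFun φ) (hQ : AEStronglyMeasurable Q volume)
    (hM : ∀ᵐ w, |Q w| ≤ M) : Continuous (mollify φ Q) :=
  continuous_iff_continuousAt.2 fun x =>
    (hasFDerivAt_mollify h hQ hM x).elim fun _ hD => hD.1.continuousAt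

theorem hasDerivAt_mollify (h : TestFun φ) (hQ : AEStronglyMeasurable Q volume)
    (hM : ∀ᵐ w, |Q w| ≤ M) {γ : ℝ → E} {v : E} {s : ℝ} (hγ : HasDerivAt γ v s) :
    HasDerivAt (fun s => mollify φ Q (γ s)) (mollify (dirDeriv v φ) Q (γ s)) s := by
  obtain ⟨D, hD, hv⟩ := hasFDerivAt_mollify h hQ hM (γ s)
  rw [← hv]
  exact hD.comp_hasDerivAt s hγ

theorem abs_mollify_le (h : TestFun φ) (hM : ∀ᵐ w, |Q w| ≤ M) (x : E) :
    |mollify φ Q x| ≤ M * ∫ w, |φ w| := by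
  have h1 : ‖∫ w, Q w * φ (x - w)‖ ≤ ∫ w, M * |φ (x - w)| := by
    refine norm_integral_le_of_norm_le ((h.integrable.comp_sub_left x).abs.const_mul M) ?_
    filter_upwards [hM] with w hw
    rw [norm_mul]
    exact mul_le_mul_of_nonneg_right hw (abs_nonneg _)
  rwa [integral_const_mul, integral_sub_left_eq_self (fun w => |φ w|) volume x] at h1

variable (E) in
/-- A sequence of bump functions with supports shrinking to the origin. -/
def bump (n : ℕ) : ContDiffBump (0 : E) where
  rIn := 1 / (2 * (n + 1))
  rOut := 1 / (n + 1)
  rIn_pos := by positivity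
  rIn_lt_rOut := by
    apply one_div_lt_one_div_of_lt <;> linarith [n.cast_nonneg (α := ℝ)]

variable (E) in
/-- A standard sequence of mollifiers. -/
def mollifier (n : ℕ) : E → ℝ := (bump E n).normed volume

theorem testFun_mollifier (n : ℕ) : TestFun (mollifier E n) :=
  ⟨(bump E n).contDiff_normed, (bump E n).hasCompactSupport_normed⟩

theorem integral_abs_mollifier (n : ℕ) : ∫ w, |mollifier E n w| = 1 := by
  simp only [mollifier, abs_of_nonneg ((bump E n).nonneg_normed _)]
  exact (bump E n).integral_normed

theorem abs_mollify_mollifier_le (hM : ∀ᵐ w, |Q w| ≤ M) (n : ℕ) (x : E) :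
    |mollify (mollifier E n) Q x| ≤ M := by
  simpa [integral_abs_mollifier] using abs_mollify_le (testFun_mollifier n) hM x

theorem tsupport_mollifier (n : ℕ) :
    tsupport (mollifier E n) = Metric.closedBall 0 (1 / ((n : ℝ) + 1)) :=
  (bump E n).tsupport_normed_eq

theorem ae_tendsto_mollify (hQ : AEStronglyMeasurable Q volume) (hM : ∀ᵐ w, |Q w| ≤ M) :
    ∀ᵐ x, Tendsto (fun n => mollify (mollifier E n) Q x) atTop (𝓝 (Q x)) := by
  -- `K = 2` is the fixed ratio of outer to inner radius of the bumps, as almost everywhere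
  -- convergence requires.
  have := ContDiffBump.ae_convolution_tendsto_right_of_locallyIntegrable (φ := bump E) (l := atTop)
    (K := 2) tendsto_one_div_add_atTop_nhds_zero_nat (Eventually.of_forall fun n => ?_)
    (locallyIntegrable_of_ae_bdd hQ hM)
  · filter_upwards [this] with x hx
    refine hx.congr fun n => ?_
    rw [convolution_eq_swap]
    exact integral_congr_ae (Eventually.of_forall fun w => mul_comm _ _)
  · simp only [bump]
    field_simp
    norm_num

end Mollify

/-! ### Passage from continuous to bounded potentials -/

section Reg
variable {κ : ℝ} {q : ℝ → ℝ}

theorem Adm.mollify (hq : Adm κ q) (n : ℕ) : Adm κ (mollify (mollifier ℝ n) q) :=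
  ⟨(continuous_mollify (testFun_mollifier n) hq.meas hq.bound).aestronglyMeasurable,
    Eventually.of_forall (abs_mollify_mollifier_le hq.bound n)⟩

theorem hasDerivAt_diagGreen (hκ : 0 < κ) (hq : Adm κ q) (x : ℝ) :
    HasDerivAt (diagGreen κ q) (greenSlope κ q x) x :=
  hasDerivAt_diagGreen_of_ae_tendsto hκ hq hq.mollify
    (fun n => continuous_mollify (testFun_mollifier n) hq.meas hq.bound)
    (ae_tendsto_mollify hq.meas hq.bound) x

theorem deriv_diagGreen (hκ : 0 < κ) (hq : Adm κ q) : deriv (diagGreen κ q) = greenSlope κ q :=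
  funext fun x => (hasDerivAt_diagGreen hκ hq x).deriv

/-- The second identity. -/
theorem integral_qDiff {p : ℝ → ℝ} (hκ : 0 < κ) (ψ : 𝓢(ℝ, ℝ)) (hp : Adm κ p) (hq : Adm κ q) :
    4 * ∫ x, jetForm diffCoeff ψ (potJet κ p q 0 0 x) x
      = ∫ x, jetForm (qDiffCoeff κ) ψ (potJet κ p q 0 0 x) x := by
  have cp := ae_tendsto_mollify hp.meas hp.bound
  have cq := ae_tendsto_mollify hq.meas hq.bound
  have h0 : AEStronglyMeasurable (0 : ℝ → ℝ) volume := aestronglyMeasurable_zero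
  have hm : ∀ n, AEStronglyMeasurable (potJet κ (_root_.mollify (mollifier ℝ n) p)
      (_root_.mollify (mollifier ℝ n) q) 0 0) volume := fun n =>
    aestronglyMeasurable_potJet hκ (hp.mollify n) (hq.mollify n) h0 h0
  have hR : ∀ n, ∀ᵐ x, ‖potJet κ (_root_.mollify (mollifier ℝ n) p)
      (_root_.mollify (mollifier ℝ n) q) 0 0 x‖ ≤ jetBound κ 0 := fun n =>
    (hp.mollify n).ae_norm_potJet_le hκ (hq.mollify n) (by simp) (by simp)
  have hl : ∀ᵐ x, Tendsto (fun n => potJet κ (_root_.mollify (mollifier ℝ n) p)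
      (_root_.mollify (mollifier ℝ n) q) 0 0 x) atTop (𝓝 (potJet κ p q 0 0 x)) := by
    filter_upwards [cp, cq] with x h₁ h₂
    exact tendsto_potJet (f₁' := 0) (f₂' := 0) hκ hp.mollify hq.mollify hp hq
      (weakTendsto_of_ae_tendsto hp.mollify cp) (weakTendsto_of_ae_tendsto hq.mollify cq) h₁ h₂
      tendsto_const_nhds tendsto_const_nhds
  refine tendsto_nhds_unique
    ((tendsto_integral_jetForm ψ continuous_diffCoeff hm hR hl).const_mul 4)
    ((tendsto_integral_jetForm ψ (continuous_qDiffCoeff κ) hm hR hl).congr fun n => ?_)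
  exact (integral_qDiff_of_continuous hκ ψ (hp.mollify n) (hq.mollify n)
    (continuous_mollify (testFun_mollifier n) hp.meas hp.bound)
    (continuous_mollify (testFun_mollifier n) hq.meas hq.bound)).symm

end Reg
end
end

section
open MeasureTheory Set Filter Topology
open scoped ContDiff SchwartzMap ENNReal

noncomputable section

/-! ### Mollified solutions of the forced KdV equation -/

/-- The spacetime slab. -/
def slab (T : ℝ) : Set (ℝ × ℝ) := Ioo (-T) T ×ˢ univ

theorem measurableSet_slab (T : ℝ) : MeasurableSet (slab T) := measurableSet_Ioo.prod .univ

/-- Extension by zero from the slab. -/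
def cutoff (T : ℝ) (u : ℝ → ℝ → ℝ) : ℝ × ℝ → ℝ := (slab T).indicator fun p => u p.1 p.2

theorem dirDeriv_fst {φ : ℝ × ℝ → ℝ} (h : TestFun φ) (p : ℝ × ℝ) :
    HasDerivAt (fun t => φ (t, p.2)) (dirDeriv (1, 0) φ p) p.1 :=
  (h.smooth.differentiable (by simp) p).hasFDerivAt.comp_hasDerivAt p.1
    ((hasDerivAt_id p.1).prodMk (hasDerivAt_const p.1 p.2))

theorem dirDeriv_snd {φ : ℝ × ℝ → ℝ} (h : TestFun φ) (p : ℝ × ℝ) :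
    HasDerivAt (fun x => φ (p.1, x)) (dirDeriv (0, 1) φ p) p.2 :=
  (h.smooth.differentiable (by simp) p).hasFDerivAt.comp_hasDerivAt p.2
    ((hasDerivAt_const p.2 p.1).prodMk (hasDerivAt_id p.2))

theorem iteratedDeriv_three_snd {φ : ℝ × ℝ → ℝ} (h : TestFun φ) (p : ℝ × ℝ) :
    iteratedDeriv 3 (fun x => φ (p.1, x)) p.2
      = dirDeriv (0, 1) (dirDeriv (0, 1) (dirDeriv (0, 1) φ)) p := by
  have e : ∀ {χ : ℝ × ℝ → ℝ}, TestFun χ →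
      deriv (fun x => χ (p.1, x)) = fun x => dirDeriv (0, 1) χ (p.1, x) := fun hχ =>
    funext fun x => (dirDeriv_snd hχ (p.1, x)).deriv
  rw [iteratedDeriv_succ', iteratedDeriv_succ', iteratedDeriv_one, e h, e (h.dirDeriv _),
    e ((h.dirDeriv _).dirDeriv _)]

theorem TestFun.reflect {φ : ℝ × ℝ → ℝ} (h : TestFun φ) (p : ℝ × ℝ) :
    TestFun (fun w => φ (p - w)) :=
  ⟨h.smooth.comp (contDiff_const.sub contDiff_id),
    h.supp.comp_homeomorph (Homeomorph.subLeft p)⟩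

theorem dirDeriv_reflect {φ : ℝ × ℝ → ℝ} (h : TestFun φ) (p v : ℝ × ℝ) :
    dirDeriv v (fun w => φ (p - w)) = fun w => -dirDeriv v φ (p - w) := by
  funext w
  have h1 := (h.smooth.differentiable (by simp) (p - w)).hasFDerivAt.comp w
    ((hasFDerivAt_id w).const_sub p)
  simp only [dirDeriv]
  erw [h1.fderiv]
  simp

theorem dirDeriv_neg (φ : ℝ × ℝ → ℝ) (v : ℝ × ℝ) :
    dirDeriv v (fun w => -φ w) = fun w => -dirDeriv v φ w := by
  funext w
  simp [dirDeriv, fderiv_fun_neg]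

/-- A distributional solution of the forced KdV equation on the slab, together with the bounds
`κ ^ 2 / 4` for the solution and `C` for the forcing term. -/
structure SlabSolution (T κ C : ℝ) (F q : ℝ → ℝ → ℝ) : Prop where
  sol : IsForcedKdVSolution (Ioo (-T) T) F q
  meas : AEStronglyMeasurable (cutoff T q) volume
  bound : ∀ᵐ w, |cutoff T q w| ≤ κ ^ 2 / 4
  measF : AEStronglyMeasurable (cutoff T F) volume
  boundF : ∀ w, |cutoff T F w| ≤ C
  contF : ContinuousOn (fun p : ℝ × ℝ => F p.1 p.2) (slab T)
  boundF' : ∀ t ∈ Ioo (-T) T, ∀ x, |F t x| ≤ C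
  pos : 0 < T

theorem exists_slabSolution {T κ : ℝ} (hT : 0 < T) {F q : ℝ → ℝ → ℝ}
    (hF : ContDiffOn ℝ ∞ (fun p : ℝ × ℝ => F p.1 p.2) (Ioo (-T) T ×ˢ univ))
    (hFb : ∃ C : ℝ, ∀ t ∈ Ioo (-T) T, ∀ x, |F t x| ≤ C)
    (hq : IsForcedKdVSolution (Ioo (-T) T) F q)
    (hκq : 4 * spacetimeSupNorm (Ioo (-T) T) q ≤ κ ^ 2) : ∃ C, SlabSolution T κ C F q := by
  obtain ⟨C, hC⟩ := hFb
  have hC0 : 0 ≤ C := (abs_nonneg _).trans (hC 0 ⟨by linarith, hT⟩ 0)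
  refine ⟨C, hq, ?_, ?_, ?_, fun w => ?_, hF.continuousOn, hC, hT⟩
  · exact (aestronglyMeasurable_indicator_iff (measurableSet_slab T)).2
      hq.memLp_spacetime.aestronglyMeasurable
  · have h1 : ∀ᵐ p ∂(volume.restrict (slab T)), |q p.1 p.2| ≤ κ ^ 2 / 4 := by
      have h2 := ae_le_eLpNormEssSup (f := fun p : ℝ × ℝ => q p.1 p.2)
        (μ := volume.restrict (slab T))
      have h3 := hq.memLp_spacetime.eLpNorm_ne_top
      filter_upwards [h2] with p hp
      rw [spacetimeSupNorm] at hκq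
      rw [← eLpNorm_exponent_top] at hp
      have := ENNReal.toReal_mono h3 hp
      rw [toReal_enorm, Real.norm_eq_abs] at this
      change _ ≤ (eLpNorm _ ∞ (volume.restrict (Ioo (-T) T ×ˢ univ))).toReal at this
      linarith
    rw [ae_restrict_iff' (measurableSet_slab T)] at h1
    filter_upwards [h1] with w hw
    by_cases hs : w ∈ slab T
    · rw [cutoff, indicator_of_mem hs]
      exact hw hs
    · rw [cutoff, indicator_of_notMem hs, abs_zero]
      positivity
  · exact (aestronglyMeasurable_indicator_iff (measurableSet_slab T)).2
      (hF.continuousOn.aestronglyMeasurable (measurableSet_slab T))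
  · by_cases hs : w ∈ slab T
    · rw [cutoff, indicator_of_mem hs]
      exact hC _ hs.1 _
    · rw [cutoff, indicator_of_notMem hs, abs_zero]
      exact hC0

namespace SlabSolution
variable {T κ C : ℝ} {F q : ℝ → ℝ → ℝ} {φ : ℝ × ℝ → ℝ}

theorem sq_bound (h : SlabSolution T κ C F q) :
    ∀ᵐ w, |cutoff T q w ^ 2| ≤ (κ ^ 2 / 4) ^ 2 := by
  filter_upwards [h.bound] with w hw
  rw [abs_pow]
  exact pow_le_pow_left₀ (abs_nonneg _) hw 2

theorem sq_meas (h : SlabSolution T κ C F q) :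
    AEStronglyMeasurable (fun w => cutoff T q w ^ 2) volume := h.meas.pow 2

/-- The equation satisfied by mollifications. -/
theorem mollify_eq (h : SlabSolution T κ C F q) (hφ : TestFun φ) {p : ℝ × ℝ}
    (hp : tsupport (fun w => φ (p - w)) ⊆ slab T) :
    mollify (dirDeriv (1, 0) φ) (cutoff T q) p
      = -mollify (dirDeriv (0, 1) (dirDeriv (0, 1) (dirDeriv (0, 1) φ))) (cutoff T q) p
        + 3 * mollify (dirDeriv (0, 1) φ) (fun w => cutoff T q w ^ 2) p
        + mollify φ (cutoff T F) p := by
  have hr := hφ.reflect p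
  -- The test function is `φ` reflected about `p`. One and three derivatives both change sign under
  -- reflection, so all derivative terms carry the same sign.
  have key := h.sol.distributional (fun w => φ (p - w)) hr.smooth hr.supp hp
  have e₁ : ∀ w, deriv (fun t => (fun w => φ (p - w)) (t, w.2)) w.1
      = -dirDeriv (1, 0) φ (p - w) := fun w => by
    rw [(dirDeriv_fst hr w).deriv, dirDeriv_reflect hφ]
  have e₂ : ∀ w, deriv (fun x => (fun w => φ (p - w)) (w.1, x)) w.2
      = -dirDeriv (0, 1) φ (p - w) := fun w => by
    rw [(dirDeriv_snd hr w).deriv, dirDeriv_reflect hφ]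
  have e₃ : ∀ w, iteratedDeriv 3 (fun x => (fun w => φ (p - w)) (w.1, x)) w.2
      = -dirDeriv (0, 1) (dirDeriv (0, 1) (dirDeriv (0, 1) φ)) (p - w) := fun w => by
    rw [iteratedDeriv_three_snd hr w, dirDeriv_reflect hφ, dirDeriv_neg, dirDeriv_neg,
      dirDeriv_reflect (hφ.dirDeriv _), dirDeriv_neg, dirDeriv_reflect ((hφ.dirDeriv _).dirDeriv _)]
    simp
  simp only [e₁, e₂, e₃] at key
  have i₁ := (hφ.dirDeriv (1, 0)).integrable_mul h.meas h.bound p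
  have i₃ := (((hφ.dirDeriv (0, 1)).dirDeriv (0, 1)).dirDeriv (0, 1)).integrable_mul h.meas h.bound p
  have j : ∀ u : ℝ × ℝ → ℝ, ∫ w in Ioo (-T) T ×ˢ univ, u w = ∫ w, (slab T).indicator u w :=
    fun u => (integral_indicator (measurableSet_slab T)).symm
  rw [j, j, j] at key
  have k₁ : ∫ w, (slab T).indicator (fun w => (-dirDeriv (1, 0) φ (p - w)
      + -dirDeriv (0, 1) (dirDeriv (0, 1) (dirDeriv (0, 1) φ)) (p - w)) * q w.1 w.2) w
      = -(mollify (dirDeriv (1, 0) φ) (cutoff T q) p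
        + mollify (dirDeriv (0, 1) (dirDeriv (0, 1) (dirDeriv (0, 1) φ))) (cutoff T q) p) := by
    rw [mollify, mollify, ← integral_add i₁ i₃, ← integral_neg]
    refine integral_congr_ae (Eventually.of_forall fun w => ?_)
    by_cases hs : w ∈ slab T
    · simp only [cutoff, indicator_of_mem hs]
      ring
    · simp only [cutoff, indicator_of_notMem hs]
      ring
  have k₂ : ∫ w, (slab T).indicator (fun w => -dirDeriv (0, 1) φ (p - w) * q w.1 w.2 ^ 2) w
      = -mollify (dirDeriv (0, 1) φ) (fun w => cutoff T q w ^ 2) p := by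
    rw [mollify, ← integral_neg]
    refine integral_congr_ae (Eventually.of_forall fun w => ?_)
    by_cases hs : w ∈ slab T
    · simp only [cutoff, indicator_of_mem hs]
      ring
    · simp only [cutoff, indicator_of_notMem hs]
      ring
  have k₃ : ∫ w, (slab T).indicator (fun w => φ (p - w) * F w.1 w.2) w
      = mollify φ (cutoff T F) p := by
    rw [mollify]
    refine integral_congr_ae (Eventually.of_forall fun w => ?_)
    by_cases hs : w ∈ slab T
    · simp only [cutoff, indicator_of_mem hs]
      ring
    · simp only [cutoff, indicator_of_notMem hs]
      ring
  rw [k₁, k₂, k₃] at key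
  linarith

end SlabSolution
end
end

section
open MeasureTheory Set Filter Topology
open scoped ContDiff SchwartzMap ENNReal

noncomputable section

/-! ### Evolution of the diagonal Green's function along mollified solutions -/

/-- The spacetime mollification of `u`. -/
def reg (n : ℕ) (u : ℝ × ℝ → ℝ) (t x : ℝ) : ℝ := mollify (mollifier (ℝ × ℝ) n) u (t, x)

/-- The spatial derivative of the spacetime mollification of `u`. -/
def regX (n : ℕ) (u : ℝ × ℝ → ℝ) (t x : ℝ) : ℝ :=
  mollify (dirDeriv (0, 1) (mollifier (ℝ × ℝ) n)) u (t, x)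

/-- The time derivative of the spacetime mollification of `u`. -/
def regT (n : ℕ) (u : ℝ × ℝ → ℝ) (t x : ℝ) : ℝ :=
  mollify (dirDeriv (1, 0) (mollifier (ℝ × ℝ) n)) u (t, x)

/-- The commutator of squaring and mollification. -/
def regComm (n : ℕ) (u : ℝ × ℝ → ℝ) (t x : ℝ) : ℝ := reg n (fun w => u w ^ 2) t x - reg n u t x ^ 2

/-- The modified forcing of the mollified solution. -/
def regForcing (κ : ℝ) (n : ℕ) (u f : ℝ × ℝ → ℝ) (t x : ℝ) : ℝ :=
  modifiedForcing κ (reg n u t) (reg n f t) x - 6 * commForcing κ (reg n u t) (regComm n u t) x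

section Reg
variable {u : ℝ × ℝ → ℝ} {M : ℝ}

theorem hasDerivAt_mollify_snd {φ : ℝ × ℝ → ℝ} (h : TestFun φ)
    (hu : AEStronglyMeasurable u volume) (hM : ∀ᵐ w, |u w| ≤ M) (t x : ℝ) :
    HasDerivAt (fun x => mollify φ u (t, x)) (mollify (dirDeriv (0, 1) φ) u (t, x)) x :=
  hasDerivAt_mollify h hu hM (γ := fun x => (t, x))
    ((hasDerivAt_const x t).prodMk (hasDerivAt_id x))

theorem hasDerivAt_reg_time (n : ℕ) (hu : AEStronglyMeasurable u volume) (hM : ∀ᵐ w, |u w| ≤ M)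
    (t x : ℝ) : HasDerivAt (fun t => reg n u t x) (regT n u t x) t :=
  hasDerivAt_mollify (testFun_mollifier n) hu hM (γ := fun t => (t, x))
    ((hasDerivAt_id t).prodMk (hasDerivAt_const t x))

theorem continuous_mollify_snd {φ : ℝ × ℝ → ℝ} (h : TestFun φ)
    (hu : AEStronglyMeasurable u volume) (hM : ∀ᵐ w, |u w| ≤ M) (t : ℝ) :
    Continuous (fun x => mollify φ u (t, x)) :=
  (continuous_mollify h hu hM).comp (Continuous.prodMk_right t)

theorem abs_reg_le (n : ℕ) (hM : ∀ᵐ w, |u w| ≤ M) (t x : ℝ) : |reg n u t x| ≤ M :=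
  abs_mollify_mollifier_le hM n _

theorem bddC3_reg (n : ℕ) (hu : AEStronglyMeasurable u volume) (hM : ∀ᵐ w, |u w| ≤ M) (t : ℝ) :
    BddC3 (reg n u t) (regX n u t)
      (fun x => mollify (dirDeriv (0, 1) (dirDeriv (0, 1) (mollifier (ℝ × ℝ) n))) u (t, x))
      (fun x => mollify (dirDeriv (0, 1) (dirDeriv (0, 1) (dirDeriv (0, 1)
        (mollifier (ℝ × ℝ) n)))) u (t, x)) where
  d₀ := hasDerivAt_mollify_snd (testFun_mollifier n) hu hM t
  d₁ := hasDerivAt_mollify_snd ((testFun_mollifier n).dirDeriv _) hu hM t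
  d₂ := hasDerivAt_mollify_snd (((testFun_mollifier n).dirDeriv _).dirDeriv _) hu hM t
  c₃ := continuous_mollify_snd ((((testFun_mollifier n).dirDeriv _).dirDeriv _).dirDeriv _) hu hM t
  bdd := by
    have h₀ := testFun_mollifier (E := ℝ × ℝ) n
    have h₁ := h₀.dirDeriv (0, 1)
    have h₂ := h₁.dirDeriv (0, 1)
    have h₃ := h₂.dirDeriv (0, 1)
    refine ⟨max (max (M * ∫ w, |mollifier (ℝ × ℝ) n w|)
      (M * ∫ w, |dirDeriv (0, 1) (mollifier (ℝ × ℝ) n) w|))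
      (max (M * ∫ w, |dirDeriv (0, 1) (dirDeriv (0, 1) (mollifier (ℝ × ℝ) n)) w|)
        (M * ∫ w, |dirDeriv (0, 1) (dirDeriv (0, 1) (dirDeriv (0, 1)
          (mollifier (ℝ × ℝ) n))) w|)), fun x => ⟨?_, ?_, ?_, ?_⟩⟩
    · exact (abs_mollify_le h₀ hM _).trans ((le_max_left _ _).trans (le_max_left _ _))
    · exact (abs_mollify_le h₁ hM _).trans ((le_max_right _ _).trans (le_max_left _ _))
    · exact (abs_mollify_le h₂ hM _).trans ((le_max_left _ _).trans (le_max_right _ _))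
    · exact (abs_mollify_le h₃ hM _).trans ((le_max_right _ _).trans (le_max_right _ _))

end Reg

/-- The mollifier at `(t, x)` sees only times within `1/(n + 1)` of `t`. Under `ht` these stay in
the open interval, so the extension by zero does not disturb the equation. -/
theorem tsupport_mollifier_reflect {T t : ℝ} {n : ℕ} (ht : |t| + 1 / ((n : ℝ) + 1) < T) (x : ℝ) :
    tsupport (fun w => mollifier (ℝ × ℝ) n ((t, x) - w)) ⊆ slab T := by
  have h1 : tsupport (fun w => mollifier (ℝ × ℝ) n ((t, x) - w))
      ⊆ Metric.closedBall (t, x) (1 / ((n : ℝ) + 1)) := by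
    refine closure_minimal (fun w hw => ?_) Metric.isClosed_closedBall
    have := subset_tsupport (mollifier (ℝ × ℝ) n) (a := (t, x) - w) hw
    rw [tsupport_mollifier, mem_closedBall_zero_iff] at this
    rwa [Metric.mem_closedBall, dist_comm, dist_eq_norm]
  intro w hw
  have h2 := h1 hw
  rw [Metric.mem_closedBall, Prod.dist_eq, max_le_iff, Real.dist_eq] at h2
  obtain ⟨h3, h4⟩ := abs_le.1 h2.1
  obtain ⟨h5, h6⟩ := abs_le.1 (le_refl |t|)
  exact ⟨⟨by simp only at h3; linarith, by simp only at h4; linarith⟩, mem_univ _⟩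

namespace SlabSolution
variable {T κ C : ℝ} {F q : ℝ → ℝ → ℝ} {n : ℕ} {t : ℝ}

theorem adm_reg (h : SlabSolution T κ C F q) (n : ℕ) (t : ℝ) : Adm κ (reg n (cutoff T q) t) :=
  ⟨(bddC3_reg n h.meas h.bound t).c₀.aestronglyMeasurable,
    Eventually.of_forall (abs_reg_le n h.bound t)⟩

theorem abs_regComm_le (h : SlabSolution T κ C F q) (n : ℕ) (t x : ℝ) :
    |regComm n (cutoff T q) t x| ≤ 2 * (κ ^ 2 / 4) ^ 2 := by
  have h1 := abs_reg_le n h.sq_bound t x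
  have h2 : |reg n (cutoff T q) t x ^ 2| ≤ (κ ^ 2 / 4) ^ 2 := by
    rw [abs_pow]
    exact pow_le_pow_left₀ (abs_nonneg _) (abs_reg_le n h.bound t x) 2
  exact (abs_sub _ _).trans (by linarith)

theorem abs_regForcing_le (hκ : 0 < κ) (h : SlabSolution T κ C F q) (n : ℕ) (t x : ℝ) :
    |regForcing κ n (cutoff T q) (cutoff T F) t x|
      ≤ 2 * C / κ ^ 3 + 6 * (2 * (2 * (κ ^ 2 / 4) ^ 2) / κ ^ 2) := by
  have h1 := abs_modifiedForcing_le hκ (h.adm_reg n t) (F := reg n (cutoff T F) t) (C := C)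
    (Eventually.of_forall (abs_reg_le n (Eventually.of_forall h.boundF) t)) x
  have h2 := abs_commForcing_le hκ (h.adm_reg n t)
    (Eventually.of_forall (h.abs_regComm_le n t)) x
  refine (abs_sub _ _).trans ?_
  rw [abs_mul, abs_of_pos (by norm_num : (0 : ℝ) < 6)]
  linarith

theorem regT_eq (h : SlabSolution T κ C F q) (ht : |t| + 1 / ((n : ℝ) + 1) < T) (x : ℝ) :
    regT n (cutoff T q) t x
      = -mollify (dirDeriv (0, 1) (dirDeriv (0, 1) (dirDeriv (0, 1) (mollifier (ℝ × ℝ) n))))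
          (cutoff T q) (t, x)
        + 3 * regX n (fun w => cutoff T q w ^ 2) t x + reg n (cutoff T F) t x :=
  h.mollify_eq (testFun_mollifier n) (tsupport_mollifier_reflect ht x)

/-- Mollification does not commute with squaring; the mismatch is counted as an additional forcing
inside `regForcing`, so that the evolution keeps the shape it has for smooth solutions. -/
theorem neg_integral_green_sq_regT (hκ : 0 < κ) (h : SlabSolution T κ C F q)
    (ht : |t| + 1 / ((n : ℝ) + 1) < T) (x : ℝ) :
    -∫ y, green κ (reg n (cutoff T q) t) y x * green κ (reg n (cutoff T q) t) y x
        * regT n (cutoff T q) t y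
      = -2 * diagGreen κ (reg n (cutoff T q) t) x * regX n (cutoff T q) t x
        + 2 * reg n (cutoff T q) t x * greenSlope κ (reg n (cutoff T q) t) x
        - 4 * κ ^ 2 * greenSlope κ (reg n (cutoff T q) t) x
        - regForcing κ n (cutoff T q) (cutoff T F) t x := by
  have hs := bddC3_reg n h.sq_meas h.sq_bound t
  obtain ⟨B, hB⟩ := hs.bdd
  have hFb : ∀ᵐ w, |cutoff T F w| ≤ C := Eventually.of_forall h.boundF
  have := integral_green_sq_mul_kdv hκ (h.adm_reg n t) (bddC3_reg n h.meas h.bound t) hs.d₀ hs.c₁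
    (C := max B C) (fun z => (hB z).1.trans (le_max_left _ _))
    (fun z => (hB z).2.1.trans (le_max_left _ _)) (bddC3_reg n h.measF hFb t).c₀
    (fun z => (abs_reg_le n hFb t z).trans (le_max_right _ _)) x
  simp only [h.regT_eq ht]
  exact this

theorem hasDerivAt_diagGreen_reg (hκ : 0 < κ) (h : SlabSolution T κ C F q)
    (ht : |t| + 1 / ((n : ℝ) + 1) < T) (x : ℝ) :
    HasDerivAt (fun s => diagGreen κ (reg n (cutoff T q) s) x)
      (-2 * diagGreen κ (reg n (cutoff T q) t) x * regX n (cutoff T q) t x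
        + 2 * reg n (cutoff T q) t x * greenSlope κ (reg n (cutoff T q) t) x
        - 4 * κ ^ 2 * greenSlope κ (reg n (cutoff T q) t) x
        - regForcing κ n (cutoff T q) (cutoff T F) t x) t := by
  rw [← h.neg_integral_green_sq_regT hκ ht x]
  refine hasDerivAt_diagGreen_time hκ (h.adm_reg n) (fun z => hasDerivAt_reg_time n h.meas h.bound t z)
    (C := κ ^ 2 / 4 * ∫ w, |dirDeriv (1, 0) (mollifier (ℝ × ℝ) n) w|) (fun s z => ?_) x
  exact Convex.norm_image_sub_le_of_norm_hasDerivWithin_le (s := univ)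
    (fun r _ => (hasDerivAt_reg_time n h.meas h.bound r z).hasDerivWithinAt)
    (fun r _ => abs_mollify_le ((testFun_mollifier n).dirDeriv _) h.bound _) convex_univ
    (mem_univ _) (mem_univ _)

/-- The continuity is read off from the evolution identity solved for `regForcing`: every other term
is continuous, including the pairing of `G²` with the time derivative, which is a modified forcing
with profile `regT`. No regularity of the commutator integral has to be studied. -/
theorem continuous_regForcing (hκ : 0 < κ) (h : SlabSolution T κ C F q)
    (ht : |t| + 1 / ((n : ℝ) + 1) < T) :
    Continuous (regForcing κ n (cutoff T q) (cutoff T F) t) := by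
  have hq := h.adm_reg n t
  have hb := bddC3_reg n h.meas h.bound t
  have c0 := hb.c₀
  have c1 := hb.c₁
  have c2 := continuous_diagGreen hκ hq
  have c3 := continuous_greenSlope hκ hq
  have c4 : Continuous (modifiedForcing κ (reg n (cutoff T q) t) (regT n (cutoff T q) t)) :=
    continuous_modifiedForcing hκ hq
      (continuous_mollify_snd ((testFun_mollifier n).dirDeriv _) h.meas h.bound t).aestronglyMeasurable
      (Eventually.of_forall fun z => abs_mollify_le ((testFun_mollifier n).dirDeriv _) h.bound _)
  have e : regForcing κ n (cutoff T q) (cutoff T F) t = fun x =>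
      modifiedForcing κ (reg n (cutoff T q) t) (regT n (cutoff T q) t) x
        - 2 * diagGreen κ (reg n (cutoff T q) t) x * regX n (cutoff T q) t x
        + 2 * reg n (cutoff T q) t x * greenSlope κ (reg n (cutoff T q) t) x
        - 4 * κ ^ 2 * greenSlope κ (reg n (cutoff T q) t) x := by
    funext x
    have := h.neg_integral_green_sq_regT hκ ht x
    rw [← modifiedForcing_eq hκ hq] at this
    linarith
  rw [e]
  fun_prop

end SlabSolution

/-! ### The weighted distance along mollified solutions -/

/-- The time derivative of the distance density, as a function of jets and of the spatial
derivatives of the potentials. -/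
def ratePoly (κ : ℝ) (w : (Fin 10 → ℝ) × ℝ × ℝ) : ℝ :=
  (w.1 0 ^ 2 - w.1 1 ^ 2) * (w.1 2 * w.1 3) / 2
    * ((-2 * w.1 0 * w.2.1 + 2 * w.1 6 * w.1 4 - 4 * κ ^ 2 * w.1 4 - w.1 8) * w.1 2
      - (-2 * w.1 1 * w.2.2 + 2 * w.1 7 * w.1 5 - 4 * κ ^ 2 * w.1 5 - w.1 9) * w.1 3)

theorem continuous_ratePoly (κ : ℝ) : Continuous (ratePoly κ) := by
  unfold ratePoly
  fun_prop

theorem distRate_eq_ratePoly {κ : ℝ} {p q p' q' f₁ f₂ : ℝ → ℝ} (x : ℝ) :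
    distRate κ p q p' q' f₁ f₂ x = ratePoly κ (potJet κ p q f₁ f₂ x, p' x, q' x) := by
  simp [distRate, ratePoly, potJet, jet, div_eq_mul_inv]
  left
  ring

theorem exists_bound_ratePoly (κ R : ℝ) : ∃ B, ∀ v a b, ‖v‖ ≤ R → |a| ≤ R → |b| ≤ R →
    |ratePoly κ (v, a, b)| ≤ B := by
  obtain ⟨B, hB⟩ := (isCompact_closedBall (0 : (Fin 10 → ℝ) × ℝ × ℝ) R).exists_bound_of_continuousOn
    (continuous_ratePoly κ).continuousOn
  refine ⟨B, fun v a b hv ha hb => hB _ ?_⟩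
  rw [mem_closedBall_zero_iff, Prod.norm_def, Prod.norm_def]
  exact max_le hv (max_le ha hb)

theorem hasDerivAt_greenDist {p q : ℝ → ℝ → ℝ} {t x p' q' : ℝ}
    (hp : HasDerivAt (fun s => p s x) p' t) (hq : HasDerivAt (fun s => q s x) q' t)
    (np : p t x ≠ 0) (nq : q t x ≠ 0) :
    HasDerivAt (fun s => greenDist (p s) (q s) x)
      ((p t x ^ 2 - q t x ^ 2) / (2 * p t x * q t x) * (p' / p t x - q' / q t x)) t := by
  have h := ((hp.fun_sub hq).fun_pow 2).fun_div ((hp.const_mul 2).fun_mul hq)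
    (mul_ne_zero (mul_ne_zero two_ne_zero np) nq)
  refine h.congr_deriv ?_
  simp only [Nat.cast_ofNat, Nat.reduceSub, pow_one]
  field_simp
  ring

section Pair
variable {T κ C : ℝ} {F₁ F₂ q₁ q₂ : ℝ → ℝ → ℝ}

/-- The weighted distance of the diagonal Green's functions of two potentials. -/
def wdist (κ : ℝ) (ψ p q : ℝ → ℝ) : ℝ := ∫ x, greenDist (diagGreen κ p) (diagGreen κ q) x * ψ x

theorem integrable_greenDist (hκ : 0 < κ) (ψ : 𝓢(ℝ, ℝ)) {p q : ℝ → ℝ} (hp : Adm κ p)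
    (hq : Adm κ q) : Integrable (fun x => greenDist (diagGreen κ p) (diagGreen κ q) x * ψ x) := by
  have := integrable_jetForm_potJet (C := 0) (f₁ := 0) (f₂ := 0) hκ ψ continuous_distCoeff hp hq
    aestronglyMeasurable_zero aestronglyMeasurable_zero (by simp) (by simp)
  refine this.congr (Eventually.of_forall fun _ => ?_)
  exact (greenDist_mul_eq_jetForm 0 0 _ _).symm

/-- The right-hand side of the first identity along mollified solutions. -/
def regRate (κ T : ℝ) (ψ : ℝ → ℝ) (n : ℕ) (F₁ F₂ q₁ q₂ : ℝ → ℝ → ℝ) (t : ℝ) : ℝ :=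
  ∫ x, jetForm (rhsCoeff κ) ψ (potJet κ (reg n (cutoff T q₁) t) (reg n (cutoff T q₂) t)
    (regForcing κ n (cutoff T q₁) (cutoff T F₁) t)
    (regForcing κ n (cutoff T q₂) (cutoff T F₂) t) x) x

theorem hasDerivAt_wdist_reg (hκ : 0 < κ) (ψ : 𝓢(ℝ, ℝ)) (h₁ : SlabSolution T κ C F₁ q₁)
    (h₂ : SlabSolution T κ C F₂ q₂) {n : ℕ} {t : ℝ} (ht : |t| + 1 / ((n : ℝ) + 1) < T) :
    HasDerivAt (fun s => wdist κ ψ (reg n (cutoff T q₁) s) (reg n (cutoff T q₂) s))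
      (regRate κ T ψ n F₁ F₂ q₁ q₂ t) t := by
  set s : Set ℝ := {r | |r| + 1 / ((n : ℝ) + 1) < T} with hs
  have hopen : IsOpen s := isOpen_lt (by fun_prop) continuous_const
  set K := 2 * C / κ ^ 3 + 6 * (2 * (2 * (κ ^ 2 / 4) ^ 2) / κ ^ 2) with hK
  set L := κ ^ 2 / 4 * ∫ w, |dirDeriv (0, 1) (mollifier (ℝ × ℝ) n) w| with hL
  have hX : ∀ {u : ℝ × ℝ → ℝ}, (∀ᵐ w, |u w| ≤ κ ^ 2 / 4) → ∀ r x, |regX n u r x| ≤ L :=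
    fun hu r x => abs_mollify_le ((testFun_mollifier n).dirDeriv _) hu _
  obtain ⟨B, hB⟩ := exists_bound_ratePoly κ (max (jetBound κ K) L)
  set R : ℝ → ℝ → ℝ := fun r x => distRate κ (reg n (cutoff T q₁) r) (reg n (cutoff T q₂) r)
    (regX n (cutoff T q₁) r) (regX n (cutoff T q₂) r)
    (regForcing κ n (cutoff T q₁) (cutoff T F₁) r)
    (regForcing κ n (cutoff T q₂) (cutoff T F₂) r) x with hR
  -- This bound depends on `n` through `L`, since the rate contains spatial derivatives of the
  -- mollified potentials. It only serves to differentiate under the integral; `regRate` is free of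
  -- these derivatives and is bounded uniformly in `n`.
  have hRB : ∀ r x, |R r x| ≤ B := fun r x => by
    rw [hR]
    simp only [distRate_eq_ratePoly]
    refine hB _ _ _ ((norm_potJet_le hκ (h₁.adm_reg n r) (h₂.adm_reg n r)
      (abs_reg_le n h₁.bound r x) (abs_reg_le n h₂.bound r x) (h₁.abs_regForcing_le hκ n r x)
      (h₂.abs_regForcing_le hκ n r x)).trans (le_max_left _ _)) ?_ ?_
    · exact (hX h₁.bound r x).trans (le_max_right _ _)
    · exact (hX h₂.bound r x).trans (le_max_right _ _)
  have hRm : AEStronglyMeasurable (R t) volume := by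
    rw [hR]
    simp only [distRate_eq_ratePoly]
    refine (continuous_ratePoly κ).comp_aestronglyMeasurable ?_
    exact (aestronglyMeasurable_potJet hκ (h₁.adm_reg n t) (h₂.adm_reg n t)
      (h₁.continuous_regForcing hκ ht).aestronglyMeasurable
      (h₂.continuous_regForcing hκ ht).aestronglyMeasurable).prodMk
      ((bddC3_reg n h₁.meas h₁.bound t).c₁.aestronglyMeasurable.prodMk
        (bddC3_reg n h₂.meas h₂.bound t).c₁.aestronglyMeasurable)
  have key := hasDerivAt_integral_of_dominated_loc_of_deriv_le (μ := volume) (x₀ := t) (s := s)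
    (F := fun r x => greenDist (diagGreen κ (reg n (cutoff T q₁) r))
      (diagGreen κ (reg n (cutoff T q₂) r)) x * ψ x) (F' := fun r x => R r x * ψ x)
    (bound := fun x => B * |ψ x|) (hopen.mem_nhds ht)
    (Eventually.of_forall fun r =>
      (integrable_greenDist hκ ψ (h₁.adm_reg n r) (h₂.adm_reg n r)).aestronglyMeasurable)
    (integrable_greenDist hκ ψ (h₁.adm_reg n t) (h₂.adm_reg n t))
    (hRm.mul ψ.continuous.aestronglyMeasurable)
    (Eventually.of_forall fun x r _ => by
      rw [norm_mul]
      exact mul_le_mul_of_nonneg_right (hRB r x) (abs_nonneg _))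
    (ψ.integrable.abs.const_mul B)
    (Eventually.of_forall fun x r hr => HasDerivAt.mul_const
      (hasDerivAt_greenDist (h₁.hasDerivAt_diagGreen_reg hκ hr x)
        (h₂.hasDerivAt_diagGreen_reg hκ hr x) (diagGreen_pos hκ (h₁.adm_reg n r) x).ne'
        (diagGreen_pos hκ (h₂.adm_reg n r) x).ne') (ψ x))
  simp only [mul_comm _ (ψ _)] at key
  have e := integral_distRate hκ ψ (h₁.adm_reg n t) (h₂.adm_reg n t)
    (bddC3_reg n h₁.meas h₁.bound t).d₀ (bddC3_reg n h₂.meas h₂.bound t).d₀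
    (h₁.continuous_regForcing hκ ht).aestronglyMeasurable
    (h₂.continuous_regForcing hκ ht).aestronglyMeasurable
    (h₁.abs_regForcing_le hκ n t) (h₂.abs_regForcing_le hκ n t) key.1
  rw [regRate, ← e]
  simpa only [wdist, mul_comm _ (ψ _)] using key.2

end Pair
end
end

section
open MeasureTheory Set Filter Topology
open scoped ContDiff SchwartzMap ENNReal

noncomputable section

/-! ### Time slices of solutions -/

/-- A function that is continuous in each variable is jointly measurable. -/
theorem aestronglyMeasurable_of_continuous_of_continuousOn {I : Set ℝ} (hI : MeasurableSet I)
    {u : ℝ → ℝ → ℝ} (hx : ∀ t ∈ I, Continuous (u t)) (ht : ∀ x, ContinuousOn (fun t => u t x) I) :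
    AEStronglyMeasurable (fun p : ℝ × ℝ => u p.1 p.2) (volume.restrict (I ×ˢ univ)) := by
  have h1 : StronglyMeasurable (Function.uncurry fun x t => I.indicator (fun t => u t x) t) := by
    refine stronglyMeasurable_uncurry_of_continuous_of_stronglyMeasurable (fun t => ?_) fun x => ?_
    · by_cases h : t ∈ I
      · simpa only [indicator_of_mem h] using hx t h
      · simpa only [indicator_of_notMem h] using continuous_const
    · classical
      have := ((ht x).measurable_piecewise (g := 0) continuousOn_const hI).stronglyMeasurable
      rwa [piecewise_eq_indicator] at this
  refine (h1.comp_measurable measurable_swap).aestronglyMeasurable.congr ?_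
  filter_upwards [ae_restrict_mem (hI.prod .univ)] with p hp
  exact indicator_of_mem hp.1 fun t => u t p.2

namespace SlabSolution
variable {T κ C : ℝ} {F q : ℝ → ℝ → ℝ} {n : ℕ} {t : ℝ}

theorem cutoff_of_mem (u : ℝ → ℝ → ℝ) (ht : t ∈ Ioo (-T) T) (x : ℝ) :
    cutoff T u (t, x) = u t x := indicator_of_mem (show (t, x) ∈ slab T from ⟨ht, mem_univ _⟩) _

theorem mono (h : SlabSolution T κ C F q) {C' : ℝ} (hC : C ≤ C') : SlabSolution T κ C' F q :=
  { h with
    boundF := fun w => (h.boundF w).trans hC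
    boundF' := fun t ht x => (h.boundF' t ht x).trans hC }

theorem ae_slice_bound (h : SlabSolution T κ C F q) :
    ∀ᵐ t, t ∈ Ioo (-T) T → ∀ᵐ x, |q t x| ≤ κ ^ 2 / 4 := by
  filter_upwards [Measure.ae_ae_of_ae_prod h.bound] with t ht hI
  filter_upwards [ht] with x hx
  rwa [cutoff_of_mem q hI] at hx

theorem abs_integral_testFun_le (h : SlabSolution T κ C F q) {ψ : ℝ → ℝ} (hψ : TestFun ψ)
    (ht : t ∈ Ioo (-T) T) : |∫ x, ψ x * q t x| ≤ κ ^ 2 / 4 * ∫ x, |ψ x| := by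
  set c := κ ^ 2 / 4 * ∫ x, |ψ x| with hc
  -- The inequality at almost every time is written as an equality of continuous functions, which
  -- then holds at every time.
  have e : (fun s => max |∫ x, ψ x * q s x| c) =ᵐ[volume.restrict (Ioo (-T) T)] fun _ => c := by
    rw [EventuallyEq, ae_restrict_iff' measurableSet_Ioo]
    filter_upwards [h.ae_slice_bound] with s hs hI
    refine max_eq_right ?_
    rw [hc, ← integral_const_mul, ← Real.norm_eq_abs]
    refine norm_integral_le_of_norm_le (hψ.integrable.abs.const_mul _) ?_
    filter_upwards [hs hI] with x hx
    rw [norm_mul, mul_comm]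
    exact mul_le_mul_of_nonneg_right hx (abs_nonneg _)
  have := Measure.eqOn_open_of_ae_eq e isOpen_Ioo
    ((h.sol.weakStar_continuous ψ hψ.smooth hψ.supp).abs.sup continuousOn_const)
    continuousOn_const ht
  exact max_eq_right_iff.1 this

/-- The spacetime bound controls slices only at almost every time. At the remaining times,
translated mollifiers as test functions bound the mollified slice by `κ²/4`, and the bound passes to
the almost everywhere limit. -/
theorem adm_slice (h : SlabSolution T κ C F q) (ht : t ∈ Ioo (-T) T) : Adm κ (q t) := by
  have hm := h.sol.memLp_slice t ht
  have hb : ∀ᵐ x, |q t x| ≤ (eLpNorm (q t) ∞ volume).toReal := by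
    filter_upwards [ae_le_eLpNormEssSup (f := q t) (μ := volume)] with x hx
    rw [← eLpNorm_exponent_top] at hx
    simpa using ENNReal.toReal_mono hm.eLpNorm_ne_top hx
  refine ⟨hm.aestronglyMeasurable, ?_⟩
  filter_upwards [ae_tendsto_mollify hm.aestronglyMeasurable hb] with x hx
  refine le_of_tendsto hx.abs (Eventually.of_forall fun n => ?_)
  have hφ : TestFun (fun w => mollifier ℝ n (x - w)) :=
    ⟨(testFun_mollifier n).smooth.comp (contDiff_const.sub contDiff_id),
      (testFun_mollifier n).supp.comp_homeomorph (Homeomorph.subLeft x)⟩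
  have := h.abs_integral_testFun_le hφ ht
  rw [integral_sub_left_eq_self (fun w => |mollifier ℝ n w|) volume x, integral_abs_mollifier,
    mul_one] at this
  simpa only [mollify, mul_comm] using this

/-- Continuity is given only against smooth compactly supported weights. These are dense in `L¹`,
and the slices are uniformly bounded. -/
theorem weakTendsto_slice (h : SlabSolution T κ C F q) (t : Ioo (-T) T) :
    WeakTendsto (𝓝 t) (fun s : Ioo (-T) T => q s) (q t) := by
  intro f hf
  -- The summand `1` keeps the denominator positive, as `κ` may vanish here.
  have hA : 0 < κ ^ 2 / 4 + 1 := by positivity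
  rw [Metric.tendsto_nhds]
  intro ε hε
  obtain ⟨g, hg₁, hg₂, hg₃⟩ := MemLp.exist_eLpNorm_sub_le ENNReal.one_ne_top le_rfl
    (memLp_one_iff_integrable.2 hf) (ε := ε / (4 * (κ ^ 2 / 4 + 1))) (by positivity)
  have hg : TestFun g := ⟨hg₂, hg₁⟩
  have hfg : Integrable (fun x => f x - g x) := hf.sub hg.integrable
  have hd : ∫ x, |f x - g x| ≤ ε / (4 * (κ ^ 2 / 4 + 1)) := by
    have h1 := ENNReal.toReal_mono ENNReal.ofReal_ne_top hg₃
    rw [ENNReal.toReal_ofReal (by positivity), eLpNorm_one_eq_lintegral_enorm] at h1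
    rw [← integral_norm_eq_lintegral_enorm (hf.sub hg.integrable).aestronglyMeasurable] at h1
    simpa using h1
  have hs : ∀ s : Ioo (-T) T, |(∫ x, f x * q s x) - ∫ x, g x * q s x| ≤ ε / 4 := by
    intro s
    have hq := h.adm_slice s.2
    have b : ∀ᵐ x, ‖q s x‖ ≤ κ ^ 2 / 4 := hq.bound
    rw [← integral_sub (hf.mul_bdd hq.meas b) (hg.integrable.mul_bdd hq.meas b)]
    have h1 : |∫ x, (f x * q s x - g x * q s x)| ≤ ∫ x, |f x - g x| * (κ ^ 2 / 4) := by
      rw [← Real.norm_eq_abs]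
      refine norm_integral_le_of_norm_le (hfg.abs.mul_const _) ?_
      filter_upwards [b] with x hx
      rw [← sub_mul, norm_mul]
      exact mul_le_mul_of_nonneg_left hx (abs_nonneg _)
    rw [integral_mul_const] at h1
    have h0 : 0 ≤ ∫ x, |f x - g x| := integral_nonneg fun _ => abs_nonneg _
    calc _ ≤ _ := h1
      _ ≤ (∫ x, |f x - g x|) * (κ ^ 2 / 4 + 1) := by nlinarith
      _ ≤ ε / (4 * (κ ^ 2 / 4 + 1)) * (κ ^ 2 / 4 + 1) := mul_le_mul_of_nonneg_right hd hA.le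
      _ = ε / 4 := by field_simp
  have hc := (continuousOn_iff_continuous_domRestrict.1
    (h.sol.weakStar_continuous g hg₂ hg₁)).tendsto t
  rw [Metric.tendsto_nhds] at hc
  filter_upwards [hc (ε / 2) (half_pos hε)] with s h3
  have h1 := abs_le.1 (hs s)
  have h2 := abs_le.1 (hs t)
  rw [Real.dist_eq] at h3 ⊢
  have h4 := abs_lt.1 h3
  simp only [domRestrict_apply] at h4
  rw [abs_lt]
  constructor <;> linarith [h1.1, h1.2, h2.1, h2.2, h4.1, h4.2]

theorem continuous_slice (h : SlabSolution T κ C F q) (ht : t ∈ Ioo (-T) T) :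
    Continuous (F t) :=
  h.contF.comp_continuous (Continuous.prodMk_right t) fun _ => ⟨ht, mem_univ _⟩

theorem tendsto_forcing_slice (h : SlabSolution T κ C F q) (t : Ioo (-T) T) (x : ℝ) :
    Tendsto (fun s : Ioo (-T) T => F s x) (𝓝 t) (𝓝 (F t x)) := by
  have : Continuous fun s : Ioo (-T) T => F s x :=
    h.contF.comp_continuous (f := fun s : Ioo (-T) T => ((s : ℝ), x)) (by fun_prop)
      fun s => ⟨s.2, mem_univ _⟩
  exact this.tendsto t

theorem aestronglyMeasurable_diagGreen (hκ : 0 < κ) (h : SlabSolution T κ C F q) :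
    AEStronglyMeasurable (fun p : ℝ × ℝ => diagGreen κ (q p.1) p.2) (volume.restrict (slab T)) :=
  aestronglyMeasurable_of_continuous_of_continuousOn (u := fun t => diagGreen κ (q t))
    measurableSet_Ioo (fun _ ht => continuous_diagGreen hκ (h.adm_slice ht)) fun x =>
    continuousOn_iff_continuous_domRestrict.2 (continuous_iff_continuousAt.2 fun t =>
      (h.weakTendsto_slice t).tendsto_diagGreen hκ (fun s => h.adm_slice s.2) (h.adm_slice t.2) x)

theorem aestronglyMeasurable_greenSlope (hκ : 0 < κ) (h : SlabSolution T κ C F q) :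
    AEStronglyMeasurable (fun p : ℝ × ℝ => greenSlope κ (q p.1) p.2) (volume.restrict (slab T)) :=
  aestronglyMeasurable_of_continuous_of_continuousOn (u := fun t => greenSlope κ (q t))
    measurableSet_Ioo (fun _ ht => continuous_greenSlope hκ (h.adm_slice ht)) fun x =>
    continuousOn_iff_continuous_domRestrict.2 (continuous_iff_continuousAt.2 fun t =>
      (h.weakTendsto_slice t).tendsto_greenSlope hκ (fun s => h.adm_slice s.2) (h.adm_slice t.2) x)

theorem aestronglyMeasurable_modifiedForcing (hκ : 0 < κ) (h : SlabSolution T κ C F q) :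
    AEStronglyMeasurable (fun p : ℝ × ℝ => modifiedForcing κ (q p.1) (F p.1) p.2)
      (volume.restrict (slab T)) :=
  aestronglyMeasurable_of_continuous_of_continuousOn
    (u := fun t => modifiedForcing κ (q t) (F t)) measurableSet_Ioo
    (fun _ ht => continuous_modifiedForcing hκ (h.adm_slice ht)
      (h.continuous_slice ht).aestronglyMeasurable (Eventually.of_forall (h.boundF' _ ht))) fun x =>
    continuousOn_iff_continuous_domRestrict.2 (continuous_iff_continuousAt.2 fun t =>
      (h.weakTendsto_slice t).tendsto_modifiedForcing hκ (fun s => h.adm_slice s.2)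
        (h.adm_slice t.2) (fun s => (h.continuous_slice s.2).aestronglyMeasurable)
        (fun s => Eventually.of_forall (h.boundF' _ s.2))
        (Eventually.of_forall fun x => h.tendsto_forcing_slice t x) x)

theorem aestronglyMeasurable_potential (h : SlabSolution T κ C F q) :
    AEStronglyMeasurable (fun p : ℝ × ℝ => q p.1 p.2) (volume.restrict (slab T)) :=
  (aestronglyMeasurable_indicator_iff (measurableSet_slab T)).1 h.meas

theorem abs_modifiedForcing_slice_le (hκ : 0 < κ) (h : SlabSolution T κ C F q)
    (ht : t ∈ Ioo (-T) T) (x : ℝ) : |modifiedForcing κ (q t) (F t) x| ≤ 2 * C / κ ^ 3 :=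
  abs_modifiedForcing_le hκ (h.adm_slice ht) (Eventually.of_forall (h.boundF' t ht)) x

theorem greenWellDefined (hκ : 0 < κ) (h : SlabSolution T κ C F q) (ht : t ∈ Ioo (-T) T) :
    GreenWellDefined κ (q t) (F t) := by
  have hq := h.adm_slice ht
  refine ⟨fun l x y => ?_, summable_abs_greenTerm hκ hq, diagGreen_pos hκ hq,
    fun x => (hasDerivAt_diagGreen hκ hq x).differentiableAt, fun x => ?_⟩
  · have h1 := (integrable_freeGreen hκ x).mul_bdd hq.meas hq.bound
    exact h1.mul_bdd (continuous_greenTerm hκ hq l y).aestronglyMeasurable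
      (Eventually.of_forall fun z => abs_greenTerm_le hκ hq l z y)
  · refine (integrable_green_mul_mul_green hκ hq
      (h.continuous_slice ht).aestronglyMeasurable (Eventually.of_forall (h.boundF' t ht)) x).congr
      (Eventually.of_forall fun y => ?_)
    simp only [green_symm hκ hq x y]
    ring

end SlabSolution
end
end

section
open MeasureTheory Set Filter Topology
open scoped ContDiff SchwartzMap ENNReal

noncomputable section

/-! ### The first identity -/

/-- The kernel `G ∂G` is bounded by an integrable exponential uniformly over admissible potentials,
so convergence `r n → 0` suffices and the kernels themselves need not converge. -/
theorem tendsto_commForcing {κ M : ℝ} (hκ : 0 < κ) {p : ℕ → ℝ → ℝ} (hp : ∀ n, Adm κ (p n))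
    (hpc : ∀ n, Continuous (p n)) {r : ℕ → ℝ → ℝ} (hr : ∀ n, AEStronglyMeasurable (r n) volume)
    (hM : ∀ n, ∀ᵐ z, |r n z| ≤ M) (hlim : ∀ᵐ z, Tendsto (fun n => r n z) atTop (𝓝 0)) (x : ℝ) :
    Tendsto (fun n => commForcing κ (p n) (r n) x) atTop (𝓝 0) := by
  have h := tendsto_integral_of_dominated_convergence (μ := volume)
    (F := fun n y => green κ (p n) y x * greenD κ (p n) y x * r n y) (f := fun _ => (0 : ℝ))
    (fun y => 1 / κ * Real.exp (-κ * |x - y|) * M)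
    (fun n => (integrable_green_mul_greenD_mul hκ (hp n) (hpc n) (hr n) (hM n)
      x).aestronglyMeasurable)
    (((integrable_exp_neg_mul_abs_sub hκ x).const_mul _).mul_const _) (fun n => ?_) ?_
  · rw [integral_zero] at h
    exact h
  · filter_upwards [hM n] with y hy
    rw [norm_mul]
    exact mul_le_mul (abs_green_mul_greenD_le hκ (hp n) x y) hy (abs_nonneg _) (by positivity)
  · filter_upwards [hlim] with y hy
    refine squeeze_zero_norm (a := fun n => 1 / κ * Real.exp (-κ * |x - y|) * |r n y|)
      (fun n => ?_) (by simpa using hy.abs.const_mul (1 / κ * Real.exp (-κ * |x - y|)))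
    rw [norm_mul]
    exact mul_le_mul_of_nonneg_right (abs_green_mul_greenD_le hκ (hp n) x y) (abs_nonneg _)

/-- The distance sees the potentials only through the diagonal Green's functions, so weak-*
convergence is enough. The unused jet entries are set to zero to avoid asking for pointwise
convergence of the potentials. -/
theorem tendsto_wdist {κ : ℝ} (hκ : 0 < κ) (ψ : 𝓢(ℝ, ℝ)) {p' q' : ℕ → ℝ → ℝ} {p q : ℝ → ℝ}
    (hp' : ∀ n, Adm κ (p' n)) (hq' : ∀ n, Adm κ (q' n)) (hp : Adm κ p) (hq : Adm κ q)
    (wp : WeakTendsto atTop p' p) (wq : WeakTendsto atTop q' q) :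
    Tendsto (fun n => wdist κ ψ (p' n) (q' n)) atTop (𝓝 (wdist κ ψ p q)) := by
  have e : ∀ a b : ℝ → ℝ, wdist κ ψ a b = ∫ x, jetForm distCoeff ψ
      (jet (diagGreen κ a x) (diagGreen κ b x) 0 0 0 0 0 0) x := fun a b =>
    integral_congr_ae (Eventually.of_forall fun x =>
      greenDist_mul_eq_jetForm (q₁ := 0) (q₂ := 0) 0 0 0 0)
  simp only [e]
  have hb : ∀ a b, Adm κ a → Adm κ b → ∀ x,
      ‖jet (diagGreen κ a x) (diagGreen κ b x) 0 0 0 0 0 0‖ ≤ 2 / (3 * κ) + 3 * κ := by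
    have e₁ : 0 < 2 / (3 * κ) := by positivity
    have h1 : ∀ {r}, Adm κ r → ∀ x, |diagGreen κ r x| ≤ 2 / (3 * κ) + 3 * κ := by
      intro r hr x
      rw [abs_of_pos (diagGreen_pos hκ hr x)]
      linarith [diagGreen_le hκ hr x]
    have h2 : ∀ {r}, Adm κ r → ∀ x, |(diagGreen κ r x)⁻¹| ≤ 2 / (3 * κ) + 3 * κ := by
      intro r hr x
      have h := diagGreen_ge hκ hr x
      rw [abs_of_pos (inv_pos.2 (diagGreen_pos hκ hr x))]
      have : (diagGreen κ r x)⁻¹ ≤ 3 * κ := by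
        rw [inv_le_comm₀ (diagGreen_pos hκ hr x) (by positivity)]
        simpa using h
      linarith
    have h0 : |(0 : ℝ)| ≤ 2 / (3 * κ) + 3 * κ := by
      rw [abs_zero]
      positivity
    exact fun a b ha hb x => norm_jet_le (h1 ha x) (h1 hb x) (h2 ha x) (h2 hb x) h0 h0 h0 h0 h0 h0
  refine tendsto_integral_jetForm ψ continuous_distCoeff (fun n => ?_)
    (fun n => Eventually.of_forall (hb _ _ (hp' n) (hq' n))) (Eventually.of_forall fun x => ?_)
  · exact aestronglyMeasurable_jet (continuous_diagGreen hκ (hp' n)).aestronglyMeasurable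
      (continuous_diagGreen hκ (hq' n)).aestronglyMeasurable aestronglyMeasurable_const
      aestronglyMeasurable_const aestronglyMeasurable_const aestronglyMeasurable_const
      aestronglyMeasurable_const aestronglyMeasurable_const
  · exact tendsto_jet (wp.tendsto_diagGreen hκ hp' hp x) (wq.tendsto_diagGreen hκ hq' hq x)
      (diagGreen_pos hκ hp x).ne' (diagGreen_pos hκ hq x).ne' tendsto_const_nhds
      tendsto_const_nhds tendsto_const_nhds tendsto_const_nhds tendsto_const_nhds
      tendsto_const_nhds

/-- The uniform bound for the modified forcings of mollified solutions. -/
def forcingBound (κ C : ℝ) : ℝ := 2 * C / κ ^ 3 + 6 * (2 * (2 * (κ ^ 2 / 4) ^ 2) / κ ^ 2)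

namespace SlabSolution
variable {T κ C : ℝ} {F q : ℝ → ℝ → ℝ}

/-- Fubini turns almost everywhere convergence in spacetime into convergence on almost every time
slice. The mollified square and the square of the mollification have the same limit, so the
commutator vanishes. -/
theorem ae_tendsto_reg (h : SlabSolution T κ C F q) : ∀ᵐ t, t ∈ Ioo (-T) T →
    (∀ᵐ x, Tendsto (fun n => reg n (cutoff T q) t x) atTop (𝓝 (q t x))) ∧
    (∀ᵐ x, Tendsto (fun n => regComm n (cutoff T q) t x) atTop (𝓝 0)) ∧
    ∀ᵐ x, Tendsto (fun n => reg n (cutoff T F) t x) atTop (𝓝 (F t x)) := by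
  filter_upwards [Measure.ae_ae_of_ae_prod (ae_tendsto_mollify h.meas h.bound),
    Measure.ae_ae_of_ae_prod (ae_tendsto_mollify h.sq_meas h.sq_bound),
    Measure.ae_ae_of_ae_prod (ae_tendsto_mollify h.measF (Eventually.of_forall h.boundF))]
    with t h1 h2 h3 hI
  refine ⟨?_, ?_, ?_⟩
  · filter_upwards [h1] with x hx
    rwa [cutoff_of_mem q hI] at hx
  · filter_upwards [h1, h2] with x hx hx'
    have := hx'.sub (hx.pow 2)
    rw [sub_self] at this
    exact this
  · filter_upwards [h3] with x hx
    rwa [cutoff_of_mem F hI] at hx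

theorem tendsto_regForcing (hκ : 0 < κ) (h : SlabSolution T κ C F q) {t : ℝ}
    (ht : t ∈ Ioo (-T) T)
    (h1 : ∀ᵐ x, Tendsto (fun n => reg n (cutoff T q) t x) atTop (𝓝 (q t x)))
    (h2 : ∀ᵐ x, Tendsto (fun n => regComm n (cutoff T q) t x) atTop (𝓝 0))
    (h3 : ∀ᵐ x, Tendsto (fun n => reg n (cutoff T F) t x) atTop (𝓝 (F t x))) (x : ℝ) :
    Tendsto (fun n => regForcing κ n (cutoff T q) (cutoff T F) t x) atTop
      (𝓝 (modifiedForcing κ (q t) (F t) x)) := by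
  have hF : ∀ᵐ w, |cutoff T F w| ≤ C := Eventually.of_forall h.boundF
  have hw := weakTendsto_of_ae_tendsto (fun n => h.adm_reg n t) h1
  have a := hw.tendsto_modifiedForcing hκ (fun n => h.adm_reg n t) (h.adm_slice ht)
    (F := fun n => reg n (cutoff T F) t) (fun n => (bddC3_reg n h.measF hF t).c₀.aestronglyMeasurable)
    (fun n => Eventually.of_forall (abs_reg_le n hF t)) h3 x
  have hc := fun n => (bddC3_reg n h.meas h.bound t).c₀
  have b := tendsto_commForcing hκ (fun n => h.adm_reg n t) hc
    (r := fun n => regComm n (cutoff T q) t)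
    (fun n => ((bddC3_reg n h.sq_meas h.sq_bound t).c₀.sub ((hc n).pow 2)).aestronglyMeasurable)
    (fun n => Eventually.of_forall (h.abs_regComm_le n t)) h2 x
  have := a.sub (b.const_mul 6)
  rw [mul_zero, sub_zero] at this
  exact this

end SlabSolution

section Pair
variable {T κ C : ℝ} {F₁ F₂ q₁ q₂ : ℝ → ℝ → ℝ}

theorem exists_add_one_div_lt_of_mem {t : ℝ} (ht : t ∈ Ioo (-T) T) :
    ∃ N : ℕ, ∀ n ≥ N, |t| + 1 / ((n : ℝ) + 1) < T := by
  have h : |t| < T := abs_lt.2 ht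
  have := (tendsto_one_div_add_atTop_nhds_zero_nat (𝕜 := ℝ)).eventually_lt_const (sub_pos.2 h)
  obtain ⟨N, hN⟩ := eventually_atTop.1 this
  exact ⟨N, fun n hn => by linarith [hN n hn]⟩

/-- The jets of a pair of solutions. -/
def solJet (κ : ℝ) (F₁ F₂ q₁ q₂ : ℝ → ℝ → ℝ) (t : ℝ) : ℝ → Fin 10 → ℝ :=
  potJet κ (q₁ t) (q₂ t) (modifiedForcing κ (q₁ t) (F₁ t)) (modifiedForcing κ (q₂ t) (F₂ t))

theorem restrict_slab (T : ℝ) : volume.restrict (slab T)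
    = (volume.restrict (Ioo (-T) T)).prod (volume : Measure ℝ) := by
  rw [slab, Measure.volume_eq_prod, ← Measure.prod_restrict, Measure.restrict_univ]

theorem integrable_solJet {c : Fin 4 → (Fin 10 → ℝ) → ℝ} (hκ : 0 < κ) (ψ : 𝓢(ℝ, ℝ))
    (hc : ∀ k, Continuous (c k)) (h₁ : SlabSolution T κ C F₁ q₁) (h₂ : SlabSolution T κ C F₂ q₂) :
    IntegrableOn (fun p : ℝ × ℝ => jetForm c ψ (solJet κ F₁ F₂ q₁ q₂ p.1 p.2) p.2) (slab T) := by
  obtain ⟨B, hB⟩ := exists_bound_coeff hc (jetBound κ (2 * C / κ ^ 3))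
  have hi : IntegrableOn (fun p : ℝ × ℝ => B * envelope ψ p.2) (slab T) := by
    rw [IntegrableOn, restrict_slab]
    exact ((integrable_envelope ψ).const_mul B).comp_snd _
  refine hi.mono' (aestronglyMeasurable_jetForm ψ hc ?_ measurable_snd.aestronglyMeasurable) ?_
  · exact aestronglyMeasurable_jet (h₁.aestronglyMeasurable_diagGreen hκ)
      (h₂.aestronglyMeasurable_diagGreen hκ) (h₁.aestronglyMeasurable_greenSlope hκ)
      (h₂.aestronglyMeasurable_greenSlope hκ) h₁.aestronglyMeasurable_potential
      h₂.aestronglyMeasurable_potential (h₁.aestronglyMeasurable_modifiedForcing hκ)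
      (h₂.aestronglyMeasurable_modifiedForcing hκ)
  · filter_upwards [ae_restrict_mem (measurableSet_slab T), ae_restrict_of_ae h₁.bound,
      ae_restrict_of_ae h₂.bound] with p hp b₁ b₂
    rw [cutoff, indicator_of_mem hp] at b₁ b₂
    exact abs_jetForm_le (hB _ (norm_potJet_le hκ (h₁.adm_slice hp.1) (h₂.adm_slice hp.1) b₁ b₂
      (h₁.abs_modifiedForcing_slice_le hκ hp.1 _) (h₂.abs_modifiedForcing_slice_le hκ hp.1 _))) _

theorem ae_tendsto_regRate (hκ : 0 < κ) (ψ : 𝓢(ℝ, ℝ)) (h₁ : SlabSolution T κ C F₁ q₁)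
    (h₂ : SlabSolution T κ C F₂ q₂) : ∀ᵐ t, t ∈ Ioo (-T) T →
    Tendsto (fun n => regRate κ T ψ n F₁ F₂ q₁ q₂ t) atTop
      (𝓝 (∫ x, jetForm (rhsCoeff κ) ψ (solJet κ F₁ F₂ q₁ q₂ t x) x)) ∧
    Tendsto (fun n => wdist κ ψ (reg n (cutoff T q₁) t) (reg n (cutoff T q₂) t)) atTop
      (𝓝 (wdist κ ψ (q₁ t) (q₂ t))) := by
  filter_upwards [h₁.ae_tendsto_reg, h₂.ae_tendsto_reg] with t k₁ k₂ hI
  obtain ⟨a₁, b₁, c₁⟩ := k₁ hI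
  obtain ⟨a₂, b₂, c₂⟩ := k₂ hI
  have w₁ := weakTendsto_of_ae_tendsto (fun n => h₁.adm_reg n t) a₁
  have w₂ := weakTendsto_of_ae_tendsto (fun n => h₂.adm_reg n t) a₂
  refine ⟨?_, tendsto_wdist hκ ψ (fun n => h₁.adm_reg n t) (fun n => h₂.adm_reg n t)
    (h₁.adm_slice hI) (h₂.adm_slice hI) w₁ w₂⟩
  -- Finitely many terms are dropped: `regForcing` is known to be continuous, hence measurable, only
  -- once the mollifier fits into the time interval.
  obtain ⟨N, hN⟩ := exists_add_one_div_lt_of_mem hI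
  rw [← tendsto_add_atTop_iff_nat N]
  refine tendsto_integral_jetForm ψ (continuous_rhsCoeff κ) (R := jetBound κ (forcingBound κ C))
    (fun n => ?_) (fun n => ?_) ?_
  · exact aestronglyMeasurable_potJet hκ (h₁.adm_reg _ t) (h₂.adm_reg _ t)
      (h₁.continuous_regForcing hκ (hN _ (Nat.le_add_left N n))).aestronglyMeasurable
      (h₂.continuous_regForcing hκ (hN _ (Nat.le_add_left N n))).aestronglyMeasurable
  · exact (h₁.adm_reg _ t).ae_norm_potJet_le hκ (h₂.adm_reg _ t) (h₁.abs_regForcing_le hκ _ t)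
      (h₂.abs_regForcing_le hκ _ t)
  · filter_upwards [a₁, a₂] with x hx hx'
    exact (tendsto_potJet hκ (fun n => h₁.adm_reg n t) (fun n => h₂.adm_reg n t) (h₁.adm_slice hI)
      (h₂.adm_slice hI) w₁ w₂ hx hx' (h₁.tendsto_regForcing hκ hI a₁ b₁ c₁ x)
      (h₂.tendsto_regForcing hκ hI a₂ b₂ c₂ x)).comp (tendsto_add_atTop_nat N)

theorem abs_regRate_le (hκ : 0 < κ) (ψ : 𝓢(ℝ, ℝ)) (h₁ : SlabSolution T κ C F₁ q₁)
    (h₂ : SlabSolution T κ C F₂ q₂) :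
    ∃ B, ∀ n t, |regRate κ T ψ n F₁ F₂ q₁ q₂ t| ≤ B := by
  obtain ⟨B, hB⟩ := exists_bound_coeff (continuous_rhsCoeff κ) (jetBound κ (forcingBound κ C))
  refine ⟨∫ x, B * envelope ψ x, fun n t => ?_⟩
  rw [regRate, ← Real.norm_eq_abs]
  exact norm_integral_le_of_norm_le ((integrable_envelope ψ).const_mul B) (Eventually.of_forall fun x => abs_jetForm_le
      (hB _ (norm_potJet_le hκ (h₁.adm_reg n t) (h₂.adm_reg n t) (abs_reg_le n h₁.bound t x)
        (abs_reg_le n h₂.bound t x) (h₁.abs_regForcing_le hκ n t x)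
        (h₂.abs_regForcing_le hκ n t x))) x)

/-- The first identity between times at which the weighted distance of mollifications converges. -/
theorem wdist_sub_wdist (hκ : 0 < κ) (ψ : 𝓢(ℝ, ℝ)) (h₁ : SlabSolution T κ C F₁ q₁)
    (h₂ : SlabSolution T κ C F₂ q₂) {s t : ℝ} (hs : s ∈ Ioo (-T) T) (ht : t ∈ Ioo (-T) T)
    (ls : Tendsto (fun n => wdist κ ψ (reg n (cutoff T q₁) s) (reg n (cutoff T q₂) s)) atTop
      (𝓝 (wdist κ ψ (q₁ s) (q₂ s))))
    (lt : Tendsto (fun n => wdist κ ψ (reg n (cutoff T q₁) t) (reg n (cutoff T q₂) t)) atTop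
      (𝓝 (wdist κ ψ (q₁ t) (q₂ t)))) :
    wdist κ ψ (q₁ t) (q₂ t) - wdist κ ψ (q₁ s) (q₂ s)
      = ∫ r in s..t, ∫ x, jetForm (rhsCoeff κ) ψ (solJet κ F₁ F₂ q₁ q₂ r x) x := by
  obtain ⟨B, hB⟩ := abs_regRate_le hκ ψ h₁ h₂
  have hsub : uIcc s t ⊆ Ioo (-T) T := (convex_Ioo _ _).ordConnected.uIcc_subset hs ht
  obtain ⟨N₁, hN₁⟩ := exists_add_one_div_lt_of_mem hs
  obtain ⟨N₂, hN₂⟩ := exists_add_one_div_lt_of_mem ht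
  -- The condition defines a symmetric interval of times, so it holds between `s` and `t` once it
  -- holds at both.
  have hgood : ∀ n ≥ max N₁ N₂, ∀ r ∈ uIcc s t, |r| + 1 / ((n : ℝ) + 1) < T := by
    intro n hn r hr
    have a₁ := hN₁ n ((le_max_left _ _).trans hn)
    have a₂ := hN₂ n ((le_max_right _ _).trans hn)
    have hT : r ∈ Ioo (-(T - 1 / ((n : ℝ) + 1))) (T - 1 / ((n : ℝ) + 1)) := by
      refine (convex_Ioo _ _).ordConnected.uIcc_subset ?_ ?_ hr
      · exact abs_lt.1 (by linarith)
      · exact abs_lt.1 (by linarith)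
    linarith [abs_lt.2 hT]
  have hmeas : ∀ n ≥ max N₁ N₂, AEStronglyMeasurable (regRate κ T ψ n F₁ F₂ q₁ q₂)
      (volume.restrict (uIoc s t)) := by
    intro n hn
    -- Measurability in time is free because the rate agrees there with a derivative.
    refine (measurable_deriv (fun r => wdist κ ψ (reg n (cutoff T q₁) r)
      (reg n (cutoff T q₂) r))).aestronglyMeasurable.congr ?_
    filter_upwards [ae_restrict_mem measurableSet_uIoc] with r hr
    exact (hasDerivAt_wdist_reg hκ ψ h₁ h₂ (hgood n hn r (uIoc_subset_uIcc hr))).deriv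
  have hint : ∀ n ≥ max N₁ N₂, ∫ r in s..t, regRate κ T ψ n F₁ F₂ q₁ q₂ r
      = wdist κ ψ (reg n (cutoff T q₁) t) (reg n (cutoff T q₂) t)
        - wdist κ ψ (reg n (cutoff T q₁) s) (reg n (cutoff T q₂) s) := by
    intro n hn
    refine intervalIntegral.integral_eq_sub_of_hasDerivAt
      (fun r hr => hasDerivAt_wdist_reg hκ ψ h₁ h₂ (hgood n hn r hr)) ?_
    exact (intervalIntegrable_const (c := B)).mono_fun' (hmeas n hn)
      (Eventually.of_forall fun r => hB n r)
  refine tendsto_nhds_unique ((lt.sub ls).congr' ?_)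
    (intervalIntegral.tendsto_integral_filter_of_dominated_convergence
      (F := fun n => regRate κ T ψ n F₁ F₂ q₁ q₂) (fun _ => B) ?_
      (Eventually.of_forall fun n => Eventually.of_forall fun r _ => hB n r)
      intervalIntegrable_const ?_)
  · filter_upwards [eventually_ge_atTop (max N₁ N₂)] with n hn using (hint n hn).symm
  · filter_upwards [eventually_ge_atTop (max N₁ N₂)] with n hn using hmeas n hn
  · filter_upwards [ae_tendsto_regRate hκ ψ h₁ h₂] with r hr hr'
    exact (hr (hsub (uIoc_subset_uIcc hr'))).1

/-- Along any convergent sequence of times the slices converge weak-*, which is all that the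
distance requires. -/
theorem continuousOn_wdist (hκ : 0 < κ) (ψ : 𝓢(ℝ, ℝ)) (h₁ : SlabSolution T κ C F₁ q₁)
    (h₂ : SlabSolution T κ C F₂ q₂) :
    ContinuousOn (fun t => wdist κ ψ (q₁ t) (q₂ t)) (Ioo (-T) T) := by
  rw [continuousOn_iff_continuous_domRestrict, continuous_iff_seqContinuous]
  intro u t hu
  exact tendsto_wdist hκ ψ (fun n => h₁.adm_slice (u n).2) (fun n => h₂.adm_slice (u n).2)
    (h₁.adm_slice t.2) (h₂.adm_slice t.2) (fun f hf => (h₁.weakTendsto_slice t f hf).comp hu)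
    (fun f hf => (h₂.weakTendsto_slice t f hf).comp hu)

theorem integrableOn_integral_solJet {c : Fin 4 → (Fin 10 → ℝ) → ℝ} (hκ : 0 < κ) (ψ : 𝓢(ℝ, ℝ))
    (hc : ∀ k, Continuous (c k)) (h₁ : SlabSolution T κ C F₁ q₁) (h₂ : SlabSolution T κ C F₂ q₂) :
    IntegrableOn (fun t => ∫ x, jetForm c ψ (solJet κ F₁ F₂ q₁ q₂ t x) x) (Ioo (-T) T) := by
  have := integrable_solJet hκ ψ hc h₁ h₂
  rw [IntegrableOn, restrict_slab] at this
  exact this.integral_prod_left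

theorem intervalIntegrable_integral_solJet {c : Fin 4 → (Fin 10 → ℝ) → ℝ} (hκ : 0 < κ)
    (ψ : 𝓢(ℝ, ℝ)) (hc : ∀ k, Continuous (c k)) (h₁ : SlabSolution T κ C F₁ q₁)
    (h₂ : SlabSolution T κ C F₂ q₂) {s t : ℝ} (hs : s ∈ Ioo (-T) T) (ht : t ∈ Ioo (-T) T) :
    IntervalIntegrable (fun t => ∫ x, jetForm c ψ (solJet κ F₁ F₂ q₁ q₂ t x) x) volume s t :=
  intervalIntegrable_iff.2 ((integrableOn_integral_solJet hκ ψ hc h₁ h₂).mono_set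
    (uIoc_subset_uIcc.trans ((convex_Ioo _ _).ordConnected.uIcc_subset hs ht)))

/-- The first identity, before the right-hand side is split. -/
theorem wdist_eq_integral (hκ : 0 < κ) (ψ : 𝓢(ℝ, ℝ)) (h₁ : SlabSolution T κ C F₁ q₁)
    (h₂ : SlabSolution T κ C F₂ q₂) (h0 : q₁ 0 =ᵐ[volume] q₂ 0) {t₀ : ℝ}
    (ht₀ : t₀ ∈ Ioo (-T) T) : wdist κ ψ (q₁ t₀) (q₂ t₀)
      = ∫ r in (0 : ℝ)..t₀, ∫ x, jetForm (rhsCoeff κ) ψ (solJet κ F₁ F₂ q₁ q₂ r x) x := by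
  set H : ℝ → ℝ := fun r => ∫ x, jetForm (rhsCoeff κ) ψ (solJet κ F₁ F₂ q₁ q₂ r x) x with hH
  have z : (0 : ℝ) ∈ Ioo (-T) T := ⟨neg_lt_zero.2 h₁.pos, h₁.pos⟩
  have hi : ∀ {s t}, s ∈ Ioo (-T) T → t ∈ Ioo (-T) T → IntervalIntegrable H volume s t :=
    fun hs ht => intervalIntegrable_integral_solJet hκ ψ (continuous_rhsCoeff κ) h₁ h₂ hs ht
  have hae := (ae_restrict_iff' measurableSet_Ioo).2 (ae_tendsto_regRate hκ ψ h₁ h₂)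
  have hne : NeZero (volume.restrict (Ioo (-T) T)) := by
    refine ⟨fun h => ?_⟩
    have := Measure.restrict_eq_zero.1 h
    rw [Real.volume_Ioo, ENNReal.ofReal_eq_zero] at this
    linarith [h₁.pos]
  -- Neither `0` nor `t₀` need be a time at which the mollified distances converge, so a good
  -- reference time `s` is chosen.
  obtain ⟨s, ⟨-, ls⟩, hs⟩ := (hae.and (ae_restrict_mem measurableSet_Ioo)).exists
  set D : ℝ → ℝ := fun t => wdist κ ψ (q₁ t) (q₂ t) - ∫ r in (0 : ℝ)..t, H r with hD
  have hDc : ContinuousOn D (Ioo (-T) T) := by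
    refine (continuousOn_wdist hκ ψ h₁ h₂).sub ?_
    refine fun t ht => ContinuousAt.continuousWithinAt ?_
    -- The compact interval `[-a, a]` contains the base point `0` and is a neighbourhood of `t`, so
    -- continuity of the primitive on it is continuity at `t`.
    obtain ⟨a, ha, hat⟩ := exists_between (abs_lt.2 ht)
    have ha0 : -a ≤ a := by linarith [abs_nonneg t]
    have haI : a ∈ Ioo (-T) T := ⟨by linarith [abs_nonneg t], hat⟩
    have haI' : -a ∈ Ioo (-T) T := ⟨by linarith, by linarith [abs_nonneg t]⟩
    have := intervalIntegral.continuousOn_primitive_interval' (hi haI' haI) (a := 0)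
      (by rw [uIcc_of_le ha0]; constructor <;> linarith [abs_nonneg t])
    refine this.continuousAt ?_
    rw [uIcc_of_le ha0]
    exact Icc_mem_nhds (abs_lt.1 ha).1 (abs_lt.1 ha).2
  have hDs : D =ᵐ[volume.restrict (Ioo (-T) T)] fun _ => D s := by
    filter_upwards [hae, ae_restrict_mem measurableSet_Ioo] with t lt ht
    have e₁ := wdist_sub_wdist hκ ψ h₁ h₂ hs ht ls lt.2
    have e₂ := intervalIntegral.integral_add_adjacent_intervals (hi z hs) (hi hs ht)
    simp only [hD]
    rw [← e₂]
    change _ = ∫ r in s..t, H r at e₁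
    linarith
  -- A continuous function that is constant almost everywhere on an open interval is constant there;
  -- this reaches both `t₀` and `0`.
  have hE := Measure.eqOn_open_of_ae_eq hDs isOpen_Ioo hDc continuousOn_const
  have hD0 : D t₀ = D 0 := (hE ht₀).trans (hE z).symm
  have h00 : wdist κ ψ (q₁ 0) (q₂ 0) = 0 := by
    rw [wdist, diagGreen_congr hκ (h₁.adm_slice z) (h₂.adm_slice z) h0]
    simp [greenDist]
  simp only [hD, h00, intervalIntegral.integral_same] at hD0
  linarith

theorem integrable_slice_solJet {t : ℝ}
    {c : Fin 4 → (Fin 10 → ℝ) → ℝ} (hκ : 0 < κ)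
    (ψ : 𝓢(ℝ, ℝ))
    (h₁ : SlabSolution T κ C F₁ q₁) (h₂ : SlabSolution T κ C F₂ q₂) (hc : ∀ k, Continuous (c k))
    (ht : t ∈ Ioo (-T) T) :
    Integrable (fun x => jetForm c ψ (solJet κ F₁ F₂ q₁ q₂ t x) x) :=
  integrable_jetForm_potJet hκ ψ hc (h₁.adm_slice ht) (h₂.adm_slice ht)
    (continuous_modifiedForcing hκ (h₁.adm_slice ht) (h₁.continuous_slice ht).aestronglyMeasurable
      (Eventually.of_forall (h₁.boundF' t ht))).aestronglyMeasurable
    (continuous_modifiedForcing hκ (h₂.adm_slice ht) (h₂.continuous_slice ht).aestronglyMeasurable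
      (Eventually.of_forall (h₂.boundF' t ht))).aestronglyMeasurable
    (h₁.abs_modifiedForcing_slice_le hκ ht) (h₂.abs_modifiedForcing_slice_le hκ ht)

end Pair
end
end

/-! ### Assembly of the two identities -/

theorem proposition3p1 (T : ℝ) (hT : 0 < T) (κ : ℝ) (hκ : 0 < κ)
    (F₁ F₂ q₁ q₂ : ℝ → ℝ → ℝ)
    -- the forcing terms are smooth and bounded on the spacetime slab
    (hF₁ : ContDiffOn ℝ ∞ (fun p : ℝ × ℝ => F₁ p.1 p.2) (Ioo (-T) T ×ˢ univ))
    (hF₂ : ContDiffOn ℝ ∞ (fun p : ℝ × ℝ => F₂ p.1 p.2) (Ioo (-T) T ×ˢ univ))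
    (hF₁b : ∃ C : ℝ, ∀ t ∈ Ioo (-T) T, ∀ x, |F₁ t x| ≤ C)
    (hF₂b : ∃ C : ℝ, ∀ t ∈ Ioo (-T) T, ∀ x, |F₂ t x| ≤ C)
    (hq₁ : IsForcedKdVSolution (Ioo (-T) T) F₁ q₁)
    (hq₂ : IsForcedKdVSolution (Ioo (-T) T) F₂ q₂)
    (h0 : q₁ 0 =ᵐ[volume] q₂ 0)
    (hκq : 4 * max (spacetimeSupNorm (Ioo (-T) T) q₁) (spacetimeSupNorm (Ioo (-T) T) q₂)
      ≤ κ ^ 2)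
    -- notation: diagonal Green's functions and modified forcings
    (g₁ g₂ f₁ f₂ : ℝ → ℝ → ℝ)
    (hg₁ : ∀ t x, g₁ t x = diagGreen κ (q₁ t) x)
    (hg₂ : ∀ t x, g₂ t x = diagGreen κ (q₂ t) x)
    (hf₁ : ∀ t x, f₁ t x = modifiedForcing κ (q₁ t) (F₁ t) x)
    (hf₂ : ∀ t x, f₂ t x = modifiedForcing κ (q₂ t) (F₂ t) x) :
    -- the objects in the identities exist
    (∀ t ∈ Ioo (-T) T,
      GreenWellDefined κ (q₁ t) (F₁ t) ∧ GreenWellDefined κ (q₂ t) (F₂ t)) ∧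
    ∀ t₀ ∈ Ioo (-T) T, ∀ ψ : 𝓢(ℝ, ℝ),
      -- the first identity, all of whose integrals converge absolutely
      (Integrable (fun x => greenDist (g₁ t₀) (g₂ t₀) x * ψ x) ∧
        IntegrableOn (fun p : ℝ × ℝ =>
          bulkIntegrand κ (q₁ p.1) (q₂ p.1) (g₁ p.1) (g₂ p.1) ψ p.2) (uIoc 0 t₀ ×ˢ univ) ∧
        IntegrableOn (fun p : ℝ × ℝ =>
          fluxIntegrand (q₁ p.1) (q₂ p.1) (g₁ p.1) (g₂ p.1) ψ p.2) (uIoc 0 t₀ ×ˢ univ) ∧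
        IntegrableOn (fun p : ℝ × ℝ =>
          forcingIntegrand (g₁ p.1) (g₂ p.1) (f₁ p.1) (f₂ p.1) ψ p.2) (uIoc 0 t₀ ×ˢ univ) ∧
        ∫ x, greenDist (g₁ t₀) (g₂ t₀) x * ψ x
          = (∫ t in (0 : ℝ)..t₀, ∫ x, bulkIntegrand κ (q₁ t) (q₂ t) (g₁ t) (g₂ t) ψ x)
            + 3 / 2 * (∫ t in (0 : ℝ)..t₀, ∫ x, fluxIntegrand (q₁ t) (q₂ t) (g₁ t) (g₂ t) ψ x)
            - ∫ t in (0 : ℝ)..t₀, ∫ x, forcingIntegrand (g₁ t) (g₂ t) (f₁ t) (f₂ t) ψ x) ∧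
      -- the second identity, at the fixed time `t₀`
      (Integrable (fun x => (q₁ t₀ x - q₂ t₀ x) * ψ x) ∧
        Integrable (fun x => qDiffIntegrand κ (q₁ t₀) (q₂ t₀) (g₁ t₀) (g₂ t₀) ψ x) ∧
        ∫ x, (q₁ t₀ x - q₂ t₀ x) * ψ x
          = 1 / 4 * ∫ x, qDiffIntegrand κ (q₁ t₀) (q₂ t₀) (g₁ t₀) (g₂ t₀) ψ x) := by
  have hsub₁ : 4 * spacetimeSupNorm (Ioo (-T) T) q₁ ≤ κ ^ 2 :=
    (mul_le_mul_of_nonneg_left (le_max_left _ _) (by norm_num)).trans hκq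
  have hsub₂ : 4 * spacetimeSupNorm (Ioo (-T) T) q₂ ≤ κ ^ 2 :=
    (mul_le_mul_of_nonneg_left (le_max_right _ _) (by norm_num)).trans hκq
  obtain ⟨C₁, s₁⟩ := exists_slabSolution hT hF₁ hF₁b hq₁ hsub₁
  obtain ⟨C₂, s₂⟩ := exists_slabSolution hT hF₂ hF₂b hq₂ hsub₂
  -- The results on pairs of solutions use one bound for both forcings.
  replace s₁ := s₁.mono (le_max_left C₁ C₂)
  replace s₂ := s₂.mono (le_max_right C₁ C₂)
  obtain rfl : g₁ = fun t => diagGreen κ (q₁ t) := funext fun t => funext (hg₁ t)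
  obtain rfl : g₂ = fun t => diagGreen κ (q₂ t) := funext fun t => funext (hg₂ t)
  obtain rfl : f₁ = fun t => modifiedForcing κ (q₁ t) (F₁ t) := funext fun t => funext (hf₁ t)
  obtain rfl : f₂ = fun t => modifiedForcing κ (q₂ t) (F₂ t) := funext fun t => funext (hf₂ t)
  refine ⟨fun t ht => ⟨s₁.greenWellDefined hκ ht, s₂.greenWellDefined hκ ht⟩, fun t₀ ht₀ ψ => ?_⟩
  have z : (0 : ℝ) ∈ Ioo (-T) T := ⟨neg_lt_zero.2 hT, hT⟩
  have hJ : uIoc 0 t₀ ⊆ Ioo (-T) T :=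
    uIoc_subset_uIcc.trans ((convex_Ioo _ _).ordConnected.uIcc_subset z ht₀)
  have hJ' : uIoc 0 t₀ ×ˢ univ ⊆ slab T := prod_mono hJ Subset.rfl
  have hJm : MeasurableSet (uIoc 0 t₀ ×ˢ (univ : Set ℝ)) := measurableSet_uIoc.prod .univ
  have eb : ∀ t ∈ Ioo (-T) T, ∀ x, bulkIntegrand κ (q₁ t) (q₂ t) (diagGreen κ (q₁ t))
      (diagGreen κ (q₂ t)) ψ x = jetForm (bulkCoeff κ) ψ (solJet κ F₁ F₂ q₁ q₂ t x) x :=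
    fun t ht x => by
      rw [bulkIntegrand_eq_jetForm (modifiedForcing κ (q₁ t) (F₁ t) x)
        (modifiedForcing κ (q₂ t) (F₂ t) x), deriv_diagGreen hκ (s₁.adm_slice ht),
        deriv_diagGreen hκ (s₂.adm_slice ht)]
      rfl
  have ef : ∀ t ∈ Ioo (-T) T, ∀ x, fluxIntegrand (q₁ t) (q₂ t) (diagGreen κ (q₁ t))
      (diagGreen κ (q₂ t)) ψ x = jetForm fluxCoeff ψ (solJet κ F₁ F₂ q₁ q₂ t x) x :=
    fun t ht x => by
      rw [fluxIntegrand_eq_jetForm (modifiedForcing κ (q₁ t) (F₁ t) x)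
        (modifiedForcing κ (q₂ t) (F₂ t) x), deriv_diagGreen hκ (s₁.adm_slice ht),
        deriv_diagGreen hκ (s₂.adm_slice ht)]
      rfl
  have eF : ∀ t x, forcingIntegrand (diagGreen κ (q₁ t)) (diagGreen κ (q₂ t))
      (modifiedForcing κ (q₁ t) (F₁ t)) (modifiedForcing κ (q₂ t) (F₂ t)) ψ x
      = jetForm forcingCoeff ψ (solJet κ F₁ F₂ q₁ q₂ t x) x :=
    fun t x => forcingIntegrand_eq_jetForm (q₁ := q₁ t) (q₂ := q₂ t) _ _
  have a₁ := s₁.adm_slice ht₀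
  have a₂ := s₂.adm_slice ht₀
  -- The forcings do not occur in the second identity, so their jet entries are zero.
  have eq : ∀ x, qDiffIntegrand κ (q₁ t₀) (q₂ t₀) (diagGreen κ (q₁ t₀)) (diagGreen κ (q₂ t₀)) ψ x
      = jetForm (qDiffCoeff κ) ψ (potJet κ (q₁ t₀) (q₂ t₀) 0 0 x) x := fun x => by
    rw [qDiffIntegrand_eq_jetForm 0 0 (hasDerivAt_diagGreen hκ a₁ x).differentiableAt
      (hasDerivAt_diagGreen hκ a₂ x).differentiableAt (diagGreen_pos hκ a₁ x).ne'
      (diagGreen_pos hκ a₂ x).ne', deriv_diagGreen hκ a₁, deriv_diagGreen hκ a₂]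
    rfl
  have ed : ∀ x, (q₁ t₀ x - q₂ t₀ x) * ψ x
      = jetForm diffCoeff ψ (potJet κ (q₁ t₀) (q₂ t₀) 0 0 x) x := fun x => by
    simp [jetForm, Fin.sum_univ_four, diffCoeff, potJet, jet]
  have i0 : AEStronglyMeasurable (0 : ℝ → ℝ) volume := aestronglyMeasurable_zero
  refine ⟨⟨integrable_greenDist hκ ψ a₁ a₂, ?_, ?_, ?_, ?_⟩, ?_, ?_, ?_⟩
  · refine ((integrable_solJet hκ ψ (continuous_bulkCoeff κ) s₁ s₂).mono_set hJ').congr_fun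
      (fun p hp => (eb p.1 (hJ hp.1) p.2).symm) hJm
  · refine ((integrable_solJet hκ ψ continuous_fluxCoeff s₁ s₂).mono_set hJ').congr_fun
      (fun p hp => (ef p.1 (hJ hp.1) p.2).symm) hJm
  · refine ((integrable_solJet hκ ψ continuous_forcingCoeff s₁ s₂).mono_set hJ').congr_fun
      (fun p _ => (eF p.1 p.2).symm) hJm
  · have main := wdist_eq_integral hκ ψ s₁ s₂ h0 ht₀
    have b₁ : ∫ t in (0 : ℝ)..t₀, ∫ x, bulkIntegrand κ (q₁ t) (q₂ t) (diagGreen κ (q₁ t))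
        (diagGreen κ (q₂ t)) ψ x
        = ∫ t in (0 : ℝ)..t₀, ∫ x, jetForm (bulkCoeff κ) ψ (solJet κ F₁ F₂ q₁ q₂ t x) x :=
      intervalIntegral.integral_congr_ae (Filter.Eventually.of_forall fun t ht => by
        simp only [eb t (hJ ht)])
    have b₂ : ∫ t in (0 : ℝ)..t₀, ∫ x, fluxIntegrand (q₁ t) (q₂ t) (diagGreen κ (q₁ t))
        (diagGreen κ (q₂ t)) ψ x
        = ∫ t in (0 : ℝ)..t₀, ∫ x, jetForm fluxCoeff ψ (solJet κ F₁ F₂ q₁ q₂ t x) x :=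
      intervalIntegral.integral_congr_ae (Filter.Eventually.of_forall fun t ht => by
        simp only [ef t (hJ ht)])
    have j₁ := intervalIntegrable_integral_solJet hκ ψ (continuous_bulkCoeff κ) s₁ s₂ z ht₀
    have j₂ := intervalIntegrable_integral_solJet hκ ψ continuous_fluxCoeff s₁ s₂ z ht₀
    have j₃ := intervalIntegrable_integral_solJet hκ ψ continuous_forcingCoeff s₁ s₂ z ht₀
    simp only [eF, b₁, b₂]
    rw [← intervalIntegral.integral_const_mul, ← intervalIntegral.integral_add j₁ (j₂.const_mul _),
      ← intervalIntegral.integral_sub (j₁.add (j₂.const_mul _)) j₃]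
    refine main.trans ?_
    refine intervalIntegral.integral_congr_ae (Filter.Eventually.of_forall fun t ht => ?_)
    have k₁ := integrable_slice_solJet hκ ψ s₁ s₂ (continuous_bulkCoeff κ) (hJ ht)
    have k₂ := integrable_slice_solJet hκ ψ s₁ s₂ continuous_fluxCoeff (hJ ht)
    have k₃ := integrable_slice_solJet hκ ψ s₁ s₂ continuous_forcingCoeff (hJ ht)
    -- The combined rate splits into the three integrands of the statement, each integrable on the
    -- slice.
    simp only [jetForm_rhsCoeff]
    have k₄ : Integrable (fun x => jetForm (bulkCoeff κ) ψ (solJet κ F₁ F₂ q₁ q₂ t x) x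
        + 3 / 2 * jetForm fluxCoeff ψ (solJet κ F₁ F₂ q₁ q₂ t x) x) := k₁.add (k₂.const_mul _)
    rw [integral_sub k₄ k₃, integral_add k₁ (k₂.const_mul _),
      integral_const_mul]
  · simp only [ed]
    exact integrable_jetForm_potJet (C := 0) hκ ψ continuous_diffCoeff a₁ a₂ i0 i0 (by simp)
      (by simp)
  · simp only [eq]
    exact integrable_jetForm_potJet (C := 0) hκ ψ (continuous_qDiffCoeff κ) a₁ a₂ i0 i0 (by simp)
      (by simp)
  · simp only [ed, eq]
    rw [← integral_qDiff hκ ψ a₁ a₂]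
    ring
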